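/- A map on a closed surface $M$ is an embedding of a finite graph in $M$ (loops and multiple edges are allowed) such that each face is an open disk; equivalently, it is a presentation of $M$ as the result of gluing the sides of finitely many topological polygons in pairs. It is a triangulation, quadrangulation or hexangulation if all its faces are $n$-gons with $n=3,4,6$, respectively (faces may meet themselves). The degree of a vertex is the number of ends of edges at it, so a loop counts twice. For such a map a vertex is called exceptional if its degree differs from $\bar n = 2n/(n-2)$, that is, from $6$, $4$, $3$ for $n=3,4,6$. For $n\in\{3,4,6\}$ let $T_n$ be the edge-to-edge tiling of the plane $\mathbb C$ by regular $n$-gons of side length $1$, with $\bar n$ of them around each vertex. Let $M_3$ be the $1$-vertex triangulation of the torus obtained from two triangles by gluing each side of one to the corresponding side of the other, respecting orientations; let $M_4$ and $M_6$ be the $1$-vertex quadrangulation and the $2$-vertex hexangulation of the torus obtained from one square and one hexagon, respectively, by gluing opposite sides by translations. Theorem. Let $n\in\{3,4,6\}$. Every map $M$ on the torus all of whose faces are $n$-gons and which has no exceptional vertices is a quotient of $T_n$: there are a lattice $\Lambda\subset\mathbb C$ of rank $2$ and a homeomorphism from $\mathbb C/\Lambda$ to the torus that carries the image of $T_n$ (its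 vertices and its graph) to $M$. Moreover, a map on the torus all of whose faces are $n$-gons is such a quotient of $T_n$ if and only if it is a finite cover of $M_n$, that is, if and only if for some integer $d\ge 1$ there is a $d$-sheeted covering map from the torus to the torus under which the preimages of the vertex set and of the graph of $M_n$ are the vertex set and the graph of the map. In particular, every map on the torus all of whose faces are $n$-gons and which has no exceptional vertices is a finite cover of $M_n$. -/

import Mathlib

open scoped Real unitInterval

noncomputable section

namespace TorusMap

/-- The `k`-th corner `exp (2 π i k / n)` of the standard regular `n`-gon. -/
def corner (n : ℕ) (k : ZMod n) : ℂ :=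
  Complex.exp (2 * π * Complex.I * k.val / n)

/-- The standard closed regular `n`-gon in the plane. -/
def Polygon (n : ℕ) : Set ℂ := convexHull ℝ (Set.range (corner n))

/-- The point with parameter `t` on the `k`-th side of the `n`-gon, which runs from corner `k`
(at `t = 0`) to corner `k + 1` (at `t = 1`). -/
def side (n : ℕ) (k : ZMod n) (t : I) : Polygon n :=
  ⟨AffineMap.lineMap (corner n k) (corner n (k + 1)) (t : ℝ),
    (convex_convexHull ℝ _).lineMap_mem (subset_convexHull ℝ _ (Set.mem_range_self k))
      (subset_convexHull ℝ _ (Set.mem_range_self (k + 1))) t.2⟩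

/-- Instructions for gluing the sides of finitely many `n`-gons in pairs. A side is a pair
`(f, k)`, the `k`-th side of the `n`-gon `f`. The side `s` is glued to the side `mate s ≠ s`,
point `t` to point `t`, or, if `rev s` is true, point `t` to point `1 - t`. -/
structure Gluing (n : ℕ) where
  Face : Type
  finite_face : Finite Face
  mate : Face × ZMod n → Face × ZMod n
  rev : Face × ZMod n → Bool
  mate_mate : ∀ s, mate (mate s) = s
  mate_ne : ∀ s, mate s ≠ s
  rev_mate : ∀ s, rev (mate s) = rev s

namespace Gluing

variable {n : ℕ} (G : Gluing n)

/-- The elementary identifications: each point of a side with the corresponding point of the side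
it is glued to. -/
inductive Glued : (Σ _ : G.Face, Polygon n) → (Σ _ : G.Face, Polygon n) → Prop
  | of_side (s : G.Face × ZMod n) (t : I) :
      Glued ⟨s.1, side n s.2 t⟩
        ⟨(G.mate s).1, side n (G.mate s).2 (if G.rev s then σ t else t)⟩

/-- The closed surface obtained from the disjoint union of the `n`-gons by the gluing: the
topological quotient by the equivalence relation that `Glued` generates. -/
abbrev Space : Type := Quot G.Glued

end Gluing

/-- A map on the surface `X` all of whose faces are `n`-gons (a triangulation, quadrangulation or
hexangulation for `n = 3, 4, 6`): a presentation of `X` as the result of gluing the sides of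
finitely many `n`-gons in pairs. Loops, multiple edges and faces that meet themselves are
allowed. -/
structure PolygonalMap (n : ℕ) (X : Type*) [TopologicalSpace X] extends Gluing n where
  homeo : toGluing.Space ≃ₜ X

namespace PolygonalMap

variable {n : ℕ} {X : Type*} [TopologicalSpace X] (m : PolygonalMap n X)

/-- The point of the surface represented by the point `x` of the `n`-gon `f`. -/
def point (f : m.Face) (x : Polygon n) : X := m.homeo (Quot.mk _ ⟨f, x⟩)

/-- The vertices of the map. -/
def vertices : Set X := {x | ∃ f k, m.point f (side n k 0) = x}

/-- The embedded graph (the union of all vertices and edges) of the map. The edges are the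
components of `skeleton \ vertices` and the faces are the components of the complement of
`skeleton`. -/
def skeleton : Set X := {x | ∃ f k t, m.point f (side n k t) = x}

/-- The two ends of a side: `(s, false)` is the end at `t = 0` and `(s, true)` that at `t = 1`. -/
abbrev SideEnd : Type := (m.Face × ZMod n) × Bool

/-- The vertex at an end of a side. -/
def endPoint (e : m.SideEnd) : X := m.point e.1.1 (side n e.1.2 (if e.2 then 1 else 0))

/-- The end of a side to which a given end of a side is glued. -/
def otherEnd (e : m.SideEnd) : m.SideEnd := (m.mate e.1, xor e.2 (m.rev e.1))

/-- The degree of a vertex `v`: the number of ends of edges at `v` (so that a loop counts twice).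
An edge consists of two sides that are glued to each other, so an end of an edge is a pair
`{e, otherEnd e}` of ends of sides. -/
def degree (v : X) : ℕ := {h : Set m.SideEnd | ∃ e, m.endPoint e = v ∧ h = {e, m.otherEnd e}}.ncard

/-- All vertices have the degree `2 n / (n - 2)`, which is `6, 4, 3` for `n = 3, 4, 6`. -/
def NoExceptionalVertices : Prop := ∀ v ∈ m.vertices, m.degree v = 2 * n / (n - 2)

/-- `m` is a finite cover of `m₀`: for some `d ≥ 1` there is a `d`-sheeted covering map of the
underlying surfaces that pulls the graph of `m₀`, with its vertices, back to that of `m`. -/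
def IsFiniteCoverOf {Y : Type*} [TopologicalSpace Y] (m₀ : PolygonalMap n Y) : Prop :=
  ∃ (p : X → Y) (d : ℕ), 0 < d ∧ IsCoveringMap p ∧ (∀ y, (p ⁻¹' {y}).ncard = d) ∧
    p ⁻¹' m₀.vertices = m.vertices ∧ p ⁻¹' m₀.skeleton = m.skeleton

/-- `m` is the quotient, by a lattice of translations, of the tiling of the plane whose vertex set
is `V` and whose graph is `E`: the lattice `Λ` is spanned by `a` and `b`, and a homeomorphism from
`ℂ ⧸ Λ` to the surface carries the image of the tiling to `m`. -/
def IsQuotientOfTiling (V E : Set ℂ) : Prop :=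
  ∃ a b : ℂ, LinearIndependent ℝ ![a, b] ∧
    ∃ h : (ℂ ⧸ AddSubgroup.closure {a, b}) ≃ₜ X,
      (∀ z : ℂ, h (QuotientAddGroup.mk z) ∈ m.vertices ↔ z ∈ V) ∧
      (∀ z : ℂ, h (QuotientAddGroup.mk z) ∈ m.skeleton ↔ z ∈ E)

end PolygonalMap

/-- The torus. -/
abbrev Torus : Type := UnitAddCircle × UnitAddCircle

/-! ### The regular tilings of the plane, with edges of length one -/

/-- The primitive sixth root of unity `exp (π i / 3)`. -/
def zeta : ℂ := Complex.exp (π * Complex.I / 3)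

/-- The vertices of the regular tiling by triangles. -/
def triangularVertices : Set ℂ := {z | ∃ a b : ℤ, z = a + b * zeta}

/-- The vertices of the regular tiling by squares. -/
def squareVertices : Set ℂ := {z | ∃ a b : ℤ, z = a + b * Complex.I}

/-- The vertices of the regular tiling by hexagons: the points of the triangular lattice that are
not in the sublattice of index three generated by `1 + zeta` and `2 - zeta`, whose points are the
centers of the hexagons. -/
def hexagonalVertices : Set ℂ := {z | ∃ a b : ℤ, ¬ a ≡ b [ZMOD 3] ∧ z = a + b * zeta}

/-- The union of all segments that join two points of `V` at distance one: the graph of each of the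
three regular tilings, if `V` is its vertex set. -/
def unitGraph (V : Set ℂ) : Set ℂ := {z | ∃ v ∈ V, ∃ w ∈ V, dist v w = 1 ∧ z ∈ segment ℝ v w}

/-! ### The minimal maps on the torus -/

/-- Two triangles, each side of one glued to the corresponding side of the other (which one may
think of as turned by `180` degrees) so that the orientations match. -/
def triangleGluing : Gluing 3 where
  Face := Bool
  finite_face := inferInstance
  mate s := (!s.1, s.2)
  rev _ := true
  mate_mate := by rintro ⟨_ | _, k⟩ <;> rfl
  mate_ne := by rintro ⟨_ | _, k⟩ <;> simp
  rev_mate _ := rfl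

/-- One square, opposite sides glued by translations. -/
def squareGluing : Gluing 4 where
  Face := Unit
  finite_face := inferInstance
  mate s := (s.1, s.2 + 2)
  rev _ := true
  mate_mate := by decide
  mate_ne := by decide
  rev_mate _ := rfl

/-- One hexagon, opposite sides glued by translations. -/
def hexagonGluing : Gluing 6 where
  Face := Unit
  finite_face := inferInstance
  mate s := (s.1, s.2 + 3)
  rev _ := true
  mate_mate := by decide
  mate_ne := by decide
  rev_mate _ := rfl

end TorusMap

end

noncomputable section

set_option linter.unusedSectionVars false

namespace TorusMap

/-! A map is encoded by its flags (a face, one of its sides, one end of that side) and three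
involutions: `flipEnd` changes the end, `turn` changes the side at the same corner, `cross` changes
the face. `flipEnd` and `cross` commute, `(flipEnd * turn) ^ n = 1`, and the degree of a vertex is
the period of `turn * cross` at its flags (`degree_endPoint`). Without exceptional vertices these
are the relations between the reflections in the sides of a triangle of the barycentric subdivision
of the tiling, so that the flags carry an action of its symmetry group `W`.

Therefore the chart of every flag `s` extends from one tile to a map `q s` of the whole plane, and
replacing `s` by its image under an involution composes `q s` with a reflection (`IsDevelopment`).
No presentation of `W` is needed for this: two words in the involutions play the role of independent
translations, the relations tell how they commute with each other and with the involutions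
(`square_relations`, `hexagonal_relations`), maps of a fundamental domain that match along its
boundary extend equivariantly under the lattice, and the behavior under reflections has to be
checked on the fundamental domain only.

By `moves_of_eq`, two points have the same image only if an element of `W` forces it, so the surface
is the plane modulo the deck group `D` of all elements of `W` compatible with `q s`. This group acts
freely: up to conjugation and taking powers, an element of `W` other than `1` with a fixed point is
one of a few short words in the reflections, and these words move every flag, because the vertex
degrees are exactly right and not proper divisors. So `D` is, up to passing to the opposite group,
the fundamental group, which is commutative for the torus. There are finitely many flags, so `D`
contains a multiple of every lattice translation; an element that commutes with all of these has
trivial linear part. Thus `D` is a lattice of translations.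

For the statement about covers, the translations that preserve the vertices of the tiling form a
lattice, and the minimal map is the quotient by that lattice, since its flags are the positions of a
tile up to translation. Any other quotient of the tiling has a smaller lattice and hence covers the
minimal map. Conversely, the covering of the minimal map by the plane lifts through any finite
cover, and finiteness of the fibers forces the lift to have a lattice of periods. -/

/-! ### Lattices in the plane and their quotients -/

/-- A quotient map whose fibers are the cosets of `Λ` identifies its target with `E ⧸ Λ`. -/
theorem exists_homeomorph_of_isQuotientMap {E X : Type*} [TopologicalSpace E] [AddCommGroup E]
    [TopologicalSpace X] {f : E → X} (hf : Topology.IsQuotientMap f) (Λ : AddSubgroup E)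
    (hΛ : ∀ z w, f z = f w ↔ w - z ∈ Λ) :
    ∃ h : (E ⧸ Λ) ≃ₜ X, ∀ z : E, h (QuotientAddGroup.mk z) = f z := by
  have key (z w : E) : (QuotientAddGroup.mk z : E ⧸ Λ) = QuotientAddGroup.mk w ↔ f z = f w := by
    rw [QuotientAddGroup.eq, hΛ, neg_add_eq_sub]
  let g : E ⧸ Λ → X := Quotient.lift f fun z w hzw ↦ (key z w).1 (Quotient.sound hzw)
  have hg : Continuous g := hf.continuous.quotient_lift _
  have hbij : Function.Bijective g := by
    refine ⟨?_, fun x ↦ ?_⟩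
    · rintro ⟨z⟩ ⟨w⟩ h
      exact (key z w).2 h
    · obtain ⟨z, rfl⟩ := hf.surjective x
      exact ⟨QuotientAddGroup.mk z, rfl⟩
  let e := Equiv.ofBijective g hbij
  refine ⟨⟨e, hg, ?_⟩, fun z ↦ rfl⟩
  rw [hf.continuous_iff]
  have : e.symm ∘ f = (QuotientAddGroup.mk : E → E ⧸ Λ) := by
    funext z
    exact e.symm_apply_eq.2 rfl
  change Continuous (e.symm ∘ f)
  rw [this]
  exact continuous_quotient_mk'

theorem exists_coordinates {a b : ℂ} (hab : LinearIndependent ℝ ![a, b]) :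
    ∃ e : ℂ ≃L[ℝ] ℝ × ℝ, ∀ x y : ℝ, e.symm (x, y) = x • a + y • b := by
  let B := basisOfLinearIndependentOfCardEqFinrank hab (by simp)
  let e : ℂ ≃L[ℝ] ℝ × ℝ := (B.equivFun.trans (LinearEquiv.finTwoArrow ℝ ℝ)).toContinuousLinearEquiv
  refine ⟨e, fun x y ↦ ?_⟩
  rw [ContinuousLinearEquiv.symm_apply_eq]
  have h1 : e a = (1, 0) := by
    have : a = B 0 := by simp [B]
    rw [this]; ext <;> simp [e, LinearEquiv.finTwoArrow]
  have h2 : e b = (0, 1) := by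
    have : b = B 1 := by simp [B]
    rw [this]; ext <;> simp [e, LinearEquiv.finTwoArrow]
  rw [map_add, map_smul, map_smul, h1, h2]
  simp

theorem mem_closure_pair_iff {a b : ℂ} {e : ℂ ≃L[ℝ] ℝ × ℝ}
    (he : ∀ x y : ℝ, e.symm (x, y) = x • a + y • b) {z : ℂ} :
    z ∈ AddSubgroup.closure {a, b} ↔ ∃ i j : ℤ, e z = ((i : ℝ), (j : ℝ)) := by
  rw [AddSubgroup.mem_closure_pair]
  refine exists_congr fun i ↦ exists_congr fun j ↦ ?_
  rw [← ContinuousLinearEquiv.eq_symm_apply, he, eq_comm]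
  simp

theorem isDiscrete_closure_pair {a b : ℂ} (hab : LinearIndependent ℝ ![a, b]) :
    IsDiscrete (AddSubgroup.closure {a, b} : Set ℂ) := by
  let B := basisOfLinearIndependentOfCardEqFinrank hab (by simp)
  have hB : (Submodule.span ℤ (Set.range B)).toAddSubgroup = AddSubgroup.closure {a, b} := by
    rw [Submodule.span_int_eq_addSubgroupClosure]
    congr 1
    simp [B, Set.pair_comm]
  rw [← hB]
  exact ⟨inferInstanceAs (DiscreteTopology (Submodule.span ℤ (Set.range B)))⟩

/-- A subgroup of a lattice that contains multiples of both generators is a lattice. -/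
theorem exists_basis_of_le_lattice {a b : ℂ} (hab : LinearIndependent ℝ ![a, b])
    {Λ : AddSubgroup ℂ} (hΛ : Λ ≤ AddSubgroup.closure {a, b}) {M N : ℤ} (hM : M ≠ 0) (hN : N ≠ 0)
    (hMa : M • a ∈ Λ) (hNb : N • b ∈ Λ) :
    ∃ a' b' : ℂ, LinearIndependent ℝ ![a', b'] ∧ Λ = AddSubgroup.closure {a', b'} := by
  let L : Submodule ℤ ℂ := AddSubgroup.toIntSubmodule Λ
  have hd : DiscreteTopology L := by
    have := isDiscrete_closure_pair hab
    exact (this.mono hΛ).1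
  -- The multiples of `a` and `b` in `Λ` already span the plane over the reals, so the discrete
  -- group `Λ` has full rank and its integral basis is a real one.
  have hspan : Submodule.span ℝ (L : Set ℂ) = ⊤ := by
    obtain ⟨e, he⟩ := exists_coordinates hab
    have ha : a ∈ Submodule.span ℝ (L : Set ℂ) := by
      have : (M : ℝ)⁻¹ • (M • a) ∈ Submodule.span ℝ (L : Set ℂ) :=
        Submodule.smul_mem _ _ (Submodule.subset_span hMa)
      rwa [← Int.cast_smul_eq_zsmul ℝ, smul_smul, inv_mul_cancel₀ (by exact_mod_cast hM),
        one_smul] at this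
    have hb : b ∈ Submodule.span ℝ (L : Set ℂ) := by
      have : (N : ℝ)⁻¹ • (N • b) ∈ Submodule.span ℝ (L : Set ℂ) :=
        Submodule.smul_mem _ _ (Submodule.subset_span hNb)
      rwa [← Int.cast_smul_eq_zsmul ℝ, smul_smul, inv_mul_cancel₀ (by exact_mod_cast hN),
        one_smul] at this
    rw [eq_top_iff]
    intro z _
    have : z = (e z).1 • a + (e z).2 • b := by
      rw [← he]; simp
    rw [this]
    exact add_mem (Submodule.smul_mem _ _ ha) (Submodule.smul_mem _ _ hb)
  have : IsZLattice ℝ L := ⟨hspan⟩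
  have := ZLattice.module_free ℝ L
  have := ZLattice.module_finite ℝ L
  let B : Module.Basis (Fin 2) ℤ L := Module.finBasisOfFinrankEq ℤ L (by
    rw [ZLattice.rank ℝ L]; simp)
  let B' := B.ofZLatticeBasis ℝ L
  refine ⟨B' 0, B' 1, ?_, ?_⟩
  · have : ![B' 0, B' 1] = B' := by
      funext i
      fin_cases i <;> rfl
    rw [this]
    exact B'.linearIndependent
  · have h := B.ofZLatticeBasis_span ℝ L
    have h2 : (Submodule.span ℤ (Set.range B')).toAddSubgroup = Λ := by
      rw [h]; rfl
    rw [← h2, Submodule.span_int_eq_addSubgroupClosure]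
    congr 1
    ext z
    simp [eq_comm]

/-- The standard covering of the torus by the plane. -/
def torusCover : ℝ × ℝ →+ Torus :=
  (QuotientAddGroup.mk' (AddSubgroup.zmultiples (1 : ℝ))).prodMap
    (QuotientAddGroup.mk' (AddSubgroup.zmultiples (1 : ℝ)))

theorem mem_ker_torusCover {z : ℝ × ℝ} :
    torusCover z = 0 ↔ ∃ i j : ℤ, z = ((i : ℝ), (j : ℝ)) := by
  rcases z with ⟨x, y⟩
  have (x : ℝ) : QuotientAddGroup.mk' (AddSubgroup.zmultiples (1 : ℝ)) x = 0 ↔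
      ∃ i : ℤ, x = i := by
    simp only [QuotientAddGroup.mk'_apply, QuotientAddGroup.eq_zero_iff,
      AddSubgroup.mem_zmultiples_iff]
    simp [eq_comm]
  simp only [torusCover, AddMonoidHom.prodMap_def, AddMonoidHom.prod_apply, Prod.mk_eq_zero,
    Prod.mk.injEq]
  erw [this, this]
  simp

theorem isQuotientMap_torusCover : Topology.IsQuotientMap torusCover := by
  have h : IsOpenQuotientMap (QuotientAddGroup.mk' (AddSubgroup.zmultiples (1 : ℝ))) :=
    QuotientAddGroup.isOpenQuotientMap_mk
  exact (h.prodMap h).isQuotientMap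

theorem isDiscrete_ker_torusCover : IsDiscrete (torusCover.ker : Set (ℝ × ℝ)) := by
  rw [isDiscrete_iff_discreteTopology, discreteTopology_subtype_iff']
  rintro ⟨x, y⟩ hxy
  obtain ⟨i, j, hij⟩ := mem_ker_torusCover.1 hxy
  refine ⟨Metric.ball (x, y) 1, Metric.isOpen_ball, ?_⟩
  ext ⟨x', y'⟩
  constructor
  · rintro ⟨hd, hk⟩
    obtain ⟨i', j', hij'⟩ := mem_ker_torusCover.1 hk
    rw [hij, hij', Metric.mem_ball, Prod.dist_eq, max_lt_iff] at hd
    simp only [Int.dist_cast_real] at hd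
    have h1 : i' = i := by
      by_contra hne
      have := Int.pairwise_one_le_dist hne
      linarith [hd.1]
    have h2 : j' = j := by
      by_contra hne
      have := Int.pairwise_one_le_dist hne
      linarith [hd.2]
    rw [hij', hij, h1, h2]; rfl
  · intro h
    rw [Set.mem_singleton_iff] at h
    rw [h]
    exact ⟨Metric.mem_ball_self one_pos, hxy⟩

theorem isAddQuotientCoveringMap_torusCover :
    IsAddQuotientCoveringMap torusCover torusCover.ker :=
  Topology.IsQuotientMap.isAddQuotientCoveringMap_of_isDiscrete_ker_addMonoidHom
    isQuotientMap_torusCover isDiscrete_ker_torusCover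

theorem exists_homeomorph_torus {a b : ℂ} (hab : LinearIndependent ℝ ![a, b]) :
    Nonempty ((ℂ ⧸ AddSubgroup.closure {a, b}) ≃ₜ Torus) := by
  obtain ⟨e, he⟩ := exists_coordinates hab
  obtain ⟨h, -⟩ := exists_homeomorph_of_isQuotientMap
    (isQuotientMap_torusCover.comp e.toHomeomorph.isQuotientMap)
    (AddSubgroup.closure {a, b}) (fun z w ↦ by
      rw [mem_closure_pair_iff he, ← mem_ker_torusCover, map_sub, map_sub, sub_eq_zero, eq_comm]
      rfl)
  exact ⟨h⟩

/-- A group whose action presents the torus as the quotient of a simply connected space is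
commutative. -/
theorem mul_comm_of_isQuotientCoveringMap_torus {E G : Type*} [TopologicalSpace E]
    [SimplyConnectedSpace E] [Group G] [MulAction G E] {f : E → Torus}
    (hf : IsQuotientCoveringMap f G) (g g' : G) : g * g' = g' * g := by
  obtain ⟨z, hz⟩ := hf.surjective 0
  -- Both coverings compute the fundamental group of the torus at `0`: the given one as the opposite
  -- of `G`, the standard one from the commutative kernel of `torusCover`.
  have e1 := hf.fundamentalGroupEquiv (x := (0 : Torus)) ⟨z, hz⟩
  have : SimplyConnectedSpace (ℝ × ℝ) := SimplyConnectedSpace.ofContractible _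
  have e2 := isAddQuotientCoveringMap_torusCover.fundamentalGroupEquiv (x := (0 : Torus))
    ⟨0, map_zero _⟩
  let e := e1.symm.trans e2
  have h : MulOpposite.op g' * MulOpposite.op g = MulOpposite.op g * MulOpposite.op g' := by
    apply e.injective
    rw [map_mul, map_mul, mul_comm]
  exact congrArg MulOpposite.unop h

end TorusMap

namespace TorusMap

/-! ### Quotients of a tiling and their finite covers -/

theorem isLocalHomeomorph_of_homeomorph {a b : ℂ} (hab : LinearIndependent ℝ ![a, b]) {Z : Type*}
    [TopologicalSpace Z] (h : (ℂ ⧸ AddSubgroup.closure {a, b}) ≃ₜ Z) :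
    IsLocalHomeomorph fun z : ℂ ↦ h (QuotientAddGroup.mk z) :=
  (((AddSubgroup.isAddQuotientCoveringMap_of_comm _
    (isDiscrete_closure_pair hab)).isCoveringMap).homeomorph_comp h).isLocalHomeomorph

namespace PolygonalMap

/-- A quotient map from the plane whose fibers are the cosets of a lattice and that carries a tiling
to a map presents the map as a quotient of the tiling. -/
theorem isQuotientOfTiling_of_isQuotientMap {n : ℕ} {X : Type*} [TopologicalSpace X]
    {m : PolygonalMap n X} {V E : Set ℂ} {f : ℂ → X} (hf : Topology.IsQuotientMap f) {a b : ℂ}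
    (hab : LinearIndependent ℝ ![a, b])
    (hΛ : ∀ z w, f z = f w ↔ w - z ∈ AddSubgroup.closure {a, b})
    (hV : ∀ z, f z ∈ m.vertices ↔ z ∈ V) (hE : ∀ z, f z ∈ m.skeleton ↔ z ∈ E) :
    m.IsQuotientOfTiling V E := by
  obtain ⟨h, hh⟩ := exists_homeomorph_of_isQuotientMap hf _ hΛ
  exact ⟨a, b, hab, h, fun z ↦ by rw [hh, hV], fun z ↦ by rw [hh, hE]⟩

/-- A finite cover of a quotient of a tiling is a quotient of the same tiling. -/
theorem IsFiniteCoverOf.isQuotientOfTiling {n : ℕ} {X Y : Type*} [TopologicalSpace X]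
    [PathConnectedSpace X] [TopologicalSpace Y]
    {m : PolygonalMap n X} {m₀ : PolygonalMap n Y} {V E : Set ℂ}
    (hm : m.IsFiniteCoverOf m₀) (hm₀ : m₀.IsQuotientOfTiling V E) : m.IsQuotientOfTiling V E := by
  obtain ⟨p, d, hd, hp, hpd, hpV, hpE⟩ := hm
  obtain ⟨a, b, hab, h₀, hV, hE⟩ := hm₀
  let Λ₀ := AddSubgroup.closure {a, b}
  let Q : ℂ → Y := fun z ↦ h₀ (QuotientAddGroup.mk z)
  have hQ : IsCoveringMap Q :=
    ((AddSubgroup.isAddQuotientCoveringMap_of_comm Λ₀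
      (isDiscrete_closure_pair hab)).isCoveringMap).homeomorph_comp h₀
  have hQΛ (z w : ℂ) : Q z = Q w ↔ w - z ∈ Λ₀ := by
    simp only [Q, h₀.injective.eq_iff, QuotientAddGroup.eq, neg_add_eq_sub, Λ₀]
  have hfin (y : Y) : (p ⁻¹' {y}).Finite := Set.finite_of_ncard_pos (by rw [hpd]; exact hd)
  have hsurj (y : Y) : ∃ x, p x = y := by
    have : (p ⁻¹' {y}).Nonempty := Set.nonempty_of_ncard_ne_zero (by rw [hpd]; exact hd.ne')
    exact this
  obtain ⟨x₀, hx₀⟩ := hsurj (Q 0)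
  have : SimplyConnectedSpace ℂ := SimplyConnectedSpace.ofContractible _
  -- The plane is simply connected, so its covering `Q` of `Y` lifts through the cover `p` to a map
  -- `q` into `X`, which is the presentation sought.
  obtain ⟨q, ⟨hq0, hq⟩, -⟩ := hp.existsUnique_continuousMap_lifts ⟨Q, hQ.continuous⟩ 0 x₀ hx₀
  have hpq (z : ℂ) : p (q z) = Q z := congrFun hq z
  have hopen : IsOpenMap q := by
    refine IsLocalHomeomorph.isOpenMap (IsLocalHomeomorph.of_comp ?_ hp.isLocalHomeomorph q.continuous)
    rw [hq]
    exact hQ.isLocalHomeomorph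
  -- A path in `X` is projected to `Y`, lifted to the plane, and pushed to `X` by `q`; by uniqueness
  -- of lifts this returns the original path.
  have hqsurj : Function.Surjective q := by
    intro x
    obtain ⟨γ⟩ := PathConnectedSpace.joined x₀ x
    have h0 : (⟨p ∘ γ, hp.continuous.comp γ.continuous⟩ : C(I, Y)) 0 = Q 0 := by simp [hx₀]
    obtain ⟨δ, hδ, hδ0⟩ := hQ.exists_path_lifts _ _ h0
    have : q ∘ δ = γ := by
      refine hp.eq_of_comp_eq (q.continuous.comp δ.continuous) γ.continuous ?_ 0 (by simp [hδ0, hq0])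
      rw [← Function.comp_assoc, hq]
      exact hδ
    exact ⟨δ 1, by simpa using congrFun this 1⟩
  have hqm : Topology.IsQuotientMap q := hopen.isQuotientMap q.continuous hqsurj
  -- A coincidence at one point is a period: `q` and its translate are lifts of the same map that
  -- agree somewhere, hence everywhere.
  have hper {z lam : ℂ} (h : q (z + lam) = q z) (w : ℂ) : q (w + lam) = q w := by
    have hlam : lam ∈ Λ₀ := by
      have := congrArg p h
      rw [hpq, hpq, eq_comm, hQΛ] at this
      simpa using this
    have : (fun w ↦ q (w + lam)) = q := by
      refine hp.eq_of_comp_eq (by fun_prop) q.continuous ?_ z h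
      funext w
      simp only [Function.comp_apply, hpq]
      rw [eq_comm, hQΛ]
      simpa using hlam
    exact congrFun this w
  let Λ : AddSubgroup ℂ :=
    { carrier := {lam | ∀ z, q (z + lam) = q z}
      add_mem' := fun {l l'} h h' z ↦ by rw [← add_assoc, h', h]
      zero_mem' := fun z ↦ by rw [add_zero]
      neg_mem' := fun {l} h z ↦ by rw [← h (z + -l), neg_add_cancel_right] }
  have hΛ₀ : Λ ≤ Λ₀ := by
    intro lam h
    have := congrArg p (h 0)
    rw [hpq, hpq, eq_comm, hQΛ] at this
    simpa using this
  -- Pigeonhole principle: the points `q (k • c)` lie in one finite fiber of `p`, so two of them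
  -- agree, and the difference of their multiples of `c` is a period.
  have hmult {c : ℂ} (hc : c ∈ Λ₀) : ∃ N : ℤ, N ≠ 0 ∧ N • c ∈ Λ := by
    have hmaps (k : ℕ) : q (k • c) ∈ p ⁻¹' {Q 0} := by
      change p _ = Q 0
      rw [hpq, eq_comm, hQΛ, sub_zero]
      exact nsmul_mem hc k
    obtain ⟨k, l, hkl, heq⟩ := Set.Finite.exists_lt_map_eq_of_forall_mem hmaps (hfin _)
    refine ⟨(l : ℤ) - k, by omega, fun z ↦ hper (z := k • c) ?_ z⟩
    rw [heq, sub_smul]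
    simp
  obtain ⟨M, hM, hMa⟩ := hmult (c := a) (AddSubgroup.subset_closure (by simp))
  obtain ⟨N, hN, hNb⟩ := hmult (c := b) (AddSubgroup.subset_closure (by simp))
  obtain ⟨a', b', hab', hΛ'⟩ := exists_basis_of_le_lattice hab hΛ₀ hM hN hMa hNb
  refine isQuotientOfTiling_of_isQuotientMap hqm hab' (fun z w ↦ ?_) (fun z ↦ ?_) (fun z ↦ ?_)
  · rw [← hΛ']
    refine ⟨fun h ↦ hper (z := z) ?_, fun h ↦ ?_⟩
    · rw [add_sub_cancel, h]
    · simpa using (h z).symm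
  · rw [← hpV, Set.mem_preimage, hpq, hV]
  · rw [← hpE, Set.mem_preimage, hpq, hE]

/-- If the lattice of one quotient of a tiling contains that of another, then the latter is a
finite cover of the former. -/
theorem isFiniteCoverOf_of_le {n : ℕ} {X Y : Type*} [TopologicalSpace X] [CompactSpace X]
    [T2Space X] [TopologicalSpace Y] [T2Space Y]
    {m : PolygonalMap n X} {m₀ : PolygonalMap n Y} {V E : Set ℂ} {a b a₀ b₀ : ℂ}
    (hab : LinearIndependent ℝ ![a, b]) (hab₀ : LinearIndependent ℝ ![a₀, b₀])
    (hle : AddSubgroup.closure {a, b} ≤ AddSubgroup.closure {a₀, b₀})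
    (h : (ℂ ⧸ AddSubgroup.closure {a, b}) ≃ₜ X) (h₀ : (ℂ ⧸ AddSubgroup.closure {a₀, b₀}) ≃ₜ Y)
    (hV : ∀ z : ℂ, h (QuotientAddGroup.mk z) ∈ m.vertices ↔ z ∈ V)
    (hE : ∀ z : ℂ, h (QuotientAddGroup.mk z) ∈ m.skeleton ↔ z ∈ E)
    (hV₀ : ∀ z : ℂ, h₀ (QuotientAddGroup.mk z) ∈ m₀.vertices ↔ z ∈ V)
    (hE₀ : ∀ z : ℂ, h₀ (QuotientAddGroup.mk z) ∈ m₀.skeleton ↔ z ∈ E) :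
    m.IsFiniteCoverOf m₀ := by
  let Λ := AddSubgroup.closure {a, b}
  let Λ₀ := AddSubgroup.closure {a₀, b₀}
  let ψ : ℂ ⧸ Λ →+ ℂ ⧸ Λ₀ := QuotientAddGroup.map Λ Λ₀ (AddMonoidHom.id ℂ) hle
  let p : X → Y := fun x ↦ h₀ (ψ (h.symm x))
  have hp (z : ℂ) : p (h (QuotientAddGroup.mk z)) = h₀ (QuotientAddGroup.mk z) := by
    simp only [p, h.symm_apply_apply]
    rfl
  have hsurj (x : X) : ∃ z : ℂ, h (QuotientAddGroup.mk z) = x := by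
    obtain ⟨z, hz⟩ := QuotientAddGroup.mk_surjective (h.symm x)
    exact ⟨z, by rw [hz]; simp⟩
  have hplocal : IsLocalHomeomorph p := by
    rw [isLocalHomeomorph_iff_isLocalHomeomorphOn_univ]
    have h1 : IsLocalHomeomorphOn (p ∘ fun z : ℂ ↦ h (QuotientAddGroup.mk z)) Set.univ := by
      rw [← isLocalHomeomorph_iff_isLocalHomeomorphOn_univ]
      have : (p ∘ fun z : ℂ ↦ h (QuotientAddGroup.mk z)) = fun z : ℂ ↦ h₀ (QuotientAddGroup.mk z) :=
        funext hp
      rw [this]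
      exact isLocalHomeomorph_of_homeomorph hab₀ h₀
    have := h1.of_comp_right (isLocalHomeomorph_of_homeomorph hab h).isLocalHomeomorphOn
    rwa [Set.image_univ, Set.range_eq_univ.2 hsurj] at this
  -- Compactness of `X` enters here: a local homeomorphism from a compact Hausdorff space to a
  -- Hausdorff space is a covering map.
  have hpcov : IsCoveringMap p := (isLocalHomeomorph_iff_isCoveringMap.1 hplocal)
  have hψsurj : Function.Surjective ψ := by
    rintro ⟨z⟩
    exact ⟨QuotientAddGroup.mk z, rfl⟩
  -- All fibers of `p` correspond to cosets of the kernel of `ψ`, which gives the same number of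
  -- sheets everywhere. The number is finite because a fiber is compact and discrete.
  have hcard (y : Y) : (p ⁻¹' {y}).ncard = (ψ.ker : Set (ℂ ⧸ Λ)).ncard := by
    obtain ⟨c, hc⟩ := hψsurj (h₀.symm y)
    have : p ⁻¹' {y} = (fun k ↦ h (c + k)) '' (ψ.ker : Set (ℂ ⧸ Λ)) := by
      ext x
      simp only [Set.mem_preimage, Set.mem_singleton_iff, Set.mem_image, SetLike.mem_coe,
        AddMonoidHom.mem_ker, p]
      constructor
      · intro hx
        refine ⟨h.symm x - c, ?_, by simp⟩
        rw [map_sub, hc, ← hx]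
        simp
      · rintro ⟨k, hk, rfl⟩
        simp [hk, hc]
    rw [this]
    refine Set.ncard_image_of_injective _ (h.injective.comp (add_right_injective c))
  have hfinite : (p ⁻¹' {h₀ 0}).Finite := by
    have hclosed : IsClosed (p ⁻¹' {h₀ 0}) := isClosed_singleton.preimage hpcov.continuous
    have := (hpcov (h₀ 0)).discreteTopology_fiber
    exact hclosed.isCompact.finite ⟨this⟩
  refine ⟨p, (ψ.ker : Set (ℂ ⧸ Λ)).ncard, ?_, hpcov, hcard, ?_, ?_⟩
  · rw [← hcard (h₀ 0), Set.ncard_pos hfinite]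
    exact ⟨h 0, by simp [p]⟩
  · ext x
    obtain ⟨z, rfl⟩ := hsurj x
    rw [Set.mem_preimage, hp, hV, hV₀]
  · ext x
    obtain ⟨z, rfl⟩ := hsurj x
    rw [Set.mem_preimage, hp, hE, hE₀]

end PolygonalMap

end TorusMap

namespace TorusMap

open scoped ComplexConjugate

/-! ### The standard polygon and its symmetries -/

section Corner

variable {n : ℕ} [NeZero n]

/-- The corners are the values of an additive character of `ZMod n`; their multiplicativity, norm
and injectivity all come from this. -/
theorem corner_eq_toCircle (k : ZMod n) : corner n k = ZMod.toCircle k := by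
  rw [ZMod.toCircle_apply, corner]

theorem corner_add (k l : ZMod n) : corner n (k + l) = corner n k * corner n l := by
  simp only [corner_eq_toCircle, AddChar.map_add_eq_mul, Circle.coe_mul]

@[simp] theorem corner_zero : corner n 0 = 1 := by
  simp [corner_eq_toCircle]

@[simp] theorem norm_corner (k : ZMod n) : ‖corner n k‖ = 1 := by
  rw [corner_eq_toCircle, Circle.norm_coe]

theorem corner_ne_zero (k : ZMod n) : corner n k ≠ 0 := by
  simp [corner_eq_toCircle]

theorem corner_injective : Function.Injective (corner n) := by
  intro k l h
  simp only [corner_eq_toCircle] at h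
  exact ZMod.injective_toCircle (Circle.coe_injective h)

theorem corner_mul_conj (k : ZMod n) : corner n k * conj (corner n k) = 1 := by
  rw [Complex.mul_conj, Complex.normSq_eq_norm_sq, norm_corner]; simp

theorem conj_corner (k : ZMod n) : conj (corner n k) = corner n (-k) := by
  apply mul_left_cancel₀ (corner_ne_zero k)
  rw [corner_mul_conj, ← corner_add, add_neg_cancel, corner_zero]

/-- The symmetry of the polygon that takes side `0` to side `k`, preserving its direction if
`b = false` and reversing it if `b = true`. -/
def polygonSymmetry (k : ZMod n) (b : Bool) : ℂ →ₗ[ℝ] ℂ :=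
  if b then LinearMap.mulLeft ℝ (corner n (k + 1)) ∘ₗ Complex.conjAe.toLinearMap
  else LinearMap.mulLeft ℝ (corner n k)

@[simp] theorem polygonSymmetry_true (k : ZMod n) (z : ℂ) :
    polygonSymmetry k true z = corner n (k + 1) * conj z := rfl

@[simp] theorem polygonSymmetry_false (k : ZMod n) (z : ℂ) :
    polygonSymmetry k false z = corner n k * z := rfl

theorem norm_polygonSymmetry (k : ZMod n) (b : Bool) (z : ℂ) : ‖polygonSymmetry k b z‖ = ‖z‖ := by
  cases b <;> simp

theorem polygonSymmetry_injective (k : ZMod n) (b : Bool) :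
    Function.Injective (polygonSymmetry k b) := by
  intro z w h
  rw [← sub_eq_zero, ← norm_eq_zero, ← norm_polygonSymmetry k b, map_sub, h, sub_self, norm_zero]

theorem polygonSymmetry_corner (k l : ZMod n) (b : Bool) :
    polygonSymmetry k b (corner n l) = corner n (if b then k + 1 - l else k + l) := by
  cases b
  · simp [corner_add]
  · simp [conj_corner, sub_eq_add_neg, ← corner_add]

/-- Corner `0` and corner `1` suffice. A rotation and a reflection that agree on both would give `2
= 0` in `ZMod n`, which `3 ≤ n` excludes. -/
theorem polygonSymmetry_inj (hn : 3 ≤ n) {k k' : ZMod n} {b b' : Bool}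
    (h : ∀ l, polygonSymmetry k b (corner n l) = polygonSymmetry k' b' (corner n l)) :
    k = k' ∧ b = b' := by
  have h0 := h 0
  have h1 := h 1
  simp only [polygonSymmetry_corner] at h0 h1
  replace h0 := corner_injective h0
  replace h1 := corner_injective h1
  have h2 : (2 : ZMod n) ≠ 0 := by
    intro h
    have : (n : ℕ) ∣ 2 := (ZMod.natCast_eq_zero_iff 2 n).1 (by exact_mod_cast h)
    have := Nat.le_of_dvd (by norm_num) this
    omega
  cases b <;> cases b' <;> simp at h0 h1 ⊢
  · exact h0
  · exact h2 (by linear_combination h1 - h0)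
  · exact h2 (by linear_combination h0 - h1)
  · exact h0

theorem polygonSymmetry_image_polygon (k : ZMod n) (b : Bool) :
    polygonSymmetry k b '' Polygon n = Polygon n := by
  rw [Polygon, LinearMap.image_convexHull, ← Set.range_comp]
  congr 1
  ext z
  simp only [Set.mem_range, Function.comp_apply, polygonSymmetry_corner]
  constructor
  · rintro ⟨l, rfl⟩
    exact ⟨_, rfl⟩
  · rintro ⟨l, rfl⟩
    cases b
    · exact ⟨l - k, by simp⟩
    · exact ⟨k + 1 - l, by simp⟩

theorem polygonSymmetry_mem_polygon {k : ZMod n} {b : Bool} {z : ℂ} :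
    polygonSymmetry k b z ∈ Polygon n ↔ z ∈ Polygon n := by
  conv_lhs => rw [← polygonSymmetry_image_polygon k b]
  exact (polygonSymmetry_injective k b).mem_set_image

theorem coe_side (k : ZMod n) (t : I) :
    (side n k t : ℂ) = corner n k * ((1 - (t : ℝ) : ℝ) + (t : ℝ) * corner n 1) := by
  change AffineMap.lineMap (corner n k) (corner n (k + 1)) (t : ℝ) = _
  rw [AffineMap.lineMap_apply_module, corner_add]
  simp only [Complex.real_smul]
  ring

theorem polygonSymmetry_side (k : ZMod n) (b : Bool) (t : I) :
    polygonSymmetry k b (side n 0 t) = side n k (if b then σ t else t) := by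
  cases b
  · simp [coe_side]
  · simp only [coe_side, polygonSymmetry_true, corner_add, corner_zero, one_mul, map_add, map_mul,
      Complex.conj_ofReal, if_true, unitInterval.coe_symm_eq]
    have := corner_mul_conj (n := n) 1
    push_cast
    linear_combination (corner n k * (t : ℝ)) * this

/-- The center is the average of the corners: their sum is invariant under multiplication by `corner
n 1 ≠ 1` and thus vanishes. -/
theorem zero_mem_polygon (hn : 2 ≤ n) : (0 : ℂ) ∈ Polygon n := by
  have hsum : ∑ k : ZMod n, corner n k = 0 := by
    have h1 : corner n 1 ≠ 1 := by
      rw [← corner_zero (n := n)]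
      intro h
      have := corner_injective h
      have : Fact (1 < n) := ⟨hn⟩
      exact one_ne_zero ‹(1 : ZMod n) = 0›
    have h2 : corner n 1 * ∑ k : ZMod n, corner n k = ∑ k : ZMod n, corner n k := by
      rw [Finset.mul_sum]
      simp only [← corner_add]
      exact Equiv.sum_comp (Equiv.addLeft (1 : ZMod n)) (corner n)
    have h3 : (corner n 1 - 1) * ∑ k : ZMod n, corner n k = 0 := by
      rw [sub_mul, h2, one_mul, sub_self]
    exact (mul_eq_zero.1 h3).resolve_left (sub_ne_zero.2 h1)
  have := (convex_convexHull ℝ (Set.range (corner n))).sum_mem (t := Finset.univ)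
    (w := fun _ : ZMod n ↦ (n : ℝ)⁻¹) (z := corner n) (fun _ _ ↦ by positivity)
    (by simp [ZMod.card, NeZero.ne]) (fun k _ ↦ subset_convexHull ℝ _ (Set.mem_range_self k))
  rwa [← Finset.smul_sum, hsum, smul_zero] at this

theorem neg_half_le_re_corner (hn : 3 ≤ n) : -(1 / 2) ≤ (corner n 1).re := by
  have h1 : Fact (1 < n) := ⟨by omega⟩
  have h3 : (3 : ℝ) ≤ n := by exact_mod_cast hn
  have : corner n 1 = Complex.exp ((2 * π / n : ℝ) * Complex.I) := by
    rw [corner, ZMod.val_one]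
    congr 1
    push_cast
    ring
  rw [this, Complex.exp_ofReal_mul_I_re]
  have hcos : Real.cos (2 * π / 3) = -(1 / 2) := by
    rw [show 2 * π / 3 = π - π / 3 by ring, Real.cos_pi_sub, Real.cos_pi_div_three]
  rw [← hcos]
  apply Real.cos_le_cos_of_nonneg_of_le_pi
  · positivity
  · linarith [Real.pi_pos]
  · gcongr

/-- The inradius is `cos (π / n)`, which is smallest for the triangle, where it equals `1 / 2`. The
bound keeps the points that are glued away from a disk around the center. -/
theorem half_le_norm_side (hn : 3 ≤ n) (k : ZMod n) (t : I) : 1 / 2 ≤ ‖(side n k t : ℂ)‖ := by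
  rw [coe_side, norm_mul, norm_corner, one_mul]
  have hc := neg_half_le_re_corner hn
  have hn1 : (corner n 1).re ^ 2 + (corner n 1).im ^ 2 = 1 := by
    have := Complex.normSq_eq_norm_sq (corner n 1)
    rw [norm_corner, Complex.normSq_apply] at this
    linarith
  refine (sq_le_sq₀ (by norm_num) (norm_nonneg _)).1 ?_
  rw [← Complex.normSq_eq_norm_sq, Complex.normSq_apply]
  simp only [Complex.add_re, Complex.add_im, Complex.ofReal_re, Complex.ofReal_im, Complex.re_ofReal_mul,
    Complex.im_ofReal_mul, zero_add]
  obtain ⟨t, ht0, ht1⟩ := t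
  simp only
  nlinarith [mul_nonneg ht0 (sub_nonneg.2 ht1), sq_nonneg (t - 1 / 2),
    mul_nonneg (mul_nonneg ht0 (sub_nonneg.2 ht1)) (by linarith : 0 ≤ (corner n 1).re + 1 / 2)]

/-- The reflections in the three sides of a triangle of the barycentric subdivision of the standard
polygon: they fix, besides, the middle of side `0`, its initial corner, and all of side `0`. -/
def polygonReflection (n : ℕ) : Fin 3 → ℂ → ℂ :=
  ![fun z ↦ corner n 1 * conj z, fun z ↦ conj z, fun z ↦ 1 + corner n 1 - corner n 1 * conj z]

theorem polygonReflection_two_side (t : I) :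
    polygonReflection n 2 (side n 0 t) = side n 0 t := by
  simp only [polygonReflection, coe_side]
  have := corner_mul_conj (n := n) 1
  simp only [corner_zero, one_mul, map_add, map_mul, Complex.conj_ofReal, Matrix.cons_val]
  push_cast
  linear_combination (-(t : ℝ) : ℂ) * this

end Corner

/-! ### Flags of a gluing -/

namespace Gluing

variable {n : ℕ} [NeZero n] (G : Gluing n)

/-- A flag is a face with one of its sides and one of the two ends of that side. -/
abbrev Flag : Type := (G.Face × ZMod n) × Bool

/-- Replace the end by the other end of the same side. -/
def flipEnd : Equiv.Perm G.Flag :=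
  Function.Involutive.toPerm (fun s ↦ (s.1, !s.2)) fun s ↦ by simp

/-- Replace the side by the other side with the same corner. -/
def turn : Equiv.Perm G.Flag :=
  Function.Involutive.toPerm (fun s ↦ ((s.1.1, if s.2 then s.1.2 + 1 else s.1.2 - 1), !s.2))
    fun s ↦ by rcases s with ⟨⟨f, k⟩, _ | _⟩ <;> simp

/-- Pass to the face on the other side of the edge. -/
def cross : Equiv.Perm G.Flag :=
  Function.Involutive.toPerm (fun s ↦ (G.mate s.1, xor s.2 (G.rev s.1))) fun s ↦ by
    simp [G.mate_mate, G.rev_mate]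

/-- The three involutions of the flags. -/
def flagPerm : Fin 3 → Equiv.Perm G.Flag := ![G.flipEnd, G.turn, G.cross]

theorem flipEnd_apply (s : G.Flag) : G.flipEnd s = (s.1, !s.2) := rfl

theorem turn_apply (s : G.Flag) :
    G.turn s = ((s.1.1, if s.2 then s.1.2 + 1 else s.1.2 - 1), !s.2) := rfl

theorem cross_apply (s : G.Flag) : G.cross s = (G.mate s.1, xor s.2 (G.rev s.1)) := rfl

variable {G}

/-- The standard polygon, moved by the symmetry that belongs to a flag, as a part of the surface. -/
def chart (s : G.Flag) (x : Polygon n) : G.Space :=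
  Quot.mk _ ⟨s.1.1, polygonSymmetry s.1.2 s.2 x, polygonSymmetry_mem_polygon.2 x.2⟩

theorem continuous_chart (s : G.Flag) : Continuous (chart s) := by
  unfold chart
  refine continuous_quot_mk.comp (continuous_sigmaMk.comp ?_)
  exact Continuous.subtype_mk
    ((LinearMap.continuous_of_finiteDimensional _).comp continuous_subtype_val) _

theorem chart_base (f : G.Face) (x : Polygon n) : chart ((f, 0), false) x = Quot.mk _ ⟨f, x⟩ := by
  simp [chart]

theorem chart_side (s : G.Flag) (t : I) :
    chart s (side n 0 t) = Quot.mk _ ⟨s.1.1, side n s.1.2 (if s.2 then σ t else t)⟩ := by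
  unfold chart
  congr 2
  exact Subtype.ext (polygonSymmetry_side _ _ _)

/-- A point near the center of a face is identified with no other point, so faces and positions can
be recovered from points of the quotient. -/
theorem eqvGen_glued (hn : 3 ≤ n) {a b : Σ _ : G.Face, Polygon n} (h : Relation.EqvGen G.Glued a b) :
    a = b ∨ 1 / 2 ≤ ‖(a.2 : ℂ)‖ ∧ 1 / 2 ≤ ‖(b.2 : ℂ)‖ := by
  induction h with
  | rel a b h =>
    obtain ⟨s, t⟩ := h
    exact Or.inr ⟨half_le_norm_side hn _ _, half_le_norm_side hn _ _⟩
  | refl => exact Or.inl rfl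
  | symm a b _ ih => exact ih.imp Eq.symm And.symm
  | trans a b c _ _ ih ih' =>
    rcases ih with rfl | ih
    · exact ih'
    · rcases ih' with rfl | ih'
      · exact Or.inr ih
      · exact Or.inr ⟨ih.1, ih'.2⟩

/-- A flag is determined by its chart. -/
theorem chart_injective (hn : 3 ≤ n) {s s' : G.Flag} (h : ∀ x, chart s x = chart s' x) :
    s = s' := by
  have key (l : ZMod n) : s.1.1 = s'.1.1 ∧ polygonSymmetry s.1.2 s.2 (corner n l) =
      polygonSymmetry s'.1.2 s'.2 (corner n l) := by
    -- The corners shrunk by `1 / 4` lie well inside the disk of radius `1 / 2` where nothing is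
    -- glued, and they still determine a symmetry of the polygon.
    have hmem : ((1 / 4 : ℝ) • corner n l : ℂ) ∈ Polygon n := by
      have := (convex_convexHull ℝ (Set.range (corner n))) (zero_mem_polygon (n := n) (by omega))
        (subset_convexHull ℝ _ (Set.mem_range_self l)) (show (0 : ℝ) ≤ 3 / 4 by norm_num)
        (show (0 : ℝ) ≤ 1 / 4 by norm_num) (by norm_num)
      rwa [smul_zero, zero_add] at this
    have := eqvGen_glued hn (Quot.eqvGen_exact (h ⟨_, hmem⟩))
    rcases this with h' | ⟨h', -⟩
    · have h2 := congrArg (fun a : Σ _ : G.Face, Polygon n ↦ (a.1, (a.2 : ℂ))) h'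
      simp only [Prod.mk.injEq, map_smul] at h2
      exact ⟨h2.1, smul_right_injective ℂ (by norm_num : (1 / 4 : ℝ) ≠ 0) h2.2⟩
    · simp only [norm_polygonSymmetry, norm_smul, norm_corner] at h'
      norm_num at h'
  have hf := (key 0).1
  obtain ⟨⟨f, k⟩, b⟩ := s
  obtain ⟨⟨f', k'⟩, b'⟩ := s'
  simp only at hf
  subst hf
  obtain ⟨rfl, rfl⟩ := polygonSymmetry_inj hn fun l ↦ (key l).2
  rfl

end Gluing

end TorusMap

namespace TorusMap

open scoped ComplexConjugate

/-! ### Developments of a gluing over a tiling of the plane -/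

/-- A tiling of the plane by copies of the standard polygon, given by affine coordinates: `place`
identifies the base tile with the standard polygon. -/
structure TilingModel (n : ℕ) where
  place : ℝ × ℝ ≃ₜ ℂ
  reflection : Fin 3 → Equiv.Perm (ℝ × ℝ)
  place_reflection : ∀ i z, place (reflection i z) = polygonReflection n i (place z)

namespace TilingModel

variable {n : ℕ} [NeZero n] (T : TilingModel n)

/-- The symmetry group of the tiling. -/
def group : Subgroup (Equiv.Perm (ℝ × ℝ)) := Subgroup.closure (Set.range T.reflection)

theorem reflection_mem (i : Fin 3) : T.reflection i ∈ T.group :=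
  Subgroup.subset_closure (Set.mem_range_self i)

theorem reflection_reflection (i : Fin 3) (z : ℝ × ℝ) : T.reflection i (T.reflection i z) = z := by
  apply T.place.injective
  have := corner_mul_conj (n := n) 1
  simp only [T.place_reflection]
  fin_cases i <;> simp [polygonReflection]
  · linear_combination T.place z * this
  · linear_combination (T.place z - 1) * this

theorem continuous_of_mem {g : Equiv.Perm (ℝ × ℝ)} (hg : g ∈ T.group) : Continuous g := by
  have key (i : Fin 3) : Continuous (T.reflection i) := by
    rw [← T.place.comp_continuous_iff]
    have : T.place ∘ T.reflection i = polygonReflection n i ∘ T.place :=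
      funext fun z ↦ T.place_reflection i z
    rw [this]
    refine Continuous.comp ?_ T.place.continuous
    fin_cases i
    · change Continuous fun z ↦ corner n 1 * conj z
      fun_prop
    · change Continuous fun z : ℂ ↦ conj z
      fun_prop
    · change Continuous fun z ↦ 1 + corner n 1 - corner n 1 * conj z
      fun_prop
  -- The inverse is carried along so that the induction passes products and inverses; the generators
  -- are their own inverses.
  have : Continuous g ∧ Continuous (g⁻¹ : Equiv.Perm (ℝ × ℝ)) := by
    induction hg using Subgroup.closure_induction with
    | mem g h =>
      obtain ⟨i, rfl⟩ := h
      refine ⟨key i, ?_⟩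
      have : (T.reflection i)⁻¹ = T.reflection i := by
        ext1 z
        rw [Equiv.Perm.inv_eq_iff_eq, T.reflection_reflection]
      rw [this]
      exact key i
    | one => exact ⟨continuous_id, continuous_id⟩
    | mul g h _ _ ihg ihh =>
      rw [mul_inv_rev]
      exact ⟨ihg.1.comp ihh.1, ihh.2.comp ihg.2⟩
    | inv g _ ih => rw [inv_inv]; exact ih.symm
  exact this.1

end TilingModel

/-- A family of maps of the plane onto the surface that `G` describes, one for every flag: the map
`q s` takes each tile to a face, the base tile as the flag `s` prescribes. -/
structure IsDevelopment {n : ℕ} [NeZero n] (T : TilingModel n) {G : Gluing n}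
    (q : G.Flag → ℝ × ℝ → G.Space) : Prop where
  continuous s : Continuous (q s)
  eq_chart s (x : Polygon n) : q s (T.place.symm x) = G.chart s x
  reflect i s z : q (G.flagPerm i s) z = q s (T.reflection i z)
  exists_mem z : ∃ g ∈ T.group, T.place (g z) ∈ Polygon n

namespace IsDevelopment

open Gluing

variable {n : ℕ} [NeZero n] {T : TilingModel n} {G : Gluing n} {q : G.Flag → ℝ × ℝ → G.Space}
  (hq : IsDevelopment T q)

variable (T q) in
/-- A symmetry of the tiling takes `q s'` and the point `z'` to `q s` and `z`. -/
def Moves (s : G.Flag) (z : ℝ × ℝ) (s' : G.Flag) (z' : ℝ × ℝ) : Prop :=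
  ∃ g ∈ T.group, (∀ y, q s' y = q s (g y)) ∧ g z' = z

theorem Moves.refl (s : G.Flag) (z : ℝ × ℝ) : Moves T q s z s z :=
  ⟨1, one_mem _, fun _ ↦ rfl, rfl⟩

theorem Moves.symm {s s' : G.Flag} {z z' : ℝ × ℝ} (h : Moves T q s z s' z') :
    Moves T q s' z' s z := by
  obtain ⟨g, hg, hq, rfl⟩ := h
  exact ⟨g⁻¹, inv_mem hg, fun y ↦ by rw [hq]; simp, by simp⟩

theorem Moves.trans {s s' s'' : G.Flag} {z z' z'' : ℝ × ℝ} (h : Moves T q s z s' z')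
    (h' : Moves T q s' z' s'' z'') : Moves T q s z s'' z'' := by
  obtain ⟨g, hg, hq, rfl⟩ := h
  obtain ⟨g', hg', hq', rfl⟩ := h'
  exact ⟨g * g', mul_mem hg hg', fun y ↦ by rw [hq', hq]; rfl, rfl⟩

theorem Moves.eq {s s' : G.Flag} {z z' : ℝ × ℝ} (h : Moves T q s z s' z') : q s z = q s' z' := by
  obtain ⟨g, -, hq, rfl⟩ := h
  exact (hq z').symm

include hq

theorem moves_reflection (i : Fin 3) (s : G.Flag) (z : ℝ × ℝ) :
    Moves T q s (T.reflection i z) (G.flagPerm i s) z :=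
  ⟨T.reflection i, T.reflection_mem i, fun y ↦ hq.reflect i s y, rfl⟩

theorem exists_perm {g : Equiv.Perm (ℝ × ℝ)} (hg : g ∈ T.group) :
    ∃ p : Equiv.Perm G.Flag, ∀ s z, q (p s) z = q s (g z) := by
  induction hg using Subgroup.closure_induction with
  | mem g h =>
    obtain ⟨i, rfl⟩ := h
    exact ⟨G.flagPerm i, fun s z ↦ hq.reflect i s z⟩
  | one => exact ⟨1, fun _ _ ↦ rfl⟩
  | mul g h _ _ ihg ihh =>
    obtain ⟨p, hp⟩ := ihg
    obtain ⟨p', hp'⟩ := ihh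
    -- The order is reversed: flags are acted on by precomposition, so that `g ↦ p` behaves like an
    -- antihomomorphism.
    exact ⟨p' * p, fun s z ↦ by rw [Equiv.Perm.mul_apply, hp', hp]; rfl⟩
  | inv g _ ih =>
    obtain ⟨p, hp⟩ := ih
    refine ⟨p⁻¹, fun s z ↦ ?_⟩
    have := hp (p⁻¹ s) (g⁻¹ z)
    simpa using this.symm

theorem exists_moves {g : Equiv.Perm (ℝ × ℝ)} (hg : g ∈ T.group) (s : G.Flag) (z : ℝ × ℝ) :
    ∃ s', Moves T q s z s' (g z) := by
  obtain ⟨p, hp⟩ := hq.exists_perm (inv_mem hg)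
  exact ⟨p s, g⁻¹, inv_mem hg, hp s, by simp⟩

/-- The reflections `0` and `1` preserve the base tile and generate its symmetries. Applied in turn
they lower the number of the side by one, which gives an induction; a reversed flag needs one more
reflection `0`. -/
theorem moves_base (s : G.Flag) (z : ℝ × ℝ) :
    Moves T q s z ((s.1.1, 0), false)
      (T.place.symm (polygonSymmetry s.1.2 s.2 (T.place z))) := by
  have h1 := corner_mul_conj (n := n) 1
  have key (f : G.Face) (k : ℕ) : ∀ z, Moves T q ((f, (k : ZMod n)), false) z ((f, 0), false)
      (T.place.symm (corner n k * T.place z)) := by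
    induction k with
    | zero => intro z; simpa using Moves.refl ((f, 0), false) z
    | succ k ih =>
      intro z
      have m1 := hq.moves_reflection 1 ((f, ((k + 1 : ℕ) : ZMod n)), false) (T.reflection 1 z)
      have m2 := hq.moves_reflection 0 (G.flagPerm 1 ((f, ((k + 1 : ℕ) : ZMod n)), false))
        (T.reflection 0 (T.reflection 1 z))
      rw [T.reflection_reflection] at m1 m2
      have hs : G.flagPerm 0 (G.flagPerm 1 ((f, ((k + 1 : ℕ) : ZMod n)), false)) =
          ((f, (k : ZMod n)), false) := by
        simp [flagPerm, flipEnd_apply, turn_apply]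
      rw [hs] at m2
      have m3 := ih (T.reflection 0 (T.reflection 1 z))
      have hz : corner n (k : ZMod n) * T.place (T.reflection 0 (T.reflection 1 z)) =
          corner n ((k + 1 : ℕ) : ZMod n) * T.place z := by
        rw [T.place_reflection, T.place_reflection]
        simp [polygonReflection, corner_add, mul_assoc]
      rw [hz] at m3
      exact (m1.trans m2).trans m3
  obtain ⟨⟨f, k⟩, b⟩ := s
  have hk : ((k.val : ℕ) : ZMod n) = k := ZMod.natCast_zmod_val k
  cases b
  · have := key f k.val z
    rwa [hk] at this
  · have m1 := hq.moves_reflection 0 ((f, k), true) (T.reflection 0 z)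
    rw [T.reflection_reflection] at m1
    have m2 := key f k.val (T.reflection 0 z)
    rw [hk] at m2
    have hz : corner n k * T.place (T.reflection 0 z) =
        polygonSymmetry k true (T.place z) := by
      rw [T.place_reflection]
      simp [polygonReflection, corner_add, mul_assoc]
    rw [hz] at m2
    exact m1.trans m2

/-- Every elementary identification is the effect of reflection `2`, which passes to the neighboring
face and fixes side `0` pointwise. -/
theorem moves_of_eqvGen {a b : Σ _ : G.Face, Polygon n} (h : Relation.EqvGen G.Glued a b) :
    Moves T q ((a.1, 0), false) (T.place.symm a.2) ((b.1, 0), false) (T.place.symm b.2) := by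
  induction h with
  | rel a b h =>
    obtain ⟨s, t⟩ := h
    have m1 := hq.moves_base (s, false) (T.place.symm (side n 0 t))
    have m2 := hq.moves_reflection 2 (s, false) (T.place.symm (side n 0 t))
    have hz : T.reflection 2 (T.place.symm (side n 0 t)) = T.place.symm (side n 0 t) := by
      apply T.place.injective
      rw [T.place_reflection, T.place.apply_symm_apply, polygonReflection_two_side]
    rw [hz] at m2
    have m3 := hq.moves_base (G.flagPerm 2 (s, false)) (T.place.symm (side n 0 t))
    have m := (m1.symm.trans m2).trans m3
    rw [T.place.apply_symm_apply, polygonSymmetry_side, polygonSymmetry_side] at m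
    simpa [flagPerm, Gluing.cross_apply] using m
  | refl => exact Moves.refl _ _
  | symm a b _ ih => exact ih.symm
  | trans a b c _ _ ih ih' => exact ih.trans ih'

theorem exists_moves_polygon (s : G.Flag) (z : ℝ × ℝ) :
    ∃ s', ∃ x : Polygon n, Moves T q s z s' (T.place.symm x) := by
  obtain ⟨g, hg, hgz⟩ := hq.exists_mem z
  obtain ⟨s', h⟩ := hq.exists_moves hg s z
  exact ⟨s', ⟨_, hgz⟩, by simpa using h⟩

/-- This is the key property of a development: it makes no identifications except those due to
symmetries. Both points are moved to the base tile, where equality in the surface is a chain of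
elementary gluings. -/
theorem moves_of_eq {s s' : G.Flag} {z z' : ℝ × ℝ} (h : q s z = q s' z') : Moves T q s z s' z' := by
  obtain ⟨s₁, x, m⟩ := hq.exists_moves_polygon s z
  obtain ⟨s₂, y, m'⟩ := hq.exists_moves_polygon s' z'
  rw [m.eq, m'.eq, hq.eq_chart, hq.eq_chart] at h
  have m₁ := hq.moves_of_eqvGen (Quot.eqvGen_exact h)
  have b₁ := hq.moves_base s₁ (T.place.symm x)
  have b₂ := hq.moves_base s₂ (T.place.symm y)
  rw [T.place.apply_symm_apply] at b₁ b₂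
  exact (((m.trans b₁).trans m₁).trans b₂.symm).trans m'.symm

/-- Consequently, whether a symmetry is compatible with `q s` can be read off the permutation of the
flags: it has to fix `s`. -/
theorem injective (hn : 3 ≤ n) : Function.Injective q := by
  intro s s' h
  refine chart_injective hn fun x ↦ ?_
  rw [← hq.eq_chart, ← hq.eq_chart, h]

theorem base_eq (a : Σ _ : G.Face, Polygon n) :
    q ((a.1, 0), false) (T.place.symm a.2) = Quot.mk _ a := by
  rw [hq.eq_chart, chart_base]

/-- By `moves_of_eq`, a face that meets the image lies in it. So the image and its complement are
unions of faces, hence closed and open, since the surface has the quotient topology of the disjoint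
union of the faces. -/
theorem surjective [PreconnectedSpace G.Space] (s : G.Flag) : Function.Surjective (q s) := by
  rw [← Set.range_eq_univ]
  have key (f : G.Face) : (∀ x, (Quot.mk _ ⟨f, x⟩ : G.Space) ∈ Set.range (q s)) ∨
      ∀ x, (Quot.mk _ ⟨f, x⟩ : G.Space) ∉ Set.range (q s) := by
    by_contra! h
    obtain ⟨⟨x, hx⟩, y, z, hz⟩ := h
    rw [← hq.base_eq] at hz
    obtain ⟨g, -, hg, -⟩ := hq.moves_of_eq hz
    exact hx ⟨g (T.place.symm x), by rw [← hg, hq.base_eq ⟨f, x⟩]⟩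
  refine IsClopen.eq_univ ⟨?_, ?_⟩ ⟨q s 0, Set.mem_range_self _⟩
  · rw [← isOpen_compl_iff, ← isQuotientMap_quot_mk.isOpen_preimage, isOpen_sigma_iff]
    intro f
    rcases key f with h | h
    · convert isOpen_empty
      ext x
      simpa using h x
    · convert isOpen_univ
      ext x
      simpa using h x
  · rw [← isQuotientMap_quot_mk.isOpen_preimage, isOpen_sigma_iff]
    intro f
    rcases key f with h | h
    · convert isOpen_univ
      ext x
      simpa using h x
    · convert isOpen_empty
      ext x
      simpa using h x

/-- Openness in the surface is tested on the faces separately, and on each face the projection to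
the surface is `q s` composed with a continuous map into the plane. -/
theorem isQuotientMap [PreconnectedSpace G.Space] (s : G.Flag) :
    Topology.IsQuotientMap (q s) := by
  rw [Topology.isQuotientMap_iff, Topology.isCoinducing_iff]
  refine ⟨fun U ↦ ⟨fun h ↦ ?_, fun h ↦ h.preimage (hq.continuous s)⟩, hq.surjective s⟩
  rw [← isQuotientMap_quot_mk.isOpen_preimage, isOpen_sigma_iff]
  intro f
  obtain ⟨z, hz⟩ := hq.surjective s (q ((f, 0), false) 0)
  obtain ⟨g, hg, hg', -⟩ := hq.moves_of_eq hz
  have : Sigma.mk f ⁻¹' (Quot.mk G.Glued ⁻¹' U) =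
      (fun x : Polygon n ↦ g (T.place.symm x)) ⁻¹' (q s ⁻¹' U) := by
    ext x
    simp only [Set.mem_preimage]
    rw [← hg', hq.base_eq ⟨f, x⟩]
  rw [this]
  exact h.preimage ((T.continuous_of_mem hg).comp
    (T.place.symm.continuous.comp continuous_subtype_val))

/-- The set `S = {0}` describes vertices and `S = Set.univ` the graph. The condition `hS` takes care
of reversed flags, for which parameter `t` turns into `σ t`; for `t = 0` the resulting end of the
side is the initial corner of the next side. -/
theorem exists_side_iff (s : G.Flag) (z : ℝ × ℝ) (S : Set I) (hS : ∀ t ∈ S, σ t ∈ S ∨ t = 0) :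
    (∃ f k, ∃ t ∈ S, Quot.mk _ ⟨f, side n k t⟩ = q s z) ↔
      ∃ g ∈ T.group, ∃ t ∈ S, T.place (g z) = side n 0 t := by
  constructor
  · rintro ⟨f, k, t, ht, h⟩
    have h' : q ((f, k), false) (T.place.symm (side n 0 t)) = q s z := by
      rw [hq.eq_chart, chart_side, ← h]
      rfl
    obtain ⟨g, hg, -, hg'⟩ := hq.moves_of_eq h'
    exact ⟨g, hg, t, ht, by rw [hg']; simp⟩
  · rintro ⟨g, hg, t, ht, h⟩
    obtain ⟨s', m⟩ := hq.exists_moves hg s z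
    have h' : q s z = chart s' (side n 0 t) := by
      rw [m.eq, ← hq.eq_chart, ← h, T.place.symm_apply_apply]
    rw [chart_side] at h'
    cases hb : s'.2
    · rw [hb] at h'
      exact ⟨_, _, t, ht, h'.symm⟩
    · rw [hb] at h'
      rcases hS t ht with h1 | rfl
      · exact ⟨_, _, σ t, h1, h'.symm⟩
      · refine ⟨s'.1.1, s'.1.2 + 1, 0, ht, ?_⟩
        rw [h']
        congr 2
        apply Subtype.ext
        simp [coe_side, corner_add]

/-- The symmetries of the tiling that are compatible with the map `q s`. -/
def _root_.TorusMap.TilingModel.deckGroup (T : TilingModel n) (f : ℝ × ℝ → G.Space) :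
    Subgroup (Equiv.Perm (ℝ × ℝ)) where
  carrier := {g | g ∈ T.group ∧ ∀ z, f (g z) = f z}
  mul_mem' := fun {g g'} h h' ↦ ⟨mul_mem h.1 h'.1, fun z ↦ by
    rw [Equiv.Perm.mul_apply, h.2, h'.2]⟩
  one_mem' := ⟨one_mem _, fun z ↦ rfl⟩
  inv_mem' := fun {g} h ↦ ⟨inv_mem h.1, fun z ↦ by rw [← h.2]; simp⟩

theorem eq_iff_exists_deck {s : G.Flag} {z z' : ℝ × ℝ} :
    q s z = q s z' ↔ ∃ g ∈ T.deckGroup (q s), g z' = z := by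
  constructor
  · intro h
    obtain ⟨g, hg, hg', h'⟩ := hq.moves_of_eq h
    exact ⟨g, ⟨hg, fun y ↦ (hg' y).symm⟩, h'⟩
  · rintro ⟨g, hg, rfl⟩
    exact hg.2 z'

end IsDevelopment

end TorusMap

namespace TorusMap

open scoped ComplexConjugate

/-! ### Pairs of involutions without fixed points -/

section Involutions

variable {F : Type*} {a b : Equiv.Perm F} (ha : a * a = 1) (hb : b * b = 1)

include ha hb in
theorem involution_mul_zpow (i : ℤ) : b * (a * b) ^ i = (a * b) ^ (-i) * b := by
  have h : b * (a * b) * b⁻¹ = (a * b)⁻¹ := by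
    rw [mul_inv_rev, inv_eq_of_mul_eq_one_left ha, mul_assoc, mul_assoc, mul_inv_cancel, mul_one,
      inv_eq_of_mul_eq_one_left hb]
  have h2 : b * (a * b) ^ i * b⁻¹ = (a * b) ^ (-i) := by
    rw [← conj_zpow, h, inv_zpow, zpow_neg]
  rw [← h2, inv_mul_cancel_right]

-- In the dihedral group generated by `a` and `b`, a product of `b` with a power of `a * b` is
-- conjugate to `a` or `b`, depending on the parity of the exponent. A fixed point of it would yield
-- one of `a` or `b`.
include ha hb in
theorem involution_zpow_ne (hfa : ∀ x, a x ≠ x) (hfb : ∀ x, b x ≠ x) (e : F) (i j : ℤ) :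
    b (((a * b) ^ j) e) ≠ ((a * b) ^ i) e := by
  intro h
  have hsym (l : ℤ) (x : F) : b (((a * b) ^ l) x) = ((a * b) ^ (-l)) (b x) := by
    rw [← Equiv.Perm.mul_apply, involution_mul_zpow ha hb, Equiv.Perm.mul_apply]
  have hadd (k l : ℤ) (x : F) : ((a * b) ^ k) (((a * b) ^ l) x) = ((a * b) ^ (k + l)) x := by
    rw [zpow_add, Equiv.Perm.mul_apply]
  have hbe : b e = ((a * b) ^ (i + j)) e := by
    rw [hsym] at h
    have := congrArg ((a * b) ^ j) h
    rwa [hadd, hadd, add_neg_cancel, zpow_zero, Equiv.Perm.one_apply, add_comm j i] at this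
  rcases Int.even_or_odd' (i + j) with ⟨l, hl | hl⟩
  · apply hfb (((a * b) ^ l) e)
    rw [hsym, hbe, ← Equiv.Perm.mul_apply, ← zpow_add, hl]
    congr 2
    ring
  · apply hfa (b (((a * b) ^ l) e))
    rw [← Equiv.Perm.mul_apply, ← Equiv.Perm.mul_apply (a * b), ← zpow_one_add, hsym, hbe,
      ← Equiv.Perm.mul_apply, ← zpow_add, hl]
    congr 2
    ring

include ha hb in
/-- Under two involutions without fixed points, the orbit of `e` consists of as many pairs
`{x, b x}` as the period of `e` under their product says. -/
theorem ncard_pairs_eq_minimalPeriod [Finite F] (hfa : ∀ x, a x ≠ x) (hfb : ∀ x, b x ≠ x) (e : F)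
    {O : Set F} (he : e ∈ O) (hO : ∀ x ∈ O, a x ∈ O ∧ b x ∈ O)
    (hmin : ∀ O' : Set F, e ∈ O' → (∀ x ∈ O', a x ∈ O' ∧ b x ∈ O') → O ⊆ O') :
    {h : Set F | ∃ x ∈ O, h = {x, b x}}.ncard = Function.minimalPeriod (a * b) e := by
  have hbb (x : F) : b (b x) = x := by rw [← Equiv.Perm.mul_apply, hb]; rfl
  have haa (x : F) : a (a x) = x := by rw [← Equiv.Perm.mul_apply, ha]; rfl
  -- Let `S` be the orbit of `e` under the rotations alone. Then `O` is contained in the union of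
  -- `S` and `b '' S`, and each pair `{x, b x}` meets `S` in exactly one point, so that pairs are
  -- counted by `S`.
  let S : Set F := Set.range fun i : ℤ ↦ ((a * b) ^ i) e
  have hSO : S ⊆ O := by
    rintro _ ⟨i, rfl⟩
    have hstep (x : F) (hx : x ∈ O) : (a * b) x ∈ O := (hO _ (hO x hx).2).1
    have hstep' (x : F) (hx : x ∈ O) : (a * b)⁻¹ x ∈ O := by
      rw [mul_inv_rev, inv_eq_of_mul_eq_one_left ha, inv_eq_of_mul_eq_one_left hb]
      exact (hO _ (hO x hx).1).2
    simp only
    induction i with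
    | zero => exact he
    | succ i ih =>
      rw [add_comm, zpow_one_add, Equiv.Perm.mul_apply]
      exact hstep _ ih
    | pred i ih =>
      rw [sub_eq_add_neg, add_comm, zpow_add, zpow_neg_one, Equiv.Perm.mul_apply]
      exact hstep' _ ih
  have hOS : O ⊆ S ∪ b '' S := by
    refine hmin _ (Or.inl ⟨0, rfl⟩) ?_
    rintro x (⟨i, rfl⟩ | ⟨_, ⟨i, rfl⟩, rfl⟩)
    · refine ⟨Or.inr ⟨_, ⟨i - 1, rfl⟩, ?_⟩, Or.inr ⟨_, ⟨i, rfl⟩, rfl⟩⟩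
      have : (a * b) ^ i = a * b * (a * b) ^ (i - 1) := by
        rw [← zpow_one_add, add_sub_cancel]
      simp only [this, Equiv.Perm.mul_apply, haa]
    · refine ⟨Or.inl ⟨1 + i, ?_⟩, Or.inl ⟨i, ?_⟩⟩
      · simp only [zpow_one_add, Equiv.Perm.mul_apply]
      · simp only [hbb]
  have himage : {h : Set F | ∃ x ∈ O, h = {x, b x}} = (fun x ↦ {x, b x}) '' S := by
    ext h
    simp only [Set.mem_ofPred_eq, Set.mem_image]
    constructor
    · rintro ⟨x, hx, rfl⟩
      rcases hOS hx with hx | ⟨y, hy, rfl⟩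
      · exact ⟨x, hx, rfl⟩
      · exact ⟨y, hy, by rw [hbb, Set.pair_comm]⟩
    · rintro ⟨x, hx, rfl⟩
      exact ⟨x, hSO hx, rfl⟩
  rw [himage, Set.InjOn.ncard_image]
  · classical
    have := Fintype.ofFinite F
    have h := MulAction.minimalPeriod_eq_card (a := a * b) (b := e)
    have h2 : MulAction.orbit (Subgroup.zpowers (a * b)) e = S := by
      ext x
      simp only [MulAction.mem_orbit_iff, S, Set.mem_range]
      constructor
      · rintro ⟨⟨g, i, rfl⟩, rfl⟩
        exact ⟨i, rfl⟩
      · rintro ⟨i, rfl⟩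
        exact ⟨⟨_, i, rfl⟩, rfl⟩
    rw [← h2, ← Nat.card_coe_set_eq, Nat.card_eq_fintype_card, ← h]
    rfl
  · rintro _ ⟨i, rfl⟩ _ ⟨j, rfl⟩ h
    simp only at h
    have hmem : ((a * b) ^ i) e ∈ ({((a * b) ^ j) e, b (((a * b) ^ j) e)} : Set F) := by
      rw [← h]; simp
    rcases hmem with h1 | h1
    · exact h1
    · exact absurd h1.symm (involution_zpow_ne ha hb hfa hfb e i j)

end Involutions

/-! ### Relations between the involutions of flags, vertices and degrees -/

namespace Gluing

variable {n : ℕ} [NeZero n] (G : Gluing n)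

theorem flipEnd_mul_self : G.flipEnd * G.flipEnd = 1 := by
  ext1 s; simp [flipEnd_apply]

theorem turn_mul_self : G.turn * G.turn = 1 := by
  ext1 s
  obtain ⟨⟨f, k⟩, b⟩ := s
  cases b <;> simp [turn_apply]

theorem cross_mul_self : G.cross * G.cross = 1 := by
  ext1 s; simp [Gluing.cross_apply, G.mate_mate, G.rev_mate]

theorem flipEnd_ne (s : G.Flag) : G.flipEnd s ≠ s := by
  intro h; simpa [flipEnd_apply] using congrArg Prod.snd h

theorem turn_ne (s : G.Flag) : G.turn s ≠ s := by
  intro h; simpa [turn_apply] using congrArg Prod.snd h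

theorem cross_ne (s : G.Flag) : G.cross s ≠ s := by
  intro h; exact G.mate_ne s.1 (congrArg Prod.fst h)

theorem flipEnd_mul_cross : G.flipEnd * G.cross = G.cross * G.flipEnd := by
  ext1 s; simp [flipEnd_apply, Gluing.cross_apply]

theorem flipEnd_mul_cross_ne (s : G.Flag) : (G.flipEnd * G.cross) s ≠ s := by
  intro h; exact G.mate_ne s.1 (congrArg Prod.fst h)

theorem flipEnd_mul_turn_pow (i : ℕ) (s : G.Flag) : ((G.flipEnd * G.turn) ^ i) s =
    ((s.1.1, if s.2 then s.1.2 + i else s.1.2 - i), s.2) := by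
  induction i with
  | zero => simp
  | succ i ih =>
    rw [pow_succ', Equiv.Perm.mul_apply, ih]
    obtain ⟨⟨f, k⟩, b⟩ := s
    cases b
    · simp [flipEnd_apply, turn_apply, sub_sub]
    · simp [flipEnd_apply, turn_apply, add_assoc]

theorem flipEnd_mul_turn_pow_eq_one : (G.flipEnd * G.turn) ^ n = 1 := by
  ext1 s; simp [flipEnd_mul_turn_pow]

theorem flipEnd_mul_turn_pow_ne {i : ℕ} (hi : 0 < i) (hin : i < n) (s : G.Flag) :
    ((G.flipEnd * G.turn) ^ i) s ≠ s := by
  intro h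
  have hi' : (i : ZMod n) ≠ 0 := fun h0 ↦ by
    have := Nat.le_of_dvd hi ((ZMod.natCast_eq_zero_iff i n).1 h0)
    omega
  rw [flipEnd_mul_turn_pow] at h
  obtain ⟨⟨f, k⟩, b⟩ := s
  cases b <;> simp at h <;> exact hi' h

/-- The corner of the face at which a flag has its end. -/
def flagCorner (s : G.Flag) : ZMod n := if s.2 then s.1.2 + 1 else s.1.2

theorem flagCorner_eq {s s' : G.Flag} (hf : s.1.1 = s'.1.1) (h : G.flagCorner s = G.flagCorner s') :
    s = s' ∨ s = G.turn s' := by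
  obtain ⟨⟨f, k⟩, b⟩ := s
  obtain ⟨⟨f', k'⟩, b'⟩ := s'
  simp only at hf
  subst hf
  cases b <;> cases b' <;> simp [flagCorner, turn_apply] at h ⊢
  · exact h
  · exact h
  · exact eq_sub_of_add_eq h
  · exact h

theorem flagCorner_turn (s : G.Flag) : G.flagCorner (G.turn s) = G.flagCorner s := by
  obtain ⟨⟨f, k⟩, b⟩ := s
  cases b <;> simp [flagCorner, turn_apply]

end Gluing

theorem coe_side_zero {n : ℕ} [NeZero n] (k : ZMod n) : (side n k 0 : ℂ) = corner n k := by
  simp [coe_side]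

theorem coe_side_one {n : ℕ} [NeZero n] (k : ZMod n) : (side n k 1 : ℂ) = corner n (k + 1) := by
  simp [coe_side, corner_add]

/-- Only the end points of a side are corners. -/
theorem eq_zero_or_one_of_side_eq_corner {n : ℕ} [NeZero n] (hn : 2 ≤ n) {k l : ZMod n} {t : I}
    (h : (side n k t : ℂ) = corner n l) : t = 0 ∨ t = 1 := by
  have hne : corner n k ≠ corner n (k + 1) := fun h ↦ by
    have : Fact (1 < n) := ⟨hn⟩
    simpa using corner_injective h
  by_contra! hc
  have h0 : 0 < (t : ℝ) := unitInterval.pos_iff_ne_zero.2 hc.1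
  have h1 : (t : ℝ) < 1 := unitInterval.lt_one_iff_ne_one.2 hc.2
  -- The unit disk is strictly convex, so an inner point of a side has norm less than one, unlike a
  -- corner.
  have := norm_combo_lt_of_ne (r := 1) (norm_corner k).le (norm_corner (k + 1)).le hne
    (sub_pos.2 h1) h0 (by ring)
  have h2 : (1 - (t : ℝ)) • corner n k + (t : ℝ) • corner n (k + 1) = corner n l := by
    rw [← h, coe_side, corner_add]
    simp only [Complex.real_smul]
    ring
  rw [h2, norm_corner] at this
  exact lt_irrefl _ this

namespace Gluing

variable {n : ℕ} [NeZero n] {G : Gluing n}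

/-- Flags at the same vertex: those that are obtained from each other by turning and crossing. -/
def SameVertex (s s' : G.Flag) : Prop :=
  Relation.EqvGen (fun s s' : G.Flag ↦ s' = G.turn s ∨ s' = G.cross s) s s'

theorem SameVertex.turn (s : G.Flag) : SameVertex s (G.turn s) := .rel _ _ (Or.inl rfl)

theorem SameVertex.cross (s : G.Flag) : SameVertex s (G.cross s) := .rel _ _ (Or.inr rfl)

/-- The condition that some flag with its corner at a given point is related to `s` is invariant
under gluing. This turns the topological equality of vertices into the combinatorial relation
generated by `turn` and `cross`. -/
theorem sameVertex_of_eqvGen (hn : 2 ≤ n) {a b : Σ _ : G.Face, Polygon n}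
    (h : Relation.EqvGen G.Glued a b) (s : G.Flag) :
    (∃ s', s'.1.1 = a.1 ∧ corner n (G.flagCorner s') = a.2 ∧ SameVertex s' s) ↔
      ∃ s', s'.1.1 = b.1 ∧ corner n (G.flagCorner s') = b.2 ∧ SameVertex s' s := by
  have key (r : G.Face × ZMod n) (t : I)
      (h : ∃ s', s'.1.1 = r.1 ∧ corner n (G.flagCorner s') = side n r.2 t ∧ SameVertex s' s) :
      ∃ s', s'.1.1 = (G.mate r).1 ∧ corner n (G.flagCorner s') =
        side n (G.mate r).2 (if G.rev r then σ t else t) ∧ SameVertex s' s := by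
    obtain ⟨s', hf, hc, hs⟩ := h
    obtain ⟨b, rfl⟩ : ∃ b : Bool, t = if b then 1 else 0 := by
      rcases eq_zero_or_one_of_side_eq_corner hn hc.symm with rfl | rfl
      · exact ⟨false, rfl⟩
      · exact ⟨true, rfl⟩
    have hcorner (r : G.Face × ZMod n) (b : Bool) :
        (side n r.2 (if b then 1 else 0) : ℂ) = corner n (G.flagCorner (r, b)) := by
      cases b <;> simp [flagCorner, coe_side_zero, coe_side_one]
    rw [hcorner] at hc
    have hs' : SameVertex (r, b) s := by
      rcases G.flagCorner_eq (s' := (r, b)) hf (corner_injective hc) with rfl | rfl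
      · exact hs
      · exact (SameVertex.turn _).trans _ _ _ hs
    refine ⟨G.cross (r, b), rfl, ?_, ((SameVertex.cross _).symm).trans _ _ _ hs'⟩
    rw [Gluing.cross_apply, ← hcorner]
    cases b <;> cases G.rev r <;> simp
  induction h with
  | rel a b h =>
    obtain ⟨r, t⟩ := h
    refine ⟨key r t, fun h ↦ ?_⟩
    have := key (G.mate r) (if G.rev r then σ t else t) h
    rw [G.mate_mate, G.rev_mate] at this
    cases hr : G.rev r <;> simpa [hr] using this
  | refl => rfl
  | symm a b _ ih => exact ih.symm
  | trans a b c _ _ ih ih' => exact ih.trans ih'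

theorem finite_flag : Finite G.Flag :=
  have := G.finite_face
  inferInstance

end Gluing

namespace PolygonalMap

open Gluing

variable {n : ℕ} [NeZero n] {X : Type*} [TopologicalSpace X] (m : PolygonalMap n X)

theorem coe_endSide (e : m.SideEnd) :
    (side n e.1.2 (if e.2 then 1 else 0) : ℂ) = corner n (m.flagCorner e) := by
  obtain ⟨⟨f, k⟩, b⟩ := e
  cases b <;> simp [flagCorner, coe_side_zero, coe_side_one]

theorem endPoint_turn (e : m.SideEnd) : m.endPoint (m.turn e) = m.endPoint e := by
  unfold endPoint point
  congr 3
  apply Subtype.ext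
  have h1 := m.coe_endSide (m.turn e)
  have h2 := m.coe_endSide e
  rw [flagCorner_turn] at h1
  exact h1.trans h2.symm

theorem endPoint_cross (e : m.SideEnd) : m.endPoint (m.cross e) = m.endPoint e := by
  unfold endPoint point
  congr 1
  rw [eq_comm]
  have := Quot.sound (Glued.of_side (G := m.toGluing) e.1 (if e.2 then 1 else 0))
  rw [this, Gluing.cross_apply]
  obtain ⟨r, b⟩ := e
  cases b <;> cases m.rev r <;> simp

theorem endPoint_eq_iff (hn : 2 ≤ n) {e e' : m.SideEnd} :
    m.endPoint e = m.endPoint e' ↔ SameVertex e e' := by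
  constructor
  · intro h
    have h1 := sameVertex_of_eqvGen hn (Quot.eqvGen_exact (m.homeo.injective h)) e'
    obtain ⟨s, hf, hc, hs⟩ := h1.2 ⟨e', rfl, (m.coe_endSide e').symm, .refl _⟩
    rw [m.coe_endSide] at hc
    rcases m.flagCorner_eq hf (corner_injective hc) with rfl | rfl
    · exact hs
    · exact (SameVertex.turn _).trans _ _ _ hs
  · intro h
    induction h with
    | rel e e' h =>
      rcases h with rfl | rfl
      · rw [endPoint_turn]
      · rw [endPoint_cross]
    | refl => rfl
    | symm e e' _ ih => exact ih.symm
    | trans e e' e'' _ _ ih ih' => exact ih.trans ih'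

/-- The flags at a vertex form one orbit of the involutions `turn` and `cross`, which have no fixed
points, and the ends of edges are the pairs `{e, cross e}`. So `ncard_pairs_eq_minimalPeriod`
applies. -/
theorem degree_endPoint (hn : 2 ≤ n) (e : m.SideEnd) :
    m.degree (m.endPoint e) = Function.minimalPeriod (m.turn * m.cross) e := by
  have := finite_flag (G := m.toGluing)
  rw [← ncard_pairs_eq_minimalPeriod m.turn_mul_self m.cross_mul_self m.turn_ne m.cross_ne e
    (O := {e' | m.endPoint e' = m.endPoint e}) rfl]
  · rfl
  · intro x hx
    exact ⟨(m.endPoint_turn x).trans hx, (m.endPoint_cross x).trans hx⟩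
  · intro O he hO x hx
    have hx' : SameVertex e x := (m.endPoint_eq_iff hn).1 (Eq.symm hx)
    have hiff : e ∈ O ↔ x ∈ O := by
      clear hx he
      have h1 (y : m.SideEnd) : y ∈ O ↔ m.turn y ∈ O := by
        refine ⟨fun h ↦ (hO y h).1, fun h ↦ ?_⟩
        have := (hO _ h).1
        rwa [← Equiv.Perm.mul_apply, turn_mul_self] at this
      have h2 (y : m.SideEnd) : y ∈ O ↔ m.cross y ∈ O := by
        refine ⟨fun h ↦ (hO y h).2, fun h ↦ ?_⟩
        have := (hO _ h).2
        rwa [← Equiv.Perm.mul_apply, cross_mul_self] at this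
      induction hx' with
      | rel y y' h =>
        rcases h with rfl | rfl
        · exact h1 y
        · exact h2 y
      | refl => rfl
      | symm y y' _ ih => exact ih.symm
      | trans y y' y'' _ _ ih ih' => exact ih.trans ih'
    exact hiff.1 he

theorem endPoint_mem_vertices (e : m.SideEnd) : m.endPoint e ∈ m.vertices := by
  refine ⟨e.1.1, m.flagCorner e, ?_⟩
  unfold endPoint
  congr 1
  apply Subtype.ext
  rw [m.coe_endSide, coe_side_zero]

theorem NoExceptionalVertices.minimalPeriod_eq (hn : 2 ≤ n) {m : PolygonalMap n X}
    (h : m.NoExceptionalVertices) (e : m.SideEnd) :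
    Function.minimalPeriod (m.turn * m.cross) e = 2 * n / (n - 2) := by
  rw [← m.degree_endPoint hn, h _ (m.endPoint_mem_vertices e)]

theorem NoExceptionalVertices.turn_mul_cross_pow (hn : 2 ≤ n) {m : PolygonalMap n X}
    (h : m.NoExceptionalVertices) : (m.turn * m.cross) ^ (2 * n / (n - 2)) = 1 := by
  ext1 e
  rw [← h.minimalPeriod_eq hn e, Equiv.Perm.coe_pow]
  exact Function.isPeriodicPt_minimalPeriod _ e

/-- That the degree is no proper divisor of the expected number is what makes the deck group act
freely around the vertices. -/
theorem NoExceptionalVertices.turn_mul_cross_pow_ne (hn : 2 ≤ n) {m : PolygonalMap n X}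
    (h : m.NoExceptionalVertices) {i : ℕ} (hi : 0 < i) (hi' : i < 2 * n / (n - 2))
    (e : m.SideEnd) : ((m.turn * m.cross) ^ i) e ≠ e := by
  intro he
  rw [← h.minimalPeriod_eq hn e] at hi'
  rw [Equiv.Perm.coe_pow] at he
  exact Function.not_isPeriodicPt_of_pos_of_lt_minimalPeriod hi.ne' hi' he

end PolygonalMap

end TorusMap

namespace TorusMap

/-! ### Families of maps of the plane that are equivariant under a lattice -/

section Lattice

variable {F X : Type*} [TopologicalSpace X] {u v : Equiv.Perm F}

/-- Equivariance forces the values on each translate of `K`, and `hcompat` says that these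
prescriptions agree on overlaps. The translates form a locally finite closed cover, so the resulting
maps are continuous. -/
theorem exists_equivariant_extension (huv : Commute u v) {K : Set (ℝ × ℝ)} (hK : IsClosed K) {C : ℝ}
    (hKC : ∀ z ∈ K, |z.1| ≤ C ∧ |z.2| ≤ C)
    (hcover : ∀ z : ℝ × ℝ, ∃ i j : ℤ, z - ((i : ℝ), (j : ℝ)) ∈ K) {κ : F → ℝ × ℝ → X}
    (hκ : ∀ s, ContinuousOn (κ s) K)
    (hcompat : ∀ s (i j : ℤ), ∀ z ∈ K, z + ((i : ℝ), (j : ℝ)) ∈ K →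
      κ ((u ^ i * v ^ j) s) z = κ s (z + ((i : ℝ), (j : ℝ)))) :
    ∃ q : F → ℝ × ℝ → X, (∀ s, Continuous (q s)) ∧ (∀ s, ∀ z ∈ K, q s z = κ s z) ∧
      ∀ s (i j : ℤ) z, q ((u ^ i * v ^ j) s) z = q s (z + ((i : ℝ), (j : ℝ))) := by
  have hT (i j k l : ℤ) (s : F) :
      (u ^ i * v ^ j) ((u ^ k * v ^ l) s) = (u ^ (i + k) * v ^ (j + l)) s := by
    rw [← Equiv.Perm.mul_apply, zpow_add, zpow_add, mul_assoc, ← mul_assoc (v ^ j),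
      ((huv.zpow_left k).zpow_right j).eq.symm, mul_assoc, mul_assoc]
  -- The translate of `K` that defines the value at `z` is chosen arbitrarily; `key` shows that any
  -- other choice gives the same value.
  choose k l hkl using hcover
  let q : F → ℝ × ℝ → X := fun s z ↦ κ ((u ^ k z * v ^ l z) s) (z - ((k z : ℝ), (l z : ℝ)))
  have key (s : F) (z : ℝ × ℝ) (i j : ℤ) (h : z - ((i : ℝ), (j : ℝ)) ∈ K) :
      q s z = κ ((u ^ i * v ^ j) s) (z - ((i : ℝ), (j : ℝ))) := by
    have hz : z - ((k z : ℝ), (l z : ℝ)) + (((k z - i : ℤ) : ℝ), ((l z - j : ℤ) : ℝ)) =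
        z - ((i : ℝ), (j : ℝ)) := by
      ext <;> simp
    have := hcompat ((u ^ i * v ^ j) s) (k z - i) (l z - j) _ (hkl z) (by rwa [hz])
    rw [hz, hT, sub_add_cancel, sub_add_cancel] at this
    exact this
  refine ⟨q, fun s ↦ ?_, fun s z hz ↦ ?_, fun s i j z ↦ ?_⟩
  · let f : ℤ × ℤ → Set (ℝ × ℝ) := fun p ↦ {z | z - ((p.1 : ℝ), (p.2 : ℝ)) ∈ K}
    refine LocallyFinite.continuous (f := f) ?_ ?_ (fun p ↦ ?_) (fun p ↦ ?_)
    · intro z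
      refine ⟨Metric.ball z 1, Metric.ball_mem_nhds _ one_pos, ?_⟩
      refine (Set.Finite.prod (Set.finite_Icc ⌊z.1 - C - 1⌋ ⌈z.1 + C + 1⌉)
        (Set.finite_Icc ⌊z.2 - C - 1⌋ ⌈z.2 + C + 1⌉)).subset ?_
      rintro ⟨i, j⟩ ⟨w, hw, hwz⟩
      have h1 := hKC _ hw
      rw [Metric.mem_ball, Prod.dist_eq, max_lt_iff, Real.dist_eq, Real.dist_eq, abs_lt, abs_lt] at hwz
      simp only [Prod.fst_sub, Prod.snd_sub, abs_le] at h1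
      refine ⟨⟨?_, ?_⟩, ⟨?_, ?_⟩⟩
      · exact_mod_cast (Int.floor_le _).trans (by linarith : z.1 - C - 1 ≤ i)
      · exact_mod_cast (by linarith : (i : ℝ) ≤ z.1 + C + 1).trans (Int.le_ceil _)
      · exact_mod_cast (Int.floor_le _).trans (by linarith : z.2 - C - 1 ≤ j)
      · exact_mod_cast (by linarith : (j : ℝ) ≤ z.2 + C + 1).trans (Int.le_ceil _)
    · exact Set.eq_univ_of_forall fun z ↦ Set.mem_iUnion.2 ⟨(k z, l z), hkl z⟩
    · exact hK.preimage (by fun_prop)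
    · have : ContinuousOn (fun z ↦ κ ((u ^ p.1 * v ^ p.2) s) (z - ((p.1 : ℝ), (p.2 : ℝ)))) (f p) :=
        (hκ _).comp (by fun_prop) fun z hz ↦ hz
      exact this.congr fun z hz ↦ key s z p.1 p.2 hz
  · have := key s z 0 0 (by simpa [← Prod.zero_eq_mk] using hz)
    simpa [← Prod.zero_eq_mk] using this
  · have hz : z - ((k z : ℝ), (l z : ℝ)) =
        z + ((i : ℝ), (j : ℝ)) - (((k z + i : ℤ) : ℝ), ((l z + j : ℤ) : ℝ)) := by
      ext <;> simp
    rw [key s (z + ((i : ℝ), (j : ℝ))) (k z + i) (l z + j) (by rw [← hz]; exact hkl z), ← hz,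
      ← hT]

theorem exists_sub_mem_square (z : ℝ × ℝ) :
    ∃ i j : ℤ, z - ((i : ℝ), (j : ℝ)) ∈ Set.Icc (0 : ℝ) 1 ×ˢ Set.Icc (0 : ℝ) 1 := by
  refine ⟨⌊z.1⌋, ⌊z.2⌋, ⟨?_, ?_⟩, ⟨?_, ?_⟩⟩
  · simp
  · have := Int.lt_floor_add_one z.1
    simp only [Prod.fst_sub]; linarith
  · simp
  · have := Int.lt_floor_add_one z.2
    simp only [Prod.snd_sub]; linarith

/-- To extend maps of the unit square equivariantly to the plane, it suffices that they agree on
opposite sides. -/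
theorem exists_equivariant_extension_square (huv : Commute u v) {κ : F → ℝ × ℝ → X}
    (hκ : ∀ s, ContinuousOn (κ s) (Set.Icc (0 : ℝ) 1 ×ˢ Set.Icc (0 : ℝ) 1))
    (hu : ∀ s, ∀ y ∈ Set.Icc (0 : ℝ) 1, κ (u s) (0, y) = κ s (1, y))
    (hv : ∀ s, ∀ x ∈ Set.Icc (0 : ℝ) 1, κ (v s) (x, 0) = κ s (x, 1)) :
    ∃ q : F → ℝ × ℝ → X, (∀ s, Continuous (q s)) ∧
      (∀ s, ∀ z ∈ Set.Icc (0 : ℝ) 1 ×ˢ Set.Icc (0 : ℝ) 1, q s z = κ s z) ∧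
      ∀ s (i j : ℤ) z, q ((u ^ i * v ^ j) s) z = q s (z + ((i : ℝ), (j : ℝ))) := by
  refine exists_equivariant_extension huv (isClosed_Icc.prod isClosed_Icc) (C := 1) ?_
    exists_sub_mem_square hκ ?_
  · rintro ⟨x, y⟩ ⟨hx, hy⟩
    simp only [Set.mem_Icc] at hx hy
    exact ⟨abs_le.2 ⟨by linarith, by linarith⟩, abs_le.2 ⟨by linarith, by linarith⟩⟩
  -- Two points of the unit interval that differ by a nonzero integer are its end points. So
  -- compatibility is an issue only on opposite sides of the square.
  have hstep {i : ℤ} {x : ℝ} (hx : x ∈ Set.Icc (0 : ℝ) 1) (hx' : x + i ∈ Set.Icc (0 : ℝ) 1) :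
      i = 0 ∨ i = 1 ∧ x = 0 ∨ i = -1 ∧ x = 1 := by
    obtain ⟨h0, h1⟩ := hx
    obtain ⟨h0', h1'⟩ := hx'
    have hi1 : i ≤ 1 := by exact_mod_cast (by linarith : (i : ℝ) ≤ 1)
    have hi2 : -1 ≤ i := by exact_mod_cast (by linarith : (-1 : ℝ) ≤ i)
    interval_cases i
    · right; right; refine ⟨rfl, ?_⟩; push_cast at h0'; linarith
    · left; rfl
    · right; left; refine ⟨rfl, ?_⟩; push_cast at h1'; linarith
  have h1 (s : F) (i : ℤ) (x y : ℝ) (hx : x ∈ Set.Icc (0 : ℝ) 1) (hx' : x + i ∈ Set.Icc (0 : ℝ) 1)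
      (hy : y ∈ Set.Icc (0 : ℝ) 1) : κ ((u ^ i) s) (x, y) = κ s (x + i, y) := by
    rcases hstep hx hx' with rfl | ⟨rfl, rfl⟩ | ⟨rfl, rfl⟩
    · simp
    · simpa using hu s y hy
    · have := hu (u⁻¹ s) y hy
      simpa using this.symm
  have h2 (s : F) (j : ℤ) (x y : ℝ) (hx : x ∈ Set.Icc (0 : ℝ) 1)
      (hy : y ∈ Set.Icc (0 : ℝ) 1) (hy' : y + j ∈ Set.Icc (0 : ℝ) 1) :
      κ ((v ^ j) s) (x, y) = κ s (x, y + j) := by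
    rcases hstep hy hy' with rfl | ⟨rfl, rfl⟩ | ⟨rfl, rfl⟩
    · simp
    · simpa using hv s x hx
    · have := hv (v⁻¹ s) x hx
      simpa using this.symm
  rintro s i j ⟨x, y⟩ ⟨hx, hy⟩ ⟨hx', hy'⟩
  rw [Equiv.Perm.mul_apply, h1 _ i x y hx hx' hy]
  exact h2 _ j _ y hx' hy hy'

/-- A relation between lattice equivariant maps that is compatible with the lattice holds in the
whole plane if it holds in a fundamental domain. -/
theorem equivariant_of_fundamental (huv : Commute u v) {K : Set (ℝ × ℝ)}
    (hcover : ∀ z : ℝ × ℝ, ∃ i j : ℤ, z - ((i : ℝ), (j : ℝ)) ∈ K) {q : F → ℝ × ℝ → X}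
    (hq : ∀ s (i j : ℤ) z, q ((u ^ i * v ^ j) s) z = q s (z + ((i : ℝ), (j : ℝ))))
    {r : Equiv.Perm F} {R : ℝ × ℝ → ℝ × ℝ} {k₁ l₁ k₂ l₂ : ℤ}
    (hR : ∀ z (i j : ℤ), R (z + ((i : ℝ), (j : ℝ))) =
      R z + (((k₁ * i + k₂ * j : ℤ) : ℝ), ((l₁ * i + l₂ * j : ℤ) : ℝ)))
    (hu : u * r = r * (u ^ k₁ * v ^ l₁)) (hv : v * r = r * (u ^ k₂ * v ^ l₂))
    (hK : ∀ s, ∀ z ∈ K, q (r s) z = q s (R z)) (s : F) (z : ℝ × ℝ) : q (r s) z = q s (R z) := by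
  have hpow (k l i : ℤ) : (u ^ k * v ^ l) ^ i = u ^ (k * i) * v ^ (l * i) := by
    rw [((huv.zpow_left k).zpow_right l).mul_zpow, zpow_mul, zpow_mul]
  -- Conjugation by `r` changes `u` and `v` in the same way as the linear part of `R` changes the
  -- lattice vectors, which transports the identity from `K` to its translates.
  have hconj (i j : ℤ) : u ^ i * v ^ j * r =
      r * (u ^ (k₁ * i + k₂ * j) * v ^ (l₁ * i + l₂ * j)) := by
    have h1 : r⁻¹ * u * r⁻¹⁻¹ = u ^ k₁ * v ^ l₁ := by
      rw [inv_inv, mul_assoc, hu, inv_mul_cancel_left]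
    have h2 : r⁻¹ * v * r⁻¹⁻¹ = u ^ k₂ * v ^ l₂ := by
      rw [inv_inv, mul_assoc, hv, inv_mul_cancel_left]
    have h3 : r⁻¹ * (u ^ i * v ^ j) * r⁻¹⁻¹ = (u ^ k₁ * v ^ l₁) ^ i * (u ^ k₂ * v ^ l₂) ^ j := by
      rw [← h1, ← h2, conj_zpow, conj_zpow]
      group
    rw [inv_inv, mul_assoc, inv_mul_eq_iff_eq_mul] at h3
    rw [h3, hpow, hpow, zpow_add, zpow_add]
    congr 1
    rw [mul_assoc, mul_assoc, ← mul_assoc (v ^ (l₁ * i)),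
      ((huv.zpow_left (k₂ * j)).zpow_right (l₁ * i)).eq.symm, mul_assoc]
  obtain ⟨i, j, hz⟩ := hcover z
  have h := hq (r s) i j (z - ((i : ℝ), (j : ℝ)))
  rw [sub_add_cancel, ← Equiv.Perm.mul_apply, hconj, Equiv.Perm.mul_apply, hK _ _ hz, hq, ← hR,
    sub_add_cancel] at h
  exact h.symm

end Lattice

/-! ### Relations between the generators of the symmetry groups -/

section Words

variable {F : Type*} {a b c : Equiv.Perm F}

theorem perm_apply_apply {a : Equiv.Perm F} (ha : a * a = 1) (x : F) : a (a x) = x := by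
  rw [← Equiv.Perm.mul_apply, ha]; rfl

/-- The translations among the symmetries of the square tiling. -/
theorem square_relations (ha : a * a = 1) (hb : b * b = 1) (hc : c * c = 1) (hac : a * c = c * a)
    (hab : (a * b) ^ 4 = 1) (hbc : (b * c) ^ 4 = 1) :
    let u := b * a * b * c
    let v := a * b * c * b
    Commute u v ∧ u * a = a * u ∧ v * a = a * v⁻¹ ∧ u * b = b * v ∧ v * b = b * u ∧
      u * c = c * u⁻¹ ∧ v * c = c * v := by
  have hai := inv_eq_of_mul_eq_one_left ha
  have hbi := inv_eq_of_mul_eq_one_left hb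
  have hci := inv_eq_of_mul_eq_one_left hc
  have ha' := perm_apply_apply ha
  have hb' := perm_apply_apply hb
  have hc' := perm_apply_apply hc
  have hac' (x : F) : c (a x) = a (c x) := by
    rw [← Equiv.Perm.mul_apply, ← hac]; rfl
  -- The relations are oriented as rewriting rules for words, so that `simp` can compare both sides
  -- of each identity in reduced form. The word `u` is modeled on the composition of reflections in
  -- two parallel lines (`b * a * b` and `c`) at distance `1 / 2`, a translation by one unit; `v` is
  -- its mirror image under `b`.
  have hab' (x : F) : b (a (b (a x))) = a (b (a (b x))) := by
    have := congrArg (fun p : Equiv.Perm F ↦ p (b (a (b (a x))))) hab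
    simpa [pow_succ, ha', hb'] using this.symm
  have hbc' (x : F) : c (b (c (b x))) = b (c (b (c x))) := by
    have := congrArg (fun p : Equiv.Perm F ↦ p (c (b (c (b x))))) hbc
    simpa [pow_succ, hb', hc'] using this.symm
  intro u v
  refine ⟨?_, ?_, ?_, ?_, ?_, ?_, ?_⟩
  · change u * v = v * u
    ext1 x
    simp [u, v, hb', hac', hab', hbc']
  all_goals
    ext1 x
    simp [u, v, hai, hbi, hci, hb', hc', hac', hab', hbc']

/-- The translations among the symmetries of the triangular tiling. -/
theorem hexagonal_relations (ha : a * a = 1) (hb : b * b = 1) (hc : c * c = 1) (hac : a * c = c * a)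
    (hab : (a * b) ^ 6 = 1) (hbc : (b * c) ^ 3 = 1) :
    let u := b * a * b * a * b * c
    let v := a * b * a * b * c * b
    Commute u v ∧ u * a = a * u ∧ v * a = a * (u * v⁻¹) ∧ u * b = b * v ∧ v * b = b * u ∧
      u * c = c * u⁻¹ ∧ v * c = c * (u⁻¹ * v) := by
  have hai := inv_eq_of_mul_eq_one_left ha
  have hbi := inv_eq_of_mul_eq_one_left hb
  have hci := inv_eq_of_mul_eq_one_left hc
  have ha' := perm_apply_apply ha
  have hb' := perm_apply_apply hb
  have hc' := perm_apply_apply hc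
  have hac' (x : F) : c (a x) = a (c x) := by
    rw [← Equiv.Perm.mul_apply, ← hac]; rfl
  have hab' (x : F) : b (a (b (a (b (a x))))) = a (b (a (b (a (b x))))) := by
    have := congrArg (fun p : Equiv.Perm F ↦ p (b (a (b (a (b (a x))))))) hab
    simpa [pow_succ, ha', hb'] using this.symm
  have hbc' (x : F) : c (b (c x)) = b (c (b x)) := by
    have := congrArg (fun p : Equiv.Perm F ↦ p (c (b (c x)))) hbc
    simpa [pow_succ, hb', hc'] using this.symm
  -- Further consequences of the relations, needed where the rewriting rules overlap.
  have hcbac (x : F) : b (c (b (a x))) = c (b (a (c x))) := by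
    rw [← hbc', hac']
  have hcbabc (x : F) : b (c (b (a (b (c (b x)))))) = c (b (a (b (c x)))) := by
    rw [hcbac, hbc', hb']
  intro u v
  refine ⟨?_, ?_, ?_, ?_, ?_, ?_, ?_⟩
  · change u * v = v * u
    ext1 x
    simp [u, v, hb', hac', hab', hcbabc]
  all_goals
    ext1 x
    simp [u, v, hai, hbi, hci, ha', hb', hc', hac', hab', hbc']

/-- The half turn about the middle of the third side among the symmetries of the triangular
tiling. -/
theorem triangle_relations (ha : a * a = 1) (hb : b * b = 1) (hc : c * c = 1) (hac : a * c = c * a)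
    (hab : (a * b) ^ 6 = 1) (hbc : (b * c) ^ 3 = 1) :
    let u := b * a * b * a * b * c
    let v := a * b * a * b * c * b
    let e := c * b * c * a * b * c
    e * b = b * e ∧ u = b * c * a * b * e ∧ v = c * a * e ∧ c * e * u⁻¹ = e * c ∧
      c * e * v⁻¹ = a ∧ c * (u * v⁻¹) = e * a := by
  have hai := inv_eq_of_mul_eq_one_left ha
  have hbi := inv_eq_of_mul_eq_one_left hb
  have hci := inv_eq_of_mul_eq_one_left hc
  have ha' := perm_apply_apply ha
  have hb' := perm_apply_apply hb
  have hc' := perm_apply_apply hc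
  have hac' (x : F) : c (a x) = a (c x) := by
    rw [← Equiv.Perm.mul_apply, ← hac]; rfl
  have hab' (x : F) : b (a (b (a (b (a x))))) = a (b (a (b (a (b x))))) := by
    have := congrArg (fun p : Equiv.Perm F ↦ p (b (a (b (a (b (a x))))))) hab
    simpa [pow_succ, ha', hb'] using this.symm
  have hbc' (x : F) : c (b (c x)) = b (c (b x)) := by
    have := congrArg (fun p : Equiv.Perm F ↦ p (c (b (c x)))) hbc
    simpa [pow_succ, hb', hc'] using this.symm
  have hcbac (x : F) : b (c (b (a x))) = c (b (a (c x))) := by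
    rw [← hbc', hac']
  have hcbabc (x : F) : b (c (b (a (b (c (b x)))))) = c (b (a (b (c x)))) := by
    rw [hcbac, hbc', hb']
  intro u v e
  refine ⟨?_, ?_, ?_, ?_, ?_, ?_⟩
  all_goals
    ext1 x
    simp [u, v, e, hai, hbi, hci, ha', hb', hc', hac', hbc'] <;>
      first | exact hcbac x | exact (hcbabc x).symm

end Words

end TorusMap

namespace TorusMap

/-! ### Extension of maps of one tile to the plane -/

/-- In the coordinates `x + y i`, the reflections in the line through `0` and `1`, in the diagonal
of the unit square at `0`, and in the perpendicular bisector of `0` and `1`. -/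
def squareReflection : Fin 3 → Equiv.Perm (ℝ × ℝ) :=
  ![Function.Involutive.toPerm (fun z ↦ (z.1, -z.2)) fun z ↦ by simp,
    Function.Involutive.toPerm (fun z ↦ (z.2, z.1)) fun z ↦ by simp,
    Function.Involutive.toPerm (fun z ↦ (1 - z.1, z.2)) fun z ↦ by simp]

/-- In the coordinates `x + y ζ`, where `ζ` is a primitive sixth root of unity, the reflections in
the line through `0` and `1`, in the bisector of the triangle `0`, `1`, `ζ` at `0`, and in the
perpendicular bisector of `0` and `1`. -/
def triangularReflection : Fin 3 → Equiv.Perm (ℝ × ℝ) :=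
  ![Function.Involutive.toPerm (fun z ↦ (z.1 + z.2, -z.2)) fun z ↦ by simp,
    Function.Involutive.toPerm (fun z ↦ (z.2, z.1)) fun z ↦ by simp,
    Function.Involutive.toPerm (fun z ↦ (1 - z.1 - z.2, z.2)) fun z ↦
      Prod.ext (by ring) rfl]

theorem squareReflection_zero (x y : ℝ) : squareReflection 0 (x, y) = (x, -y) := rfl
theorem squareReflection_one (x y : ℝ) : squareReflection 1 (x, y) = (y, x) := rfl
theorem squareReflection_two (x y : ℝ) : squareReflection 2 (x, y) = (1 - x, y) := rfl
theorem triangularReflection_zero (x y : ℝ) : triangularReflection 0 (x, y) = (x + y, -y) := rfl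
theorem triangularReflection_one (x y : ℝ) : triangularReflection 1 (x, y) = (y, x) := rfl
theorem triangularReflection_two (x y : ℝ) :
    triangularReflection 2 (x, y) = (1 - x - y, y) := rfl

variable {F X : Type*} [TopologicalSpace X] {a b c : Equiv.Perm F}

/-- The unit square with sides at `x = 0`, `1` and `y = 0`, `1`. -/
abbrev unitSquare : Set (ℝ × ℝ) := Set.Icc (0 : ℝ) 1 ×ˢ Set.Icc (0 : ℝ) 1

theorem mem_unitSquare {x y : ℝ} :
    (x, y) ∈ unitSquare ↔ (0 ≤ x ∧ x ≤ 1) ∧ 0 ≤ y ∧ y ≤ 1 := Iff.rfl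

/-- The square is a fundamental domain for the translations `u` and `v`, and the hypotheses on the
boundary make opposite sides match. Reflections `1` and `2` preserve the square; reflection `0` maps
it to the square below, from which `v` leads back. -/
theorem exists_extension_square (ha : a * a = 1) (hb : b * b = 1) (hc : c * c = 1)
    (hac : a * c = c * a) (hab : (a * b) ^ 4 = 1) (hbc : (b * c) ^ 4 = 1) {χ : F → ℝ × ℝ → X}
    (hχ : ∀ s, ContinuousOn (χ s) unitSquare)
    (hχa : ∀ s, ∀ x ∈ Set.Icc (0 : ℝ) 1, χ (a s) (x, 0) = χ s (x, 0))
    (hχb : ∀ s x y, (x, y) ∈ unitSquare → χ (b s) (x, y) = χ s (y, x))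
    (hχc : ∀ s x y, (x, y) ∈ unitSquare → χ (c s) (x, y) = χ s (1 - x, y)) :
    ∃ q : F → ℝ × ℝ → X, (∀ s, Continuous (q s)) ∧ (∀ s, ∀ z ∈ unitSquare, q s z = χ s z) ∧
      ∀ i s z, q (![a, b, c] i s) z = q s (squareReflection i z) := by
  obtain ⟨huv, hua, hva, hub, hvb, huc, hvc⟩ := square_relations ha hb hc hac hab hbc
  have hb' := perm_apply_apply hb
  set u := b * a * b * c with hu
  set v := a * b * c * b with hv
  obtain ⟨q, hqc, hqK, hqT⟩ := exists_equivariant_extension_square huv hχ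
    (fun s y hy ↦ by
      have h0 : ((0 : ℝ), y) ∈ unitSquare := mem_unitSquare.2 ⟨by simp, hy⟩
      have h0' : (y, (0 : ℝ)) ∈ unitSquare := mem_unitSquare.2 ⟨hy, by simp⟩
      rw [hu]
      simp only [Equiv.Perm.mul_apply]
      rw [hχb _ _ _ h0, hχa _ _ hy, hχb _ _ _ h0', hχc _ _ _ h0, sub_zero])
    (fun s x hx ↦ by
      have h0 : (x, (0 : ℝ)) ∈ unitSquare := mem_unitSquare.2 ⟨hx, by simp⟩
      have h0' : ((0 : ℝ), x) ∈ unitSquare := mem_unitSquare.2 ⟨by simp, hx⟩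
      have h1 : ((1 : ℝ), x) ∈ unitSquare := mem_unitSquare.2 ⟨by simp, hx⟩
      rw [hv]
      simp only [Equiv.Perm.mul_apply]
      rw [hχa _ _ hx, hχb _ _ _ h0, hχc _ _ _ h0', sub_zero, hχb _ _ _ h1])
  refine ⟨q, hqc, hqK, fun i ↦ ?_⟩
  fin_cases i
  · refine equivariant_of_fundamental huv exists_sub_mem_square hqT (r := a) (k₁ := 1) (l₁ := 0)
      (k₂ := 0) (l₂ := -1) ?_ (by simpa using hua) (by simpa using hva) ?_
    · rintro ⟨x, y⟩ i j
      ext <;> simp [squareReflection_zero]; ring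
    · rintro s ⟨x, y⟩ h
      obtain ⟨hx, hy⟩ := mem_unitSquare.1 h
      have hv' : v⁻¹ = b * c * b * a := by
        rw [hv]
        simp only [mul_inv_rev, inv_eq_of_mul_eq_one_left ha, inv_eq_of_mul_eq_one_left hb,
          inv_eq_of_mul_eq_one_left hc, mul_assoc]
      have h1 : (x, 1 - y) ∈ unitSquare := mem_unitSquare.2 ⟨hx, by constructor <;> linarith⟩
      have h2 : (1 - y, x) ∈ unitSquare := mem_unitSquare.2 ⟨by constructor <;> linarith, hx⟩
      have h3 : (y, x) ∈ unitSquare := mem_unitSquare.2 ⟨hy, hx⟩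
      have h4 := hqT (v⁻¹ s) 0 1 (x, -y)
      have h5 : (x, -y) + (((0 : ℤ) : ℝ), ((1 : ℤ) : ℝ)) = (x, 1 - y) := by
        ext <;> simp; ring
      have h6 : v (v⁻¹ s) = s := by simp
      rw [h5, zpow_zero, one_mul, zpow_one, h6, hqK _ _ h1, hv'] at h4
      simp only [Equiv.Perm.mul_apply] at h4
      rw [hχb _ _ _ h1, hχc _ _ _ h2, sub_sub_cancel, hχb _ _ _ h3] at h4
      change q (a s) (x, y) = q s (x, -y)
      rw [h4, hqK _ _ h]
  · refine equivariant_of_fundamental huv exists_sub_mem_square hqT (r := b) (k₁ := 0) (l₁ := 1)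
      (k₂ := 1) (l₂ := 0) ?_ (by simpa using hub) (by simpa using hvb) ?_
    · rintro ⟨x, y⟩ i j
      ext <;> simp [squareReflection_one]
    · rintro s ⟨x, y⟩ h
      have h' : (y, x) ∈ unitSquare := ⟨h.2, h.1⟩
      change q (b s) (x, y) = q s (y, x)
      rw [hqK _ _ h, hqK _ _ h', hχb _ _ _ h]
  · refine equivariant_of_fundamental huv exists_sub_mem_square hqT (r := c) (k₁ := -1) (l₁ := 0)
      (k₂ := 0) (l₂ := 1) ?_ (by simpa using huc) (by simpa using hvc) ?_
    · rintro ⟨x, y⟩ i j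
      ext <;> simp [squareReflection_two]; ring
    · rintro s ⟨x, y⟩ h
      obtain ⟨hx, hy⟩ := mem_unitSquare.1 h
      have h' : (1 - x, y) ∈ unitSquare := mem_unitSquare.2 ⟨by constructor <;> linarith, hy⟩
      change q (c s) (x, y) = q s (1 - x, y)
      rw [hqK _ _ h, hqK _ _ h', hχc _ _ _ h]

/-- The triangle with corners `(0, 0)`, `(1, 0)`, `(0, 1)`. -/
def unitTriangle : Set (ℝ × ℝ) := {z | 0 ≤ z.1 ∧ 0 ≤ z.2 ∧ z.1 + z.2 ≤ 1}

theorem mem_unitTriangle {x y : ℝ} :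
    (x, y) ∈ unitTriangle ↔ 0 ≤ x ∧ 0 ≤ y ∧ x + y ≤ 1 := Iff.rfl

theorem isClosed_unitTriangle : IsClosed unitTriangle := by
  have h1 : IsClosed {z : ℝ × ℝ | 0 ≤ z.1} := isClosed_le (by fun_prop) (by fun_prop)
  have h2 : IsClosed {z : ℝ × ℝ | 0 ≤ z.2} := isClosed_le (by fun_prop) (by fun_prop)
  have h3 : IsClosed {z : ℝ × ℝ | z.1 + z.2 ≤ 1} := isClosed_le (by fun_prop) (by fun_prop)
  exact h1.inter (h2.inter h3)

/-- A fundamental domain for the translations consists of two triangles. The chart on the second one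
is defined through the half turn `e` about the middle of their common side. -/
theorem exists_extension_triangle (ha : a * a = 1) (hb : b * b = 1) (hc : c * c = 1)
    (hac : a * c = c * a) (hab : (a * b) ^ 6 = 1) (hbc : (b * c) ^ 3 = 1) {χ : F → ℝ × ℝ → X}
    (hχ : ∀ s, ContinuousOn (χ s) unitTriangle)
    (hχa : ∀ s, ∀ x ∈ Set.Icc (0 : ℝ) 1, χ (a s) (x, 0) = χ s (x, 0))
    (hχb : ∀ s x y, (x, y) ∈ unitTriangle → χ (b s) (x, y) = χ s (y, x))
    (hχc : ∀ s x y, (x, y) ∈ unitTriangle → χ (c s) (x, y) = χ s (1 - x - y, y)) :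
    ∃ q : F → ℝ × ℝ → X, (∀ s, Continuous (q s)) ∧ (∀ s, ∀ z ∈ unitTriangle, q s z = χ s z) ∧
      ∀ i s z, q (![a, b, c] i s) z = q s (triangularReflection i z) := by
  obtain ⟨huv, hua, hva, hub, hvb, huc, hvc⟩ := hexagonal_relations ha hb hc hac hab hbc
  obtain ⟨heb, hue, hve, hceu, hcev, hcuv⟩ := triangle_relations ha hb hc hac hab hbc
  set u := b * a * b * a * b * c
  set v := a * b * a * b * c * b
  set e := c * b * c * a * b * c with he
  -- On the common side the half turn is compatible with the charts; so the two halves of `κ` below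
  -- fit together.
  have hdiag (s : F) (x y : ℝ) (h : (x, y) ∈ unitTriangle) (hxy : x + y = 1) :
      χ (e s) (1 - x, 1 - y) = χ s (x, y) := by
    obtain ⟨hx, hy, -⟩ := mem_unitTriangle.1 h
    obtain rfl : y = 1 - x := by linarith
    rw [he]
    simp only [Equiv.Perm.mul_apply, sub_sub_cancel]
    rw [hχc _ _ _ (mem_unitTriangle.2 ⟨by linarith, by linarith, by linarith⟩),
      hχb _ _ _ (mem_unitTriangle.2 ⟨by linarith, by linarith, by linarith⟩),
      hχc _ _ _ (mem_unitTriangle.2 ⟨by linarith, by linarith, by linarith⟩)]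
    ring_nf
    rw [hχa _ _ ⟨by linarith, by linarith⟩,
      hχb _ _ _ (mem_unitTriangle.2 ⟨by linarith, by linarith, by linarith⟩),
      hχc _ _ _ (mem_unitTriangle.2 ⟨by linarith, by linarith, by linarith⟩)]
    ring_nf
  classical
  let κ : F → ℝ × ℝ → X := fun s z ↦ if z.1 + z.2 ≤ 1 then χ s z else χ (e s) (1 - z.1, 1 - z.2)
  have hlow (s : F) (z : ℝ × ℝ) (h : z ∈ unitTriangle) : κ s z = χ s z := if_pos h.2.2
  have hup (s : F) (x y : ℝ) (h : (x, y) ∈ unitSquare) (hxy : 1 ≤ x + y) :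
      κ s (x, y) = χ (e s) (1 - x, 1 - y) := by
    obtain ⟨hx, hy⟩ := mem_unitSquare.1 h
    rcases hxy.eq_or_lt with h1 | h1
    · rw [hdiag s x y (mem_unitTriangle.2 ⟨hx.1, hy.1, h1.symm.le⟩) h1.symm]
      exact if_pos h1.symm.le
    · exact if_neg (not_le.2 h1)
  obtain ⟨q, hqc, hqK, hqT⟩ := exists_equivariant_extension_square (κ := κ) huv
    (fun s ↦ by
      have hclosed : IsClosed {z : ℝ × ℝ | 1 ≤ z.1 + z.2} :=
        isClosed_le (by fun_prop) (by fun_prop)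
      have h1 : ContinuousOn (κ s) unitTriangle := (hχ s).congr (hlow s)
      have h2 : ContinuousOn (κ s) (unitSquare ∩ {z | 1 ≤ z.1 + z.2}) := by
        have : ContinuousOn (fun z : ℝ × ℝ ↦ χ (e s) (1 - z.1, 1 - z.2))
            (unitSquare ∩ {z | 1 ≤ z.1 + z.2}) := by
          refine (hχ (e s)).comp (by fun_prop) ?_
          rintro ⟨x, y⟩ ⟨⟨hx, hy⟩, hxy⟩
          simp only [Set.mem_Icc, Set.mem_ofPred_eq] at hx hy hxy
          exact mem_unitTriangle.2 ⟨by linarith, by linarith, by linarith⟩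
        exact this.congr fun z hz ↦ hup s z.1 z.2 hz.1 hz.2
      have h3 := h1.union_of_isClosed h2 isClosed_unitTriangle
        ((isClosed_Icc.prod isClosed_Icc).inter hclosed)
      refine h3.mono ?_
      rintro ⟨x, y⟩ ⟨hx, hy⟩
      rcases le_total (x + y) 1 with h | h
      · exact Or.inl (mem_unitTriangle.2 ⟨hx.1, hy.1, h⟩)
      · exact Or.inr ⟨⟨hx, hy⟩, h⟩)
    (fun s y hy ↦ by
      obtain ⟨hy0, hy1⟩ := hy
      rw [hup s 1 y (mem_unitSquare.2 ⟨by simp, hy0, hy1⟩) (by linarith),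
        hlow _ _ (mem_unitTriangle.2 ⟨le_rfl, hy0, by linarith⟩), hue]
      simp only [Equiv.Perm.mul_apply, sub_self]
      rw [hχb _ _ _ (mem_unitTriangle.2 ⟨by linarith, by linarith, by linarith⟩),
        hχc _ _ _ (mem_unitTriangle.2 ⟨by linarith, by linarith, by linarith⟩), sub_zero,
        hχa _ _ ⟨by linarith, by linarith⟩,
        hχb _ _ _ (mem_unitTriangle.2 ⟨by linarith, by linarith, by linarith⟩)])
    (fun s x hx ↦ by
      obtain ⟨hx0, hx1⟩ := hx
      rw [hup s x 1 (mem_unitSquare.2 ⟨⟨hx0, hx1⟩, by simp⟩) (by linarith),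
        hlow _ _ (mem_unitTriangle.2 ⟨hx0, le_rfl, by linarith⟩), hve]
      simp only [Equiv.Perm.mul_apply, sub_self]
      rw [hχc _ _ _ (mem_unitTriangle.2 ⟨by linarith, by linarith, by linarith⟩), sub_zero,
        hχa _ _ ⟨by linarith, by linarith⟩])
  have hqlow (s : F) (x y : ℝ) (h : (x, y) ∈ unitTriangle) : q s (x, y) = χ s (x, y) := by
    obtain ⟨hx, hy, hxy⟩ := mem_unitTriangle.1 h
    rw [hqK _ _ (mem_unitSquare.2 ⟨⟨by linarith, by linarith⟩, by linarith, by linarith⟩),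
      hlow _ _ h]
  have hqup (s : F) (x y : ℝ) (h : (x, y) ∈ unitSquare) (hxy : 1 ≤ x + y) :
      q s (x, y) = χ (e s) (1 - x, 1 - y) := by
    rw [hqK _ _ h, hup _ _ _ h hxy]
  have hqs (i j : ℤ) (s : F) (z w : ℝ × ℝ) (hzw : z + ((i : ℝ), (j : ℝ)) = w) :
      q s z = q ((u ^ i * v ^ j)⁻¹ s) w := by
    have := hqT ((u ^ i * v ^ j)⁻¹ s) i j z
    have h' : (u ^ i * v ^ j) ((u ^ i * v ^ j)⁻¹ s) = s := (u ^ i * v ^ j).apply_symm_apply s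
    rwa [h', hzw] at this
  refine ⟨q, hqc, fun s z h ↦ hqlow s z.1 z.2 h, fun i ↦ ?_⟩
  fin_cases i
  · refine equivariant_of_fundamental huv exists_sub_mem_square hqT (r := a) (k₁ := 1) (l₁ := 0)
      (k₂ := 1) (l₂ := -1) ?_ (by simpa using hua) (by simpa using hva) ?_
    · rintro ⟨x, y⟩ i j
      ext <;> simp [triangularReflection_zero] <;> ring
    · rintro s ⟨x, y⟩ h
      obtain ⟨hx, hy⟩ := mem_unitSquare.1 h
      change q (a s) (x, y) = q s (x + y, -y)
      rcases le_total (x + y) 1 with hxy | hxy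
      · rw [hqlow (a s) x y (mem_unitTriangle.2 ⟨hx.1, hy.1, hxy⟩),
          hqs 0 1 s (x + y, -y) (x + y, 1 - y) (by ext <;> simp; ring), zpow_zero, one_mul,
          zpow_one, hqup _ _ _ (mem_unitSquare.2 ⟨⟨by linarith, hxy⟩, by linarith, by linarith⟩)
            (by linarith), ← Equiv.Perm.mul_apply e, ← hcev]
        simp only [Equiv.Perm.mul_apply]
        rw [hχc _ _ _ (mem_unitTriangle.2 ⟨hx.1, hy.1, hxy⟩)]
        ring_nf
      · rw [hqup (a s) x y h hxy,
          hqs (-1) 1 s (x + y, -y) (x + y - 1, 1 - y) (by ext <;> simp <;> ring),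
          hqlow _ _ _ (mem_unitTriangle.2 ⟨by linarith, by linarith, by linarith⟩),
          ← Equiv.Perm.mul_apply e, ← hcuv]
        have : (u ^ (-1 : ℤ) * v ^ (1 : ℤ))⁻¹ = u * v⁻¹ := by
          rw [mul_inv_rev, zpow_neg_one, inv_inv, zpow_one, (huv.inv_right).eq]
        rw [this, Equiv.Perm.mul_apply c,
          hχc _ _ _ (mem_unitTriangle.2 ⟨by linarith, by linarith, by linarith⟩)]
        ring_nf
  · refine equivariant_of_fundamental huv exists_sub_mem_square hqT (r := b) (k₁ := 0) (l₁ := 1)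
      (k₂ := 1) (l₂ := 0) ?_ (by simpa using hub) (by simpa using hvb) ?_
    · rintro ⟨x, y⟩ i j
      ext <;> simp [triangularReflection_one]
    · rintro s ⟨x, y⟩ h
      obtain ⟨hx, hy⟩ := mem_unitSquare.1 h
      have h' : (y, x) ∈ unitSquare := ⟨h.2, h.1⟩
      change q (b s) (x, y) = q s (y, x)
      rcases le_total (x + y) 1 with hxy | hxy
      · rw [hqlow _ _ _ (mem_unitTriangle.2 ⟨hx.1, hy.1, hxy⟩),
          hqlow _ _ _ (mem_unitTriangle.2 ⟨hy.1, hx.1, by linarith⟩),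
          hχb _ _ _ (mem_unitTriangle.2 ⟨hx.1, hy.1, hxy⟩)]
      · rw [hqup _ _ _ h hxy, hqup _ _ _ h' (by linarith), ← Equiv.Perm.mul_apply, heb,
          Equiv.Perm.mul_apply,
          hχb _ _ _ (mem_unitTriangle.2 ⟨by linarith, by linarith, by linarith⟩)]
  · refine equivariant_of_fundamental huv exists_sub_mem_square hqT (r := c) (k₁ := -1) (l₁ := 0)
      (k₂ := -1) (l₂ := 1) ?_ (by simpa using huc) (by simpa using hvc) ?_
    · rintro ⟨x, y⟩ i j
      ext <;> simp [triangularReflection_two]; ring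
    · rintro s ⟨x, y⟩ h
      obtain ⟨hx, hy⟩ := mem_unitSquare.1 h
      change q (c s) (x, y) = q s (1 - x - y, y)
      rcases le_total (x + y) 1 with hxy | hxy
      · rw [hqlow _ _ _ (mem_unitTriangle.2 ⟨hx.1, hy.1, hxy⟩),
          hqlow _ _ _ (mem_unitTriangle.2 ⟨by linarith, by linarith, by linarith⟩),
          hχc _ _ _ (mem_unitTriangle.2 ⟨hx.1, hy.1, hxy⟩)]
      · rw [hqup (c s) x y h hxy,
          hqs 1 0 s (1 - x - y, y) (2 - x - y, y) (by ext <;> simp; ring), zpow_zero, mul_one,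
          zpow_one, hqup _ _ _ (mem_unitSquare.2 ⟨⟨by linarith, by linarith⟩, hy⟩)
            (by linarith), ← Equiv.Perm.mul_apply e, ← hceu]
        simp only [Equiv.Perm.mul_apply]
        rw [hχc _ _ _ (mem_unitTriangle.2 ⟨by linarith, by linarith, by linarith⟩)]
        ring_nf

/-- The regular hexagon with center `(0, 0)` and with two sides on the perpendicular bisectors of
`(0, 0)` and `(± 1, 0)`. -/
def unitHexagon : Set (ℝ × ℝ) :=
  {z | (-1 ≤ 2 * z.1 + z.2 ∧ 2 * z.1 + z.2 ≤ 1) ∧ (-1 ≤ z.1 + 2 * z.2 ∧ z.1 + 2 * z.2 ≤ 1) ∧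
    -1 ≤ z.1 - z.2 ∧ z.1 - z.2 ≤ 1}

theorem mem_unitHexagon {x y : ℝ} : (x, y) ∈ unitHexagon ↔ (-1 ≤ 2 * x + y ∧ 2 * x + y ≤ 1) ∧
    (-1 ≤ x + 2 * y ∧ x + 2 * y ≤ 1) ∧ -1 ≤ x - y ∧ x - y ≤ 1 := Iff.rfl

theorem isClosed_unitHexagon : IsClosed unitHexagon := by
  have h {f : ℝ × ℝ → ℝ} (hf : Continuous f) : IsClosed {z | -1 ≤ f z ∧ f z ≤ 1} :=
    isClosed_Icc.preimage hf
  have h1 := h (f := fun z ↦ 2 * z.1 + z.2) (by fun_prop)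
  have h2 := h (f := fun z ↦ z.1 + 2 * z.2) (by fun_prop)
  have h3 := h (f := fun z ↦ z.1 - z.2) (by fun_prop)
  exact h1.inter (h2.inter h3)

/-- Points of the unit square are covered by the hexagons centered at its four corners; the cases
select a suitable corner. -/
theorem exists_sub_mem_unitHexagon (z : ℝ × ℝ) :
    ∃ i j : ℤ, z - ((i : ℝ), (j : ℝ)) ∈ unitHexagon := by
  obtain ⟨i, j, h⟩ := exists_sub_mem_square z
  obtain ⟨x, y⟩ := z
  have hz (k l : ℤ) : (x, y) - (((i + k : ℤ) : ℝ), ((j + l : ℤ) : ℝ)) = (x - i - k, y - j - l) := by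
    ext <;> simp <;> ring
  obtain ⟨hx, hy⟩ := h
  simp only [Prod.fst_sub, Prod.snd_sub, Set.mem_Icc] at hx hy
  have key (k l : ℤ) (h : (x - i - k, y - j - l) ∈ unitHexagon) :
      ∃ i j : ℤ, (x, y) - ((i : ℝ), (j : ℝ)) ∈ unitHexagon :=
    ⟨i + k, j + l, by rwa [hz]⟩
  by_cases h1 : 2 * (x - i) + (y - j) ≤ 1
  · by_cases h2 : (x - i) + 2 * (y - j) ≤ 1
    · exact key 0 0 (mem_unitHexagon.2 (by push_cast; refine ⟨⟨?_, ?_⟩, ⟨?_, ?_⟩, ?_, ?_⟩ <;> linarith))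
    · exact key 0 1 (mem_unitHexagon.2 (by push_cast; refine ⟨⟨?_, ?_⟩, ⟨?_, ?_⟩, ?_, ?_⟩ <;> linarith))
  · by_cases h2 : (x - i) + 2 * (y - j) ≤ 1
    · exact key 1 0 (mem_unitHexagon.2 (by push_cast; refine ⟨⟨?_, ?_⟩, ⟨?_, ?_⟩, ?_, ?_⟩ <;> linarith))
    · by_cases h3 : 2 ≤ 2 * (x - i) + (y - j)
      · by_cases h4 : 2 ≤ (x - i) + 2 * (y - j)
        · exact key 1 1 (mem_unitHexagon.2 (by push_cast; refine ⟨⟨?_, ?_⟩, ⟨?_, ?_⟩, ?_, ?_⟩ <;> linarith))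
        · exact key 1 0 (mem_unitHexagon.2 (by push_cast; refine ⟨⟨?_, ?_⟩, ⟨?_, ?_⟩, ?_, ?_⟩ <;> linarith))
      · by_cases h5 : x - i ≤ y - j
        · exact key 0 1 (mem_unitHexagon.2 (by push_cast; refine ⟨⟨?_, ?_⟩, ⟨?_, ?_⟩, ?_, ?_⟩ <;> linarith))
        · exact key 1 0 (mem_unitHexagon.2 (by push_cast; refine ⟨⟨?_, ?_⟩, ⟨?_, ?_⟩, ?_, ?_⟩ <;> linarith))

/-- The hexagon is itself a fundamental domain, which its translates by the six shortest lattice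
vectors meet along sides. The gluing across one side is given by `hχc`, and the symmetries `a` and
`b` of the hexagon carry it to the others. -/
theorem exists_extension_hexagon (ha : a * a = 1) (hb : b * b = 1) (hc : c * c = 1)
    (hac : a * c = c * a) (hab : (a * b) ^ 6 = 1) (hbc : (b * c) ^ 3 = 1) {χ : F → ℝ × ℝ → X}
    (hχ : ∀ s, ContinuousOn (χ s) unitHexagon)
    (hχa : ∀ s x y, (x, y) ∈ unitHexagon → χ (a s) (x, y) = χ s (x + y, -y))
    (hχb : ∀ s x y, (x, y) ∈ unitHexagon → χ (b s) (x, y) = χ s (y, x))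
    (hχc : ∀ s x y, (x, y) ∈ unitHexagon → 2 * x + y = 1 → χ (c s) (x, y) = χ s (x, y)) :
    ∃ q : F → ℝ × ℝ → X, (∀ s, Continuous (q s)) ∧ (∀ s, ∀ z ∈ unitHexagon, q s z = χ s z) ∧
      ∀ i s z, q (![a, b, c] i s) z = q s (triangularReflection i z) := by
  obtain ⟨huv, hua, hva, hub, hvb, huc, hvc⟩ := hexagonal_relations ha hb hc hac hab hbc
  set u := b * a * b * a * b * c with hu
  set v := a * b * a * b * c * b with hv
  have hA {x y : ℝ} (h : (x, y) ∈ unitHexagon) : (x + y, -y) ∈ unitHexagon := by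
    obtain ⟨⟨_, _⟩, ⟨_, _⟩, _, _⟩ := mem_unitHexagon.1 h
    exact mem_unitHexagon.2 (by refine ⟨⟨?_, ?_⟩, ⟨?_, ?_⟩, ?_, ?_⟩ <;> linarith)
  have hB {x y : ℝ} (h : (x, y) ∈ unitHexagon) : (y, x) ∈ unitHexagon := by
    obtain ⟨⟨_, _⟩, ⟨_, _⟩, _, _⟩ := mem_unitHexagon.1 h
    exact mem_unitHexagon.2 (by refine ⟨⟨?_, ?_⟩, ⟨?_, ?_⟩, ?_, ?_⟩ <;> linarith)
  -- The word `b * a * b * a * b` reflects the hexagon in the line through its center parallel to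
  -- the side `2 x + y = 1`. Followed by the reflection in that side it is the translation `u`.
  have hhalf (s : F) (x y : ℝ) (h : (x, y) ∈ unitHexagon) :
      χ ((b * a * b * a * b) s) (x, y) = χ s (-x - y, y) := by
    have h1 := hB h
    have h2 := hA h1
    have h3 := hB h2
    have h4 := hA h3
    simp only [Equiv.Perm.mul_apply]
    rw [hχb _ _ _ h, hχa _ _ _ h1, hχb _ _ _ h2, hχa _ _ _ h3, hχb _ _ _ h4]
    ring_nf
  have hneg {x y : ℝ} (h : (x, y) ∈ unitHexagon) : (-x - y, y) ∈ unitHexagon := by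
    obtain ⟨⟨_, _⟩, ⟨_, _⟩, _, _⟩ := mem_unitHexagon.1 h
    exact mem_unitHexagon.2 (by refine ⟨⟨?_, ?_⟩, ⟨?_, ?_⟩, ?_, ?_⟩ <;> linarith)
  -- A point and its translate by `(1, 0)` both lie in the hexagon only if they are on two opposite
  -- sides, which determines `y`.
  have hcu (s : F) (x y : ℝ) (h : (x, y) ∈ unitHexagon) (h' : (x + 1, y) ∈ unitHexagon) :
      χ (u s) (x, y) = χ s (x + 1, y) := by
    have h1 := (mem_unitHexagon.1 h).1.1
    have h2 := (mem_unitHexagon.1 h').1.2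
    obtain rfl : y = -1 - 2 * x := by linarith
    rw [hu, Equiv.Perm.mul_apply, hhalf _ _ _ h, hχc _ _ _ (hneg h) (by ring)]
    ring_nf
  have hcv (s : F) (x y : ℝ) (h : (x, y) ∈ unitHexagon) (h' : (x, y + 1) ∈ unitHexagon) :
      χ (v s) (x, y) = χ s (x, y + 1) := by
    have : v = b * u * b := by rw [mul_assoc, hub, ← mul_assoc, hb, one_mul]
    rw [this]
    simp only [Equiv.Perm.mul_apply]
    rw [hχb _ _ _ h, hcu _ _ _ (hB h) (hB h'), hχb _ _ _ (hB h')]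
  have hcuv (s : F) (x y : ℝ) (h : (x, y) ∈ unitHexagon) (h' : (x + 1, y - 1) ∈ unitHexagon) :
      χ ((u * v⁻¹) s) (x, y) = χ s (x + 1, y - 1) := by
    have : u * v⁻¹ = a * v * a := by rw [mul_assoc a v a, hva, ← mul_assoc, ha, one_mul]
    have h1 : (x + y, -y + 1) ∈ unitHexagon := by
      have := hA h'
      ring_nf at this ⊢
      exact this
    rw [this]
    simp only [Equiv.Perm.mul_apply]
    rw [hχa _ _ _ h, hcv _ _ _ (hA h) h1, hχa _ _ _ h1]
    ring_nf
  obtain ⟨q, hqc, hqK, hqT⟩ := exists_equivariant_extension huv isClosed_unitHexagon (C := 1)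
    (by
      rintro ⟨x, y⟩ h
      obtain ⟨⟨_, _⟩, ⟨_, _⟩, _, _⟩ := mem_unitHexagon.1 h
      exact ⟨abs_le.2 ⟨by linarith, by linarith⟩, abs_le.2 ⟨by linarith, by linarith⟩⟩)
    exists_sub_mem_unitHexagon hχ
    (by
      rintro s i j ⟨x, y⟩ h h'
      have h'' : (x + i, y + j) ∈ unitHexagon := h'
      change _ = χ s (x + i, y + j)
      obtain ⟨⟨_, _⟩, ⟨_, _⟩, _, _⟩ := mem_unitHexagon.1 h
      obtain ⟨⟨_, _⟩, ⟨_, _⟩, _, _⟩ := mem_unitHexagon.1 h''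
      have h1 : 2 * i + j ≤ 2 := by exact_mod_cast (by linarith : 2 * (i : ℝ) + j ≤ 2)
      have h2 : -2 ≤ 2 * i + j := by exact_mod_cast (by linarith : -2 ≤ 2 * (i : ℝ) + j)
      have h3 : i + 2 * j ≤ 2 := by exact_mod_cast (by linarith : (i : ℝ) + 2 * j ≤ 2)
      have h4 : -2 ≤ i + 2 * j := by exact_mod_cast (by linarith : -2 ≤ (i : ℝ) + 2 * j)
      have h5 : i - j ≤ 2 := by exact_mod_cast (by linarith : (i : ℝ) - j ≤ 2)
      have h6 : -2 ≤ i - j := by exact_mod_cast (by linarith : -2 ≤ (i : ℝ) - j)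
      -- The inequalities for both points leave only zero and the six shortest lattice vectors.
      have hcases : i = 0 ∧ j = 0 ∨ i = 1 ∧ j = 0 ∨ i = -1 ∧ j = 0 ∨ i = 0 ∧ j = 1 ∨
          i = 0 ∧ j = -1 ∨ i = 1 ∧ j = -1 ∨ i = -1 ∧ j = 1 := by omega
      rcases hcases with ⟨rfl, rfl⟩ | ⟨rfl, rfl⟩ | ⟨rfl, rfl⟩ | ⟨rfl, rfl⟩ | ⟨rfl, rfl⟩ |
        ⟨rfl, rfl⟩ | ⟨rfl, rfl⟩
      · simp
      · simp only [Int.cast_one, Int.cast_zero, add_zero, zpow_one, zpow_zero, mul_one] at h'' ⊢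
        exact hcu s x y h h''
      · simp only [Int.cast_neg, Int.cast_one, Int.cast_zero, add_zero, zpow_neg_one, zpow_zero,
          mul_one] at h'' ⊢
        have := hcu (u⁻¹ s) (x + -1) y h'' (by simpa using h)
        simpa using this.symm
      · simp only [Int.cast_one, Int.cast_zero, add_zero, zpow_one, zpow_zero, one_mul] at h'' ⊢
        exact hcv s x y h h''
      · simp only [Int.cast_neg, Int.cast_one, Int.cast_zero, add_zero, zpow_neg_one, zpow_zero,
          one_mul] at h'' ⊢
        have := hcv (v⁻¹ s) x (y + -1) h'' (by simpa using h)
        simpa using this.symm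
      · simp only [Int.cast_neg, Int.cast_one, zpow_neg_one, zpow_one] at h'' ⊢
        exact hcuv s x y h h''
      · simp only [Int.cast_neg, Int.cast_one, zpow_neg_one, zpow_one] at h'' ⊢
        have := hcuv ((u⁻¹ * v) s) (x + -1) (y + 1) h'' (by simpa using h)
        have h7 : (u * v⁻¹) * (u⁻¹ * v) = 1 := by
          rw [huv.inv_right.eq]; group
        rw [← Equiv.Perm.mul_apply (u * v⁻¹), h7] at this
        simpa using this.symm)
  refine ⟨q, hqc, hqK, fun i ↦ ?_⟩
  fin_cases i
  · refine equivariant_of_fundamental huv exists_sub_mem_unitHexagon hqT (r := a) (k₁ := 1)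
      (l₁ := 0) (k₂ := 1) (l₂ := -1) ?_ (by simpa using hua) (by simpa using hva) ?_
    · rintro ⟨x, y⟩ i j
      ext <;> simp [triangularReflection_zero] <;> ring
    · rintro s ⟨x, y⟩ h
      change q (a s) (x, y) = q s (x + y, -y)
      rw [hqK _ _ h, hqK _ _ (hA h), hχa _ _ _ h]
  · refine equivariant_of_fundamental huv exists_sub_mem_unitHexagon hqT (r := b) (k₁ := 0)
      (l₁ := 1) (k₂ := 1) (l₂ := 0) ?_ (by simpa using hub) (by simpa using hvb) ?_
    · rintro ⟨x, y⟩ i j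
      ext <;> simp [triangularReflection_one]
    · rintro s ⟨x, y⟩ h
      change q (b s) (x, y) = q s (y, x)
      rw [hqK _ _ h, hqK _ _ (hB h), hχb _ _ _ h]
  · refine equivariant_of_fundamental huv exists_sub_mem_unitHexagon hqT (r := c) (k₁ := -1)
      (l₁ := 0) (k₂ := -1) (l₂ := 1) ?_ (by simpa using huc) (by simpa using hvc) ?_
    · rintro ⟨x, y⟩ i j
      ext <;> simp [triangularReflection_two]; ring
    · rintro s ⟨x, y⟩ h
      change q (c s) (x, y) = q s (1 - x - y, y)
      have h1 := hqT s 1 0 (-x - y, y)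
      have h2 : (-x - y, y) + (((1 : ℤ) : ℝ), ((0 : ℤ) : ℝ)) = (1 - x - y, y) := by
        ext <;> simp; ring
      rw [h2, zpow_one, zpow_zero, mul_one, hqK _ _ (hneg h)] at h1
      rw [← h1, hqK _ _ h, hu, Equiv.Perm.mul_apply, hhalf _ _ _ (hneg h)]
      ring_nf

end TorusMap

namespace TorusMap

open scoped ComplexConjugate

/-! ### Roots of unity -/

theorem zeta_re : zeta.re = 1 / 2 := by
  have : zeta = Complex.exp ((π / 3 : ℝ) * Complex.I) := by
    rw [zeta]; congr 1; push_cast; ring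
  rw [this, Complex.exp_ofReal_mul_I_re, Real.cos_pi_div_three]

theorem zeta_im : zeta.im = √3 / 2 := by
  have : zeta = Complex.exp ((π / 3 : ℝ) * Complex.I) := by
    rw [zeta]; congr 1; push_cast; ring
  rw [this, Complex.exp_ofReal_mul_I_im, Real.sin_pi_div_three]

theorem conj_zeta : conj zeta = 1 - zeta := by
  apply Complex.ext
  · simp [zeta_re]; norm_num
  · simp

theorem conj_two : conj (2 : ℂ) = 2 := by
  simpa using Complex.conj_ofReal 2

theorem zeta_mul_zeta : zeta * zeta = zeta - 1 := by
  have h3 : √3 * √3 = 3 := Real.mul_self_sqrt (by norm_num)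
  apply Complex.ext
  · simp [zeta_re, zeta_im]; nlinarith
  · simp [zeta_re, zeta_im]; ring

theorem corner_six_one : corner 6 1 = zeta := by
  rw [corner, zeta]
  congr 1
  have : (1 : ZMod 6).val = 1 := rfl
  rw [this]; push_cast; ring

theorem corner_three_one : corner 3 1 = zeta - 1 := by
  rw [← zeta_mul_zeta, zeta, ← Complex.exp_add, corner]
  congr 1
  have : (1 : ZMod 3).val = 1 := rfl
  rw [this]; push_cast; ring

theorem corner_three_two : corner 3 2 = -zeta := by
  have : (2 : ZMod 3) = 1 + 1 := rfl
  rw [this, corner_add, corner_three_one]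
  linear_combination zeta_mul_zeta

theorem corner_four_one : corner 4 1 = Complex.I := by
  have h1 : (1 : ZMod 4).val = 1 := rfl
  rw [corner, h1]
  exact (congrArg Complex.exp (by push_cast; ring)).trans Complex.exp_pi_div_two_mul_I

theorem corner_four_two : corner 4 2 = -1 := by
  have : (2 : ZMod 4) = 1 + 1 := rfl
  rw [this, corner_add, corner_four_one, Complex.I_mul_I]

theorem corner_four_three : corner 4 3 = -Complex.I := by
  have : (3 : ZMod 4) = 2 + 1 := rfl
  rw [this, corner_add, corner_four_one, corner_four_two, neg_one_mul]

theorem corner_six_two : corner 6 2 = zeta - 1 := by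
  have : (2 : ZMod 6) = 1 + 1 := rfl
  rw [this, corner_add, corner_six_one, zeta_mul_zeta]

theorem corner_six_three : corner 6 3 = -1 := by
  have : (3 : ZMod 6) = 2 + 1 := rfl
  rw [this, corner_add, corner_six_one, corner_six_two]
  linear_combination zeta_mul_zeta

theorem corner_six_four : corner 6 4 = -zeta := by
  have : (4 : ZMod 6) = 3 + 1 := rfl
  rw [this, corner_add, corner_six_one, corner_six_three, neg_one_mul]

theorem corner_six_five : corner 6 5 = 1 - zeta := by
  have : (5 : ZMod 6) = 3 + 2 := rfl
  rw [this, corner_add, corner_six_two, corner_six_three]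
  ring

/-! ### The regular tilings -/

theorem linearIndependent_pair_of_det {u v : ℂ} (h : u.re * v.im - u.im * v.re ≠ 0) :
    LinearIndependent ℝ ![u, v] := by
  rw [LinearIndependent.pair_iff]
  intro s t hst
  have h1 : s * u.re + t * v.re = 0 := by simpa using congrArg Complex.re hst
  have h2 : s * u.im + t * v.im = 0 := by simpa using congrArg Complex.im hst
  constructor
  · refine (mul_eq_zero.1 (?_ : s * (u.re * v.im - u.im * v.re) = 0)).resolve_right h
    linear_combination v.im * h1 - v.re * h2
  · refine (mul_eq_zero.1 (?_ : t * (u.re * v.im - u.im * v.re) = 0)).resolve_right h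
    linear_combination u.re * h2 - u.im * h1

/-- Affine coordinates of the plane. -/
def affineMap (c : ℂ) {u v : ℂ} (h : LinearIndependent ℝ ![u, v]) : ℝ × ℝ ≃ₜ ℂ :=
  (exists_coordinates h).choose.symm.toHomeomorph.trans (Homeomorph.addLeft c)

theorem affineMap_apply (c : ℂ) {u v : ℂ} (h : LinearIndependent ℝ ![u, v]) (x y : ℝ) :
    affineMap c h (x, y) = c + (x * u + y * v) := by
  have := (exists_coordinates h).choose_spec x y
  simp only [Complex.real_smul] at this
  rw [← this]
  rfl

/-- These are the edge vectors of the standard triangle at corner `0`. Its sides have length `√3`,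
so the coordinates of the model differ from those of the tiling with unit edges by a similarity. -/
theorem linearIndependent_triangle : LinearIndependent ℝ ![zeta - 2, -zeta - 1] := by
  apply linearIndependent_pair_of_det
  have : (0 : ℝ) < √3 := by positivity
  simp [zeta_re, zeta_im]
  intro h
  nlinarith

theorem linearIndependent_square : LinearIndependent ℝ ![Complex.I - 1, -Complex.I - 1] := by
  apply linearIndependent_pair_of_det
  norm_num

/-- These vectors lead from the center of the standard hexagon to the centers of two neighbors,
across the two sides at corner `0`. -/
theorem linearIndependent_hexagon : LinearIndependent ℝ ![1 + zeta, 2 - zeta] := by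
  apply linearIndependent_pair_of_det
  have : (0 : ℝ) < √3 := by positivity
  simp [zeta_re, zeta_im]
  intro h
  nlinarith

/-- The tiling by triangles. -/
def triangleModel : TilingModel 3 where
  place := affineMap 1 linearIndependent_triangle
  -- Here the origin is a vertex and side `0` joins `0` and `1`, so the line through `0` and `1`
  -- belongs to index `2` and the bisector of the side to index `0`. The order of the reflections is
  -- therefore reversed.
  reflection := triangularReflection ∘ Fin.rev
  place_reflection := by
    rintro i ⟨x, y⟩
    fin_cases i
    · change affineMap _ _ (1 - x - y, y) = _
      simp only [polygonReflection, affineMap_apply, corner_three_one]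
      simp [conj_zeta, conj_two]
      linear_combination (x - y : ℂ) * zeta_mul_zeta
    · change affineMap _ _ (y, x) = _
      simp only [polygonReflection, affineMap_apply, corner_three_one]
      simp [conj_zeta, conj_two]
      ring
    · change affineMap _ _ (x + y, -y) = _
      simp only [polygonReflection, affineMap_apply, corner_three_one]
      simp [conj_zeta, conj_two]
      linear_combination (y - x : ℂ) * zeta_mul_zeta

/-- The tiling by squares. -/
def squareModel : TilingModel 4 where
  place := affineMap 1 linearIndependent_square
  reflection := squareReflection ∘ Fin.rev
  place_reflection := by
    rintro i ⟨x, y⟩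
    fin_cases i
    · change affineMap _ _ (1 - x, y) = _
      simp only [polygonReflection, affineMap_apply, corner_four_one]
      simp
      linear_combination (x - y : ℂ) * Complex.I_mul_I
    · change affineMap _ _ (y, x) = _
      simp only [polygonReflection, affineMap_apply, corner_four_one]
      simp
      ring
    · change affineMap _ _ (x, -y) = _
      simp only [polygonReflection, affineMap_apply, corner_four_one]
      simp
      linear_combination (y - x : ℂ) * Complex.I_mul_I

/-- The tiling by hexagons. -/
def hexagonModel : TilingModel 6 where
  place := affineMap 0 linearIndependent_hexagon
  -- The origin is the center of the hexagon. The bisector of `0` and `1` carries side `0`, and the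
  -- line through `0` and `1` passes through the middle of that side, so the order is kept.
  reflection := triangularReflection
  place_reflection := by
    rintro i ⟨x, y⟩
    fin_cases i
    · change affineMap _ _ (x + y, -y) = _
      simp only [polygonReflection, affineMap_apply, corner_six_one]
      simp [conj_zeta, conj_two]
      linear_combination (x - y : ℂ) * zeta_mul_zeta
    · change affineMap _ _ (y, x) = _
      simp only [polygonReflection, affineMap_apply, corner_six_one]
      simp [conj_zeta, conj_two]
      ring
    · change affineMap _ _ (1 - x - y, y) = _
      simp only [polygonReflection, affineMap_apply, corner_six_one]
      simp [conj_zeta, conj_two]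
      linear_combination (y - x : ℂ) * zeta_mul_zeta

theorem triangleModel_place (x y : ℝ) :
    triangleModel.place (x, y) = 1 + (x * (zeta - 2) + y * (-zeta - 1)) :=
  affineMap_apply _ linearIndependent_triangle _ _

theorem squareModel_place (x y : ℝ) :
    squareModel.place (x, y) = 1 + (x * (Complex.I - 1) + y * (-Complex.I - 1)) :=
  affineMap_apply _ linearIndependent_square _ _

theorem hexagonModel_place (x y : ℝ) :
    hexagonModel.place (x, y) = x * (1 + zeta) + y * (2 - zeta) :=
  (affineMap_apply _ linearIndependent_hexagon _ _).trans (zero_add _)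

/-- The plane set described in coordinates contains the polygon if it is convex and contains its
corners. -/
theorem polygon_subset_of_affineMap {n : ℕ} {c u v : ℂ} {h : LinearIndependent ℝ ![u, v]}
    {K : Set (ℝ × ℝ)} (hK : Convex ℝ K) (hc : ∀ k, ∃ z ∈ K, affineMap c h z = corner n k) {z : ℝ × ℝ}
    (hz : affineMap c h z ∈ Polygon n) : z ∈ K := by
  have hconv : Convex ℝ (affineMap c h '' K) := by
    rintro _ ⟨⟨x, y⟩, hx, rfl⟩ _ ⟨⟨x', y'⟩, hx', rfl⟩ s t hs ht hst
    refine ⟨s • (x, y) + t • (x', y'), hK hx hx' hs ht hst, ?_⟩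
    have hst' : (s : ℂ) + t = 1 := by exact_mod_cast hst
    simp only [Prod.smul_mk, Prod.mk_add_mk, affineMap_apply, Complex.real_smul, smul_eq_mul]
    push_cast
    linear_combination (-c) * hst'
  obtain ⟨w, hw, hwz⟩ := convexHull_min (by rintro _ ⟨k, rfl⟩; exact hc k) hconv hz
  exact (affineMap c h).injective hwz ▸ hw

theorem corner_mem_polygon {n : ℕ} (k : ZMod n) : corner n k ∈ Polygon n :=
  subset_convexHull ℝ _ (Set.mem_range_self k)

theorem combo_mem {K : Set ℂ} (hK : Convex ℝ K) {P Q R : ℂ} (hP : P ∈ K) (hQ : Q ∈ K) (hR : R ∈ K)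
    {a b c : ℝ} (ha : 0 ≤ a) (hb : 0 ≤ b) (hc : 0 ≤ c) (habc : a + b + c = 1) {z : ℂ}
    (hz : z = a * P + b * Q + c * R) : z ∈ K := by
  have := hK.sum_mem (t := Finset.univ) (w := ![a, b, c]) (z := ![P, Q, R])
    (by intro i _; fin_cases i <;> assumption) (by simpa [Fin.sum_univ_three] using habc)
    (by intro i _; fin_cases i <;> assumption)
  simpa [Fin.sum_univ_three, hz] using this

theorem triangleModel_mem_polygon {z : ℝ × ℝ} :
    triangleModel.place z ∈ Polygon 3 ↔ z ∈ unitTriangle := by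
  constructor
  · refine polygon_subset_of_affineMap (h := linearIndependent_triangle) ?_ ?_
    · rintro ⟨x, y⟩ ⟨h1, h2, h3⟩ ⟨x', y'⟩ ⟨h1', h2', h3'⟩ s t hs ht hst
      simp only at h1 h2 h3 h1' h2' h3'
      rw [Prod.smul_mk, Prod.smul_mk, Prod.mk_add_mk, mem_unitTriangle]
      simp only [smul_eq_mul]
      refine ⟨?_, ?_, ?_⟩
      · positivity
      · positivity
      · nlinarith
    · intro k
      fin_cases k
      · refine ⟨(0, 0), mem_unitTriangle.2 (by norm_num), ?_⟩
        rw [affineMap_apply]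
        refine Eq.trans ?_ corner_zero.symm
        push_cast; ring
      · refine ⟨(1, 0), mem_unitTriangle.2 (by norm_num), ?_⟩
        rw [affineMap_apply]
        refine Eq.trans ?_ corner_three_one.symm
        push_cast; ring
      · refine ⟨(0, 1), mem_unitTriangle.2 (by norm_num), ?_⟩
        rw [affineMap_apply]
        refine Eq.trans ?_ corner_three_two.symm
        push_cast; ring
  · obtain ⟨x, y⟩ := z
    rintro ⟨h1, h2, h3⟩
    refine combo_mem (convex_convexHull ℝ _) (corner_mem_polygon 0) (corner_mem_polygon 1)
      (corner_mem_polygon 2) (sub_nonneg.2 h3) h1 h2 (by ring) ?_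
    rw [triangleModel_place, corner_zero, corner_three_one, corner_three_two]
    push_cast; ring

theorem squareModel_mem_polygon {z : ℝ × ℝ} :
    squareModel.place z ∈ Polygon 4 ↔ z ∈ unitSquare := by
  constructor
  · refine polygon_subset_of_affineMap (h := linearIndependent_square) ((convex_Icc 0 1).prod (convex_Icc 0 1)) ?_
    intro k
    fin_cases k
    · refine ⟨(0, 0), mem_unitSquare.2 (by norm_num), ?_⟩
      rw [affineMap_apply]
      refine Eq.trans ?_ corner_zero.symm
      push_cast; ring
    · refine ⟨(1, 0), mem_unitSquare.2 (by norm_num), ?_⟩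
      rw [affineMap_apply]
      refine Eq.trans ?_ corner_four_one.symm
      push_cast; ring
    · refine ⟨(1, 1), mem_unitSquare.2 (by norm_num), ?_⟩
      rw [affineMap_apply]
      refine Eq.trans ?_ corner_four_two.symm
      push_cast; ring
    · refine ⟨(0, 1), mem_unitSquare.2 (by norm_num), ?_⟩
      rw [affineMap_apply]
      refine Eq.trans ?_ corner_four_three.symm
      push_cast; ring
  · obtain ⟨x, y⟩ := z
    rintro ⟨hx, hy⟩
    have hconv : Convex ℝ (Polygon 4) := convex_convexHull ℝ _
    have e1 := hconv (corner_mem_polygon 0) (corner_mem_polygon 1) (sub_nonneg.2 hx.2) hx.1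
      (by ring)
    have e2 := hconv (corner_mem_polygon 3) (corner_mem_polygon 2) (sub_nonneg.2 hx.2) hx.1
      (by ring)
    have e3 := hconv e1 e2 (sub_nonneg.2 hy.2) hy.1 (by ring)
    convert e3 using 1
    rw [squareModel_place, corner_zero, corner_four_one, corner_four_two, corner_four_three]
    simp only [Complex.real_smul]
    push_cast; ring

theorem hexagonModel_mem_polygon {z : ℝ × ℝ} :
    hexagonModel.place z ∈ Polygon 6 ↔ z ∈ unitHexagon := by
  constructor
  · refine polygon_subset_of_affineMap (h := linearIndependent_hexagon) ?_ ?_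
    · rintro ⟨x, y⟩ h ⟨x', y'⟩ h' s t hs ht hst
      obtain ⟨⟨_, _⟩, ⟨_, _⟩, _, _⟩ := mem_unitHexagon.1 h
      obtain ⟨⟨_, _⟩, ⟨_, _⟩, _, _⟩ := mem_unitHexagon.1 h'
      obtain rfl : t = 1 - s := by linarith
      rw [Prod.smul_mk, Prod.smul_mk, Prod.mk_add_mk, mem_unitHexagon]
      simp only [smul_eq_mul]
      refine ⟨⟨?_, ?_⟩, ⟨?_, ?_⟩, ?_, ?_⟩ <;> nlinarith
    · intro k
      fin_cases k
      · refine ⟨(1 / 3, 1 / 3), mem_unitHexagon.2 (by norm_num), ?_⟩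
        rw [affineMap_apply]
        refine Eq.trans ?_ corner_zero.symm
        push_cast; ring
      · refine ⟨(2 / 3, -1 / 3), mem_unitHexagon.2 (by norm_num), ?_⟩
        rw [affineMap_apply]
        refine Eq.trans ?_ corner_six_one.symm
        push_cast; ring
      · refine ⟨(1 / 3, -2 / 3), mem_unitHexagon.2 (by norm_num), ?_⟩
        rw [affineMap_apply]
        refine Eq.trans ?_ corner_six_two.symm
        push_cast; ring
      · refine ⟨(-1 / 3, -1 / 3), mem_unitHexagon.2 (by norm_num), ?_⟩
        rw [affineMap_apply]
        refine Eq.trans ?_ corner_six_three.symm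
        push_cast; ring
      · refine ⟨(-2 / 3, 1 / 3), mem_unitHexagon.2 (by norm_num), ?_⟩
        rw [affineMap_apply]
        refine Eq.trans ?_ corner_six_four.symm
        push_cast; ring
      · refine ⟨(-1 / 3, 2 / 3), mem_unitHexagon.2 (by norm_num), ?_⟩
        rw [affineMap_apply]
        refine Eq.trans ?_ corner_six_five.symm
        push_cast; ring
  · obtain ⟨x, y⟩ := z
    intro h
    obtain ⟨⟨h1, h2⟩, ⟨h3, h4⟩, h5, h6⟩ := mem_unitHexagon.1 h
    have key (k : ZMod 6) {a b : ℝ} (ha : 0 ≤ a) (hb : 0 ≤ b) (hab : a + b ≤ 1)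
        (e : hexagonModel.place (x, y) = a * corner 6 k + b * corner 6 (k + 1)) :
        hexagonModel.place (x, y) ∈ Polygon 6 :=
      combo_mem (convex_convexHull ℝ _) (zero_mem_polygon (by norm_num)) (corner_mem_polygon k)
        (corner_mem_polygon (k + 1)) (sub_nonneg.2 hab) ha hb (by ring) (by rw [e]; simp)
    -- The signs of the three linear forms, which up to sign are coordinates with respect to
    -- consecutive corners, select one of the six triangles spanned by the center and a side. As `2
    -- x + y` is the sum of the other two forms, two of the eight cases are degenerate.
    rcases le_total 0 (x + 2 * y) with hp | hp <;> rcases le_total 0 (x - y) with hr | hr <;>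
      rcases le_total 0 (2 * x + y) with hm | hm
    · refine key 0 hp hr (by linarith) ?_
      rw [hexagonModel_place, zero_add, corner_zero, corner_six_one]
      push_cast; ring
    · refine key 0 hp hr (by linarith) ?_
      rw [hexagonModel_place, zero_add, corner_zero, corner_six_one]
      push_cast; ring
    · refine key 5 (neg_nonneg.2 hr) hm (by linarith) ?_
      have : (5 + 1 : ZMod 6) = 0 := rfl
      rw [hexagonModel_place, this, corner_zero, corner_six_five]
      push_cast; ring
    · refine key 4 (neg_nonneg.2 hm) hp (by linarith) ?_
      have : (4 + 1 : ZMod 6) = 5 := rfl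
      rw [hexagonModel_place, this, corner_six_four, corner_six_five]
      push_cast; ring
    · refine key 1 hm (neg_nonneg.2 hp) (by linarith) ?_
      have : (1 + 1 : ZMod 6) = 2 := rfl
      rw [hexagonModel_place, this, corner_six_one, corner_six_two]
      push_cast; ring
    · refine key 2 hr (neg_nonneg.2 hm) (by linarith) ?_
      have : (2 + 1 : ZMod 6) = 3 := rfl
      rw [hexagonModel_place, this, corner_six_two, corner_six_three]
      push_cast; ring
    · refine key 3 (neg_nonneg.2 hp) (neg_nonneg.2 hr) (by linarith) ?_
      have : (3 + 1 : ZMod 6) = 4 := rfl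
      rw [hexagonModel_place, this, corner_six_three, corner_six_four]
      push_cast; ring
    · refine key 3 (neg_nonneg.2 hp) (neg_nonneg.2 hr) (by linarith) ?_
      have : (3 + 1 : ZMod 6) = 4 := rfl
      rw [hexagonModel_place, this, corner_six_three, corner_six_four]
      push_cast; ring

end TorusMap

namespace TorusMap

open scoped ComplexConjugate

/-! ### Existence of developments -/

namespace Gluing

variable {n : ℕ} [NeZero n] {G : Gluing n}

theorem polygonSymmetry_not (k : ZMod n) (b : Bool) (z : ℂ) :
    polygonSymmetry k (!b) z = polygonSymmetry k b (polygonReflection n 0 z) := by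
  have := corner_mul_conj (n := n) 1
  cases b
  · simp [polygonReflection, corner_add, mul_assoc]
  · simp [polygonReflection, corner_add]
    linear_combination (-corner n k * z) * this

theorem polygonSymmetry_turn (s : G.Flag) (z : ℂ) :
    polygonSymmetry (G.turn s).1.2 (G.turn s).2 z =
      polygonSymmetry s.1.2 s.2 (polygonReflection n 1 z) := by
  obtain ⟨⟨f, k⟩, _ | _⟩ := s <;> simp [polygonReflection, turn_apply]

theorem polygonReflection_mem {i : Fin 3} (hi : i ≠ 2) {z : ℂ} (hz : z ∈ Polygon n) :
    polygonReflection n i z ∈ Polygon n := by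
  fin_cases i
  · have := (polygonSymmetry_mem_polygon (n := n) (k := 0) (b := true)).2 hz
    simpa [polygonReflection] using this
  · have := (polygonSymmetry_mem_polygon (n := n) (k := -1) (b := true)).2 hz
    simpa [polygonReflection] using this
  · exact absurd rfl hi

/-- The reflections `0` and `1` stay in the same face, so their effect on charts is precomposition
with a symmetry of the standard polygon. -/
theorem chart_flagPerm {i : Fin 3} (hi : i ≠ 2) (s : G.Flag) (x : Polygon n) :
    chart (G.flagPerm i s) x =
      chart s ⟨polygonReflection n i x, polygonReflection_mem hi x.2⟩ := by
  unfold chart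
  fin_cases i
  · congr 2
    exact Subtype.ext (polygonSymmetry_not _ _ _)
  · congr 2
    exact Subtype.ext (polygonSymmetry_turn _ _)
  · exact absurd rfl hi

/-- Charts on the two sides of an edge agree along that edge; this supplies the boundary conditions
for extending charts to the plane. -/
theorem chart_cross_side (s : G.Flag) (t : I) :
    chart (G.cross s) (side n 0 t) = chart s (side n 0 t) := by
  rw [chart_side, chart_side, Gluing.cross_apply]
  have := Quot.sound (Glued.of_side (G := G) s.1 (if s.2 then σ t else t))
  rw [this]
  cases s.2 <;> cases G.rev s.1 <;> simp

end Gluing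

namespace TilingModel

open Gluing

variable {n : ℕ} [NeZero n] (T : TilingModel n) {G : Gluing n}

open Classical in
/-- The chart of a flag in the coordinates of the tiling, arbitrary outside of the base tile. -/
def tileChart (s : G.Flag) (z : ℝ × ℝ) : G.Space :=
  if h : T.place z ∈ Polygon n then chart s ⟨T.place z, h⟩ else chart s (side n 0 0)

variable {T}

theorem tileChart_of_mem (s : G.Flag) {z : ℝ × ℝ} (h : T.place z ∈ Polygon n) :
    T.tileChart s z = chart s ⟨T.place z, h⟩ := dif_pos h

theorem continuousOn_tileChart (s : G.Flag) : ContinuousOn (T.tileChart s) {z | T.place z ∈ Polygon n} := by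
  rw [continuousOn_iff_continuous_domRestrict]
  have : Set.domRestrict {z | T.place z ∈ Polygon n} (T.tileChart s) =
      fun z : {z | T.place z ∈ Polygon n} ↦ chart s ⟨T.place z, z.2⟩ := funext fun z ↦ tileChart_of_mem s z.2
  rw [this]
  exact (continuous_chart s).comp
    (Continuous.subtype_mk (T.place.continuous.comp continuous_subtype_val) _)

theorem tileChart_flagPerm {i : Fin 3} (hi : i ≠ 2) (s : G.Flag) {z : ℝ × ℝ}
    (h : T.place z ∈ Polygon n) :
    T.tileChart (G.flagPerm i s) z = T.tileChart s (T.reflection i z) := by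
  have h' : T.place (T.reflection i z) ∈ Polygon n := by
    rw [T.place_reflection]
    exact polygonReflection_mem hi h
  rw [tileChart_of_mem _ h, tileChart_of_mem _ h', chart_flagPerm hi]
  congr 1
  exact Subtype.ext (T.place_reflection i z).symm

theorem tileChart_cross (s : G.Flag) {z : ℝ × ℝ} {t : I} (h : T.place z = side n 0 t) :
    T.tileChart (G.cross s) z = T.tileChart s z := by
  have h' : T.place z ∈ Polygon n := h ▸ (side n 0 t).2
  rw [tileChart_of_mem _ h', tileChart_of_mem _ h']
  have : (⟨T.place z, h'⟩ : Polygon n) = side n 0 t := Subtype.ext h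
  rw [this, chart_cross_side]

theorem isDevelopment_of_eq_tileChart {q : G.Flag → ℝ × ℝ → G.Space} (hq : ∀ s, Continuous (q s))
    (hqχ : ∀ s z, T.place z ∈ Polygon n → q s z = T.tileChart s z)
    (hqr : ∀ i s z, q (G.flagPerm i s) z = q s (T.reflection i z))
    (hT : ∀ z, ∃ g ∈ T.group, T.place (g z) ∈ Polygon n) : IsDevelopment T q where
  continuous := hq
  eq_chart s x := by
    have h : T.place (T.place.symm x) ∈ Polygon n := by simp
    rw [hqχ s _ h, tileChart_of_mem s h]
    congr 1
    exact Subtype.ext (by simp)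
  reflect := hqr
  exists_mem := hT

end TilingModel

open Gluing

theorem pow_mul_comm_eq_one {M : Type*} [Group M] {a b : M} {k : ℕ} (ha : a * a = 1) (hb : b * b = 1)
    (h : (a * b) ^ k = 1) : (b * a) ^ k = 1 := by
  have : b * a = (a * b)⁻¹ := by
    rw [mul_inv_rev, inv_eq_of_mul_eq_one_left ha, inv_eq_of_mul_eq_one_left hb]
  rw [this, inv_pow, h, inv_one]

theorem triangleModel_place_side {x : ℝ} (hx : x ∈ Set.Icc (0 : ℝ) 1) :
    triangleModel.place (x, 0) = side 3 0 ⟨x, hx⟩ := by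
  rw [triangleModel_place, coe_side, corner_zero, corner_three_one]
  push_cast; ring

theorem squareModel_place_side {x : ℝ} (hx : x ∈ Set.Icc (0 : ℝ) 1) :
    squareModel.place (x, 0) = side 4 0 ⟨x, hx⟩ := by
  rw [squareModel_place, coe_side, corner_zero, corner_four_one]
  push_cast; ring

theorem hexagonModel_place_side {x : ℝ} (hx : x ∈ Set.Icc (0 : ℝ) 1) :
    hexagonModel.place ((1 + x) / 3, (1 - 2 * x) / 3) = side 6 0 ⟨x, hx⟩ := by
  rw [hexagonModel_place, coe_side, corner_zero, corner_six_one]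
  push_cast; ring

/-- The generators of the extension are taken in the order `cross`, `turn`, `flipEnd`: the relation
of order six expresses the vertex degree, and that of order three the number of sides. -/
theorem exists_isDevelopment_triangle {G : Gluing 3} (h : (G.turn * G.cross) ^ 6 = 1)
    (hT : ∀ z, ∃ g ∈ triangleModel.group, triangleModel.place (g z) ∈ Polygon 3) :
    ∃ q : G.Flag → ℝ × ℝ → G.Space, IsDevelopment triangleModel q := by
  have hmem (z : ℝ × ℝ) : z ∈ unitTriangle ↔ triangleModel.place z ∈ Polygon 3 :=
    triangleModel_mem_polygon.symm
  obtain ⟨q, hq, hqχ, hqr⟩ := exists_extension_triangle G.cross_mul_self G.turn_mul_self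
    G.flipEnd_mul_self G.flipEnd_mul_cross.symm
    (pow_mul_comm_eq_one G.turn_mul_self G.cross_mul_self h)
    (pow_mul_comm_eq_one G.flipEnd_mul_self G.turn_mul_self G.flipEnd_mul_turn_pow_eq_one)
    (χ := triangleModel.tileChart)
    (fun s ↦ (TilingModel.continuousOn_tileChart s).mono fun z hz ↦ (hmem z).1 hz)
    (fun s x hx ↦ TilingModel.tileChart_cross s (triangleModel_place_side hx))
    (fun s x y hz ↦ TilingModel.tileChart_flagPerm (T := triangleModel) (i := 1) (by decide) s
      ((hmem _).1 hz))
    (fun s x y hz ↦ TilingModel.tileChart_flagPerm (T := triangleModel) (i := 0) (by decide) s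
      ((hmem _).1 hz))
  refine ⟨q, TilingModel.isDevelopment_of_eq_tileChart hq
    (fun s z hz ↦ hqχ s z ((hmem z).2 hz)) (fun i s z ↦ ?_) hT⟩
  fin_cases i
  · exact hqr 2 s z
  · exact hqr 1 s z
  · exact hqr 0 s z

theorem exists_isDevelopment_square {G : Gluing 4} (h : (G.turn * G.cross) ^ 4 = 1)
    (hT : ∀ z, ∃ g ∈ squareModel.group, squareModel.place (g z) ∈ Polygon 4) :
    ∃ q : G.Flag → ℝ × ℝ → G.Space, IsDevelopment squareModel q := by
  have hmem (z : ℝ × ℝ) : z ∈ unitSquare ↔ squareModel.place z ∈ Polygon 4 :=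
    squareModel_mem_polygon.symm
  obtain ⟨q, hq, hqχ, hqr⟩ := exists_extension_square G.cross_mul_self G.turn_mul_self
    G.flipEnd_mul_self G.flipEnd_mul_cross.symm
    (pow_mul_comm_eq_one G.turn_mul_self G.cross_mul_self h)
    (pow_mul_comm_eq_one G.flipEnd_mul_self G.turn_mul_self G.flipEnd_mul_turn_pow_eq_one)
    (χ := squareModel.tileChart)
    (fun s ↦ (TilingModel.continuousOn_tileChart s).mono fun z hz ↦ (hmem z).1 hz)
    (fun s x hx ↦ TilingModel.tileChart_cross s (squareModel_place_side hx))
    (fun s x y hz ↦ TilingModel.tileChart_flagPerm (T := squareModel) (i := 1) (by decide) s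
      ((hmem _).1 hz))
    (fun s x y hz ↦ TilingModel.tileChart_flagPerm (T := squareModel) (i := 0) (by decide) s
      ((hmem _).1 hz))
  refine ⟨q, TilingModel.isDevelopment_of_eq_tileChart hq
    (fun s z hz ↦ hqχ s z ((hmem z).2 hz)) (fun i s z ↦ ?_) hT⟩
  fin_cases i
  · exact hqr 2 s z
  · exact hqr 1 s z
  · exact hqr 0 s z

/-- Dually to triangles, the generators are `flipEnd`, `turn`, `cross`; now the relation of order
six comes from the polygon and that of order three from the vertex degree. -/
theorem exists_isDevelopment_hexagon {G : Gluing 6} (h : (G.turn * G.cross) ^ 3 = 1)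
    (hT : ∀ z, ∃ g ∈ hexagonModel.group, hexagonModel.place (g z) ∈ Polygon 6) :
    ∃ q : G.Flag → ℝ × ℝ → G.Space, IsDevelopment hexagonModel q := by
  have hmem (z : ℝ × ℝ) : z ∈ unitHexagon ↔ hexagonModel.place z ∈ Polygon 6 :=
    hexagonModel_mem_polygon.symm
  obtain ⟨q, hq, hqχ, hqr⟩ := exists_extension_hexagon G.flipEnd_mul_self G.turn_mul_self
    G.cross_mul_self G.flipEnd_mul_cross G.flipEnd_mul_turn_pow_eq_one h
    (χ := hexagonModel.tileChart)
    (fun s ↦ (TilingModel.continuousOn_tileChart s).mono fun z hz ↦ (hmem z).1 hz)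
    (fun s x y hz ↦ TilingModel.tileChart_flagPerm (T := hexagonModel) (i := 0) (by decide) s
      ((hmem _).1 hz))
    (fun s x y hz ↦ TilingModel.tileChart_flagPerm (T := hexagonModel) (i := 1) (by decide) s
      ((hmem _).1 hz))
    (fun s x y hz hxy ↦ by
      obtain ⟨⟨h1, h2⟩, ⟨h3, h4⟩, h5, h6⟩ := mem_unitHexagon.1 hz
      -- On the line `2 x + y = 1`, the parameter of the point along side `0` is `3 x - 1`, by
      -- `hexagonModel_place_side`.
      have hx : 3 * x - 1 ∈ Set.Icc (0 : ℝ) 1 := ⟨by linarith, by linarith⟩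
      refine TilingModel.tileChart_cross s (t := ⟨3 * x - 1, hx⟩) ?_
      rw [← hexagonModel_place_side hx]
      congr 2
      · ring
      · linarith)
  refine ⟨q, TilingModel.isDevelopment_of_eq_tileChart hq
    (fun s z hz ↦ hqχ s z ((hmem z).2 hz)) (fun i s z ↦ ?_) hT⟩
  fin_cases i
  · exact hqr 0 s z
  · exact hqr 1 s z
  · exact hqr 2 s z

end TorusMap

namespace TorusMap

/-! ### The symmetry groups of the tilings -/

/-- The permutation `g` of the plane is the affine map with linear part `M` (its rows one after the
other) and translation part `(k, l)`. -/
def IsIntegralAffine (g : Equiv.Perm (ℝ × ℝ)) (M : ℤ × ℤ × ℤ × ℤ) (k l : ℤ) : Prop :=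
  ∀ x y : ℝ, g (x, y) = (M.1 * x + M.2.1 * y + k, M.2.2.1 * x + M.2.2.2 * y + l)

/-- The product of two matrices. -/
def matrixMul (M N : ℤ × ℤ × ℤ × ℤ) : ℤ × ℤ × ℤ × ℤ :=
  (M.1 * N.1 + M.2.1 * N.2.2.1, M.1 * N.2.1 + M.2.1 * N.2.2.2,
    M.2.2.1 * N.1 + M.2.2.2 * N.2.2.1, M.2.2.1 * N.2.1 + M.2.2.2 * N.2.2.2)

theorem IsIntegralAffine.mul {g h : Equiv.Perm (ℝ × ℝ)} {M N : ℤ × ℤ × ℤ × ℤ} {k l k' l' : ℤ}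
    (hg : IsIntegralAffine g M k l) (hh : IsIntegralAffine h N k' l') :
    IsIntegralAffine (g * h) (matrixMul M N) (M.1 * k' + M.2.1 * l' + k)
      (M.2.2.1 * k' + M.2.2.2 * l' + l) := by
  intro x y
  rw [Equiv.Perm.mul_apply, hh, hg]
  ext <;> simp [matrixMul] <;> ring

theorem IsIntegralAffine.eq_one {g : Equiv.Perm (ℝ × ℝ)} {k l : ℤ}
    (h : IsIntegralAffine g (1, 0, 0, 1) k l) {w : ℝ × ℝ} (hw : g w = w) : g = 1 := by
  obtain ⟨x, y⟩ := w
  have h1 := h x y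
  rw [hw] at h1
  simp only [Prod.mk.injEq, Int.cast_one, Int.cast_zero] at h1
  have hk : (k : ℝ) = 0 := by linarith
  have hl : (l : ℝ) = 0 := by linarith
  ext1 ⟨x, y⟩
  rw [h x y]
  ext <;> simp [hk, hl]

/-- A finite list of matrices that contains the identity and is stable under left multiplication by
the generators contains all linear parts. Stability is decidable, since the entries are integers. -/
theorem exists_isIntegralAffine_of_generators {R : Fin 3 → Equiv.Perm (ℝ × ℝ)}
    (hR : ∀ i z, R i (R i z) = z) {S : List (ℤ × ℤ × ℤ × ℤ)} (h1 : (1, 0, 0, 1) ∈ S)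
    {M : Fin 3 → ℤ × ℤ × ℤ × ℤ} {k l : Fin 3 → ℤ} (h : ∀ i, IsIntegralAffine (R i) (M i) (k i) (l i))
    (hS : ∀ i, ∀ N ∈ S, matrixMul (M i) N ∈ S) {g : Equiv.Perm (ℝ × ℝ)}
    (hg : g ∈ Subgroup.closure (Set.range R)) : ∃ N ∈ S, ∃ k l, IsIntegralAffine g N k l := by
  induction hg using Subgroup.closure_induction_left with
  | one => exact ⟨_, h1, 0, 0, fun x y ↦ by simp⟩
  | mul_left x hx y hy ih =>
    obtain ⟨i, rfl⟩ := hx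
    obtain ⟨N, hN, k', l', hN'⟩ := ih
    exact ⟨_, hS i N hN, _, _, (h i).mul hN'⟩
  | inv_mul_cancel x hx y hy ih =>
    obtain ⟨i, rfl⟩ := hx
    obtain ⟨N, hN, k', l', hN'⟩ := ih
    have : (R i)⁻¹ = R i := by
      ext1 z
      rw [Equiv.Perm.inv_eq_iff_eq, hR]
    rw [this]
    exact ⟨_, hS i N hN, _, _, (h i).mul hN'⟩

/-- The symmetry group of the square tiling. -/
def squareGroup : Subgroup (Equiv.Perm (ℝ × ℝ)) := Subgroup.closure (Set.range squareReflection)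

/-- The symmetry group of the triangular tiling. -/
def triangularGroup : Subgroup (Equiv.Perm (ℝ × ℝ)) :=
  Subgroup.closure (Set.range triangularReflection)

theorem squareReflection_mem (i : Fin 3) : squareReflection i ∈ squareGroup :=
  Subgroup.subset_closure (Set.mem_range_self i)

theorem triangularReflection_mem (i : Fin 3) : triangularReflection i ∈ triangularGroup :=
  Subgroup.subset_closure (Set.mem_range_self i)

theorem squareModel_group : squareModel.group = squareGroup := by
  unfold squareGroup TilingModel.group
  congr 1
  exact Fin.rev_surjective.range_comp squareReflection

theorem triangleModel_group : triangleModel.group = triangularGroup := by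
  unfold triangularGroup TilingModel.group
  congr 1
  exact Fin.rev_surjective.range_comp triangularReflection

theorem hexagonModel_group : hexagonModel.group = triangularGroup := rfl

theorem exists_isIntegralAffine_square {g : Equiv.Perm (ℝ × ℝ)} (hg : g ∈ squareGroup) :
    ∃ M ∈ [(1, 0, 0, 1), (-1, 0, 0, -1), (0, -1, 1, 0), (0, 1, -1, 0), (1, 0, 0, -1),
      (-1, 0, 0, 1), (0, 1, 1, 0), (0, -1, -1, 0)], ∃ k l, IsIntegralAffine g M k l := by
  refine exists_isIntegralAffine_of_generators (R := squareReflection) ?_ (by decide)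
    (M := ![(1, 0, 0, -1), (0, 1, 1, 0), (-1, 0, 0, 1)]) (k := ![0, 0, 1]) (l := ![0, 0, 0])
    ?_ (by decide) hg
  · rintro i ⟨x, y⟩
    fin_cases i <;>
      simp [squareReflection_zero, squareReflection_one, squareReflection_two]
  · intro i x y
    fin_cases i <;>
      simp [squareReflection_zero, squareReflection_one, squareReflection_two]
    ring

theorem exists_isIntegralAffine_triangular {g : Equiv.Perm (ℝ × ℝ)} (hg : g ∈ triangularGroup) :
    ∃ M ∈ [(1, 0, 0, 1), (-1, 0, 0, -1), (0, -1, 1, 1), (-1, -1, 1, 0), (0, 1, -1, -1),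
      (1, 1, -1, 0), (1, 1, 0, -1), (-1, -1, 0, 1), (0, 1, 1, 0), (0, -1, -1, 0), (1, 0, -1, -1),
      (-1, 0, 1, 1)], ∃ k l, IsIntegralAffine g M k l := by
  refine exists_isIntegralAffine_of_generators (R := triangularReflection) ?_ (by decide)
    (M := ![(1, 1, 0, -1), (0, 1, 1, 0), (-1, -1, 0, 1)]) (k := ![0, 0, 1]) (l := ![0, 0, 0])
    ?_ (by decide) hg
  · rintro i ⟨x, y⟩
    fin_cases i <;>
      simp [triangularReflection_zero, triangularReflection_one, triangularReflection_two]
    ring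
  · intro i x y
    fin_cases i <;>
      simp [triangularReflection_zero, triangularReflection_one, triangularReflection_two]
    ring

theorem exists_translation {W : Subgroup (Equiv.Perm (ℝ × ℝ))} {g h : Equiv.Perm (ℝ × ℝ)}
    (hg : g ∈ W) (hh : h ∈ W) (hg' : ∀ z, g z = z + (1, 0)) (hh' : ∀ z, h z = z + (0, 1))
    (i j : ℤ) : ∃ τ ∈ W, ∀ x y, τ (x, y) = (x + i, y + j) := by
  have key {ρ : Equiv.Perm (ℝ × ℝ)} {v : ℝ × ℝ} (hρ : ∀ z, ρ z = z + v) (i : ℤ) (z : ℝ × ℝ) :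
      (ρ ^ i) z = z + i • v := by
    induction i with
    | zero => simp
    | succ i ih => rw [zpow_add_one, (Commute.zpow_self ρ i).eq, Equiv.Perm.mul_apply, ih, hρ,
        add_smul, one_smul, add_assoc]
    | pred i ih =>
      have h1 : ρ ((ρ ^ (-(i : ℤ) - 1)) z) = (ρ ^ (-(i : ℤ))) z := by
        rw [← Equiv.Perm.mul_apply, ← zpow_one_add]
        congr 2
        ring
      rw [hρ, ih] at h1
      rw [sub_smul, one_smul, eq_sub_of_add_eq h1, add_sub_assoc]
  refine ⟨g ^ i * h ^ j, mul_mem (zpow_mem hg i) (zpow_mem hh j), fun x y ↦ ?_⟩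
  rw [Equiv.Perm.mul_apply, key hg', key hh']
  ext <;> simp

theorem exists_translation_square (i j : ℤ) :
    ∃ τ ∈ squareGroup, ∀ x y, τ (x, y) = (x + i, y + j) := by
  have m := squareReflection_mem
  refine exists_translation (mul_mem (mul_mem (mul_mem (m 2) (m 1)) (m 0)) (m 1))
    (mul_mem (mul_mem (mul_mem (m 1) (m 2)) (m 1)) (m 0)) ?_ ?_ i j <;> rintro ⟨x, y⟩ <;>
  simp [squareReflection_zero, squareReflection_one, squareReflection_two, add_comm]

theorem exists_translation_triangular (i j : ℤ) :
    ∃ τ ∈ triangularGroup, ∀ x y, τ (x, y) = (x + i, y + j) := by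
  have m := triangularReflection_mem
  refine exists_translation
    (mul_mem (mul_mem (mul_mem (mul_mem (mul_mem (m 2) (m 1)) (m 0)) (m 1)) (m 0)) (m 1))
    (mul_mem (mul_mem (mul_mem (mul_mem (mul_mem (m 1) (m 2)) (m 1)) (m 0)) (m 1)) (m 0))
    ?_ ?_ i j <;> rintro ⟨x, y⟩ <;>
  simp [triangularReflection_zero, triangularReflection_one, triangularReflection_two] <;> ring

section Fixed

variable {N : Equiv.Perm (ℝ × ℝ) → Prop}

/-- A property of symmetries of the square tiling that passes to conjugates and to roots holds for
all symmetries with a fixed point, if it holds for representatives of their conjugacy classes. -/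
theorem square_of_fixed
    (hconj : ∀ h ∈ squareGroup, ∀ g g' : Equiv.Perm (ℝ × ℝ), (∀ z, g (h z) = h (g' z)) →
      N g' → N g) (hsq : ∀ g, N (g * g) → N g) (hi : ∀ i, N (squareReflection i))
    (h02 : N (squareReflection 0 * squareReflection 2))
    (h01 : N ((squareReflection 0 * squareReflection 1) ^ 2))
    (h12 : N ((squareReflection 1 * squareReflection 2) ^ 2))
    {g : Equiv.Perm (ℝ × ℝ)} (hg : g ∈ squareGroup) {w : ℝ × ℝ} (hw : g w = w) (hg1 : g ≠ 1) :
    N g := by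
  have m := squareReflection_mem
  -- A half turn has center `(k / 2, l / 2)`, and the parities of `k` and `l` tell whether this is a
  -- vertex, the middle of an edge or the center of a tile.
  have hneg (g : Equiv.Perm (ℝ × ℝ)) (k l : ℤ) (hg : IsIntegralAffine g (-1, 0, 0, -1) k l) :
      N g := by
    obtain ⟨a, ha⟩ := Int.even_or_odd' k
    obtain ⟨b, hb⟩ := Int.even_or_odd' l
    obtain ⟨τ, hτ, hτ'⟩ := exists_translation_square a b
    rcases ha with rfl | rfl <;> rcases hb with rfl | rfl
    · refine hconj τ hτ _ _ ?_ h01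
      rintro ⟨x, y⟩
      simp only [pow_two, Equiv.Perm.mul_apply, squareReflection_zero, squareReflection_one, hτ', hg _ _]
      ext <;> push_cast <;> ring
    · refine hconj (τ * squareReflection 1) (mul_mem hτ (m 1)) _ _ ?_ h02
      rintro ⟨x, y⟩
      simp only [Equiv.Perm.mul_apply, squareReflection_zero, squareReflection_one,
        squareReflection_two, hτ', hg _ _]
      ext <;> push_cast <;> ring
    · refine hconj τ hτ _ _ ?_ h02
      rintro ⟨x, y⟩
      simp only [Equiv.Perm.mul_apply, squareReflection_zero, squareReflection_two, hτ', hg _ _]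
      ext <;> push_cast <;> ring
    · refine hconj τ hτ _ _ ?_ h12
      rintro ⟨x, y⟩
      simp only [pow_two, Equiv.Perm.mul_apply, squareReflection_one, squareReflection_two, hτ', hg _ _]
      ext <;> push_cast <;> ring
  obtain ⟨M, hM, k, l, hgM⟩ := exists_isIntegralAffine_square hg
  obtain ⟨wx, wy⟩ := w
  have hfix := hgM wx wy
  rw [hw, Prod.mk.injEq] at hfix
  obtain ⟨hx, hy⟩ := hfix
  simp only [List.mem_cons, List.not_mem_nil, or_false] at hM
  rcases hM with rfl | rfl | rfl | rfl | rfl | rfl | rfl | rfl <;> push_cast at hx hy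
  · exact absurd (hgM.eq_one hw) hg1
  · exact hneg _ _ _ hgM
  -- The square of a quarter turn is a half turn.
  · exact hsq _ (hneg _ _ _ (hgM.mul hgM))
  · exact hsq _ (hneg _ _ _ (hgM.mul hgM))
  -- For linear parts that are reflections, the fixed point excludes glide reflections; what remains
  -- of the translation part locates the axis, up to conjugation.
  · have hk : k = 0 := by exact_mod_cast (by linarith : (k : ℝ) = 0)
    subst hk
    obtain ⟨t, rfl | rfl⟩ := Int.even_or_odd' l
    · obtain ⟨τ, hτ, hτ'⟩ := exists_translation_square 0 t
      refine hconj τ hτ _ _ ?_ (hi 0)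
      rintro ⟨x, y⟩
      simp only [squareReflection_zero, hτ', hgM _ _]
      ext <;> push_cast <;> ring
    · obtain ⟨τ, hτ, hτ'⟩ := exists_translation_square 0 t
      refine hconj (τ * squareReflection 1) (mul_mem hτ (m 1)) _ _ ?_ (hi 2)
      rintro ⟨x, y⟩
      simp only [Equiv.Perm.mul_apply, squareReflection_one, squareReflection_two, hτ', hgM _ _]
      ext <;> push_cast <;> ring
  · have hl : l = 0 := by exact_mod_cast (by linarith : (l : ℝ) = 0)
    subst hl
    obtain ⟨t, rfl | rfl⟩ := Int.even_or_odd' k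
    · obtain ⟨τ, hτ, hτ'⟩ := exists_translation_square t 0
      refine hconj (τ * squareReflection 1) (mul_mem hτ (m 1)) _ _ ?_ (hi 0)
      rintro ⟨x, y⟩
      simp only [Equiv.Perm.mul_apply, squareReflection_zero, squareReflection_one, hτ', hgM _ _]
      ext <;> push_cast <;> ring
    · obtain ⟨τ, hτ, hτ'⟩ := exists_translation_square t 0
      refine hconj τ hτ _ _ ?_ (hi 2)
      rintro ⟨x, y⟩
      simp only [squareReflection_two, hτ', hgM _ _]
      ext <;> push_cast <;> ring
  · have hl : l = -k := by
      have : (l : ℝ) = -k := by linarith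
      exact_mod_cast this
    subst hl
    obtain ⟨τ, hτ, hτ'⟩ := exists_translation_square k 0
    refine hconj τ hτ _ _ ?_ (hi 1)
    rintro ⟨x, y⟩
    simp only [squareReflection_one, hτ', hgM _ _]
    ext <;> push_cast <;> ring
  · have hl : l = k := by exact_mod_cast (by linarith : (l : ℝ) = k)
    subst hl
    obtain ⟨τ, hτ, hτ'⟩ := exists_translation_square l 0
    refine hconj (τ * squareReflection 0) (mul_mem hτ (m 0)) _ _ ?_ (hi 1)
    rintro ⟨x, y⟩
    simp only [Equiv.Perm.mul_apply, squareReflection_zero, squareReflection_one, hτ', hgM _ _]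
    ext <;> push_cast <;> ring

/-- A property of symmetries of the triangular tiling that passes to conjugates and to roots holds
for all symmetries with a fixed point, if it holds for representatives of their conjugacy classes. -/
theorem triangular_of_fixed
    (hconj : ∀ h ∈ triangularGroup, ∀ g g' : Equiv.Perm (ℝ × ℝ), (∀ z, g (h z) = h (g' z)) →
      N g' → N g) (hsq : ∀ g, N (g * g) → N g) (hcube : ∀ g, N (g * (g * g)) → N g)
    (hi : ∀ i, N (triangularReflection i))
    (h02 : N (triangularReflection 0 * triangularReflection 2))
    (h01 : N ((triangularReflection 0 * triangularReflection 1) ^ 2))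
    (h01' : N ((triangularReflection 0 * triangularReflection 1) ^ 3))
    (h12 : N (triangularReflection 1 * triangularReflection 2))
    {g : Equiv.Perm (ℝ × ℝ)} (hg : g ∈ triangularGroup) {w : ℝ × ℝ} (hw : g w = w) (hg1 : g ≠ 1) :
    N g := by
  have m := triangularReflection_mem
  -- The center `(k / 2, l / 2)` is a lattice point or the middle of a shortest lattice vector; the
  -- middles in the three directions are conjugate by rotations.
  have hneg (g : Equiv.Perm (ℝ × ℝ)) (k l : ℤ) (hg : IsIntegralAffine g (-1, 0, 0, -1) k l) :
      N g := by
    obtain ⟨a, ha⟩ := Int.even_or_odd' k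
    obtain ⟨b, hb⟩ := Int.even_or_odd' l
    rcases ha with rfl | rfl <;> rcases hb with rfl | rfl
    · obtain ⟨τ, hτ, hτ'⟩ := exists_translation_triangular a b
      refine hconj τ hτ _ _ ?_ h01'
      rintro ⟨x, y⟩
      simp only [pow_succ, pow_zero, one_mul, Equiv.Perm.mul_apply, triangularReflection_zero,
        triangularReflection_one, hτ', hg _ _]
      ext <;> push_cast <;> ring
    · obtain ⟨τ, hτ, hτ'⟩ := exists_translation_triangular a b
      refine hconj (τ * triangularReflection 1) (mul_mem hτ (m 1)) _ _ ?_ h02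
      rintro ⟨x, y⟩
      simp only [Equiv.Perm.mul_apply, triangularReflection_zero, triangularReflection_one,
        triangularReflection_two, hτ', hg _ _]
      ext <;> push_cast <;> ring
    · obtain ⟨τ, hτ, hτ'⟩ := exists_translation_triangular a b
      refine hconj τ hτ _ _ ?_ h02
      rintro ⟨x, y⟩
      simp only [Equiv.Perm.mul_apply, triangularReflection_zero, triangularReflection_two, hτ',
        hg _ _]
      ext <;> push_cast <;> ring
    · obtain ⟨τ, hτ, hτ'⟩ := exists_translation_triangular a (b + 1)
      refine hconj (τ * triangularReflection 0 * triangularReflection 1)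
        (mul_mem (mul_mem hτ (m 0)) (m 1)) _ _ ?_ h02
      rintro ⟨x, y⟩
      simp only [Equiv.Perm.mul_apply, triangularReflection_zero, triangularReflection_one,
        triangularReflection_two, hτ', hg _ _]
      ext <;> push_cast <;> ring
  -- For a rotation of order three, `l - k` modulo `3` tells whether the center is a lattice point
  -- or the center of a triangle of one of the two orientations. A half turn exchanges these
  -- orientations.
  have hrot (g : Equiv.Perm (ℝ × ℝ)) (k l : ℤ) (hg : IsIntegralAffine g (0, 1, -1, -1) k l) :
      N g := by
    have hmod : (∃ t, l = k + 3 * t) ∨ (∃ t, l = k - 1 + 3 * t) ∨ ∃ t, l = k + 1 + 3 * t := by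
      have : (l - k) % 3 = 0 ∨ (l - k) % 3 = 1 ∨ (l - k) % 3 = 2 := by omega
      rcases this with h | h | h
      · exact Or.inl ⟨(l - k) / 3, by omega⟩
      · exact Or.inr (Or.inr ⟨(l - k) / 3, by omega⟩)
      · exact Or.inr (Or.inl ⟨(l - k) / 3 + 1, by omega⟩)
    rcases hmod with ⟨t, rfl⟩ | ⟨t, rfl⟩ | ⟨t, rfl⟩
    · obtain ⟨τ, hτ, hτ'⟩ := exists_translation_triangular (k + t) t
      refine hconj τ hτ _ _ ?_ h01
      rintro ⟨x, y⟩
      simp only [pow_succ, pow_zero, one_mul, Equiv.Perm.mul_apply, triangularReflection_zero,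
        triangularReflection_one, hτ', hg _ _]
      ext <;> push_cast <;> ring
    · obtain ⟨τ, hτ, hτ'⟩ := exists_translation_triangular (k + t) t
      refine hconj (τ * (triangularReflection 0 * triangularReflection 1) ^ 3)
        (mul_mem hτ (pow_mem (mul_mem (m 0) (m 1)) 3)) _ _ ?_ h12
      rintro ⟨x, y⟩
      simp only [pow_succ, pow_zero, one_mul, Equiv.Perm.mul_apply, triangularReflection_zero,
        triangularReflection_one, triangularReflection_two, hτ', hg _ _]
      ext <;> push_cast <;> ring
    · obtain ⟨τ, hτ, hτ'⟩ := exists_translation_triangular (k + t) t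
      refine hconj τ hτ _ _ ?_ h12
      rintro ⟨x, y⟩
      simp only [Equiv.Perm.mul_apply, triangularReflection_one, triangularReflection_two, hτ',
        hg _ _]
      ext <;> push_cast <;> ring
  obtain ⟨M, hM, k, l, hgM⟩ := exists_isIntegralAffine_triangular hg
  obtain ⟨wx, wy⟩ := w
  have hfix := hgM wx wy
  rw [hw, Prod.mk.injEq] at hfix
  obtain ⟨hx, hy⟩ := hfix
  simp only [List.mem_cons, List.not_mem_nil, or_false] at hM
  rcases hM with rfl | rfl | rfl | rfl | rfl | rfl | rfl | rfl | rfl | rfl | rfl | rfl <;>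
    push_cast at hx hy
  · exact absurd (hgM.eq_one hw) hg1
  · exact hneg _ _ _ hgM
  -- The cube of a rotation of order six is a half turn; the other rotation of order three is
  -- reduced by squaring.
  · exact hcube _ (hneg _ _ _ (hgM.mul (hgM.mul hgM)))
  · exact hsq _ (hrot _ _ _ (hgM.mul hgM))
  · exact hrot _ _ _ hgM
  · exact hcube _ (hneg _ _ _ (hgM.mul (hgM.mul hgM)))
  · have hl : l = -2 * k := by
      have : (l : ℝ) = -2 * k := by linarith
      exact_mod_cast this
    subst hl
    obtain ⟨τ, hτ, hτ'⟩ := exists_translation_triangular 0 (-k)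
    refine hconj τ hτ _ _ ?_ (hi 0)
    rintro ⟨x, y⟩
    simp only [triangularReflection_zero, hτ', hgM _ _]
    ext <;> push_cast <;> ring
  · have hl : l = 0 := by exact_mod_cast (by linarith : (l : ℝ) = 0)
    subst hl
    obtain ⟨τ, hτ, hτ'⟩ := exists_translation_triangular 0 (k - 1)
    refine hconj τ hτ _ _ ?_ (hi 2)
    rintro ⟨x, y⟩
    simp only [triangularReflection_two, hτ', hgM _ _]
    ext <;> push_cast <;> ring
  · have hl : l = -k := by
      have : (l : ℝ) = -k := by linarith
      exact_mod_cast this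
    subst hl
    obtain ⟨τ, hτ, hτ'⟩ := exists_translation_triangular k 0
    refine hconj τ hτ _ _ ?_ (hi 1)
    rintro ⟨x, y⟩
    simp only [triangularReflection_one, hτ', hgM _ _]
    ext <;> push_cast <;> ring
  · have hl : l = k := by exact_mod_cast (by linarith : (l : ℝ) = k)
    subst hl
    obtain ⟨τ, hτ, hτ'⟩ := exists_translation_triangular l 0
    refine hconj (τ * triangularReflection 0 * triangularReflection 1)
      (mul_mem (mul_mem hτ (m 0)) (m 1)) _ _ ?_ (hi 0)
    rintro ⟨x, y⟩
    simp only [Equiv.Perm.mul_apply, triangularReflection_zero, triangularReflection_one, hτ',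
      hgM _ _]
    ext <;> push_cast <;> ring
  · have hk : k = 0 := by exact_mod_cast (by linarith : (k : ℝ) = 0)
    subst hk
    obtain ⟨τ, hτ, hτ'⟩ := exists_translation_triangular l 0
    refine hconj (τ * triangularReflection 0) (mul_mem hτ (m 0)) _ _ ?_ (hi 1)
    rintro ⟨x, y⟩
    simp only [Equiv.Perm.mul_apply, triangularReflection_zero, triangularReflection_one, hτ',
      hgM _ _]
    ext <;> push_cast <;> ring
  · have hk : k = -2 * l := by
      have : (k : ℝ) = -2 * l := by linarith
      exact_mod_cast this
    subst hk
    obtain ⟨τ, hτ, hτ'⟩ := exists_translation_triangular (-l) 0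
    refine hconj (τ * triangularReflection 1) (mul_mem hτ (m 1)) _ _ ?_ (hi 0)
    rintro ⟨x, y⟩
    simp only [Equiv.Perm.mul_apply, triangularReflection_zero, triangularReflection_one, hτ',
      hgM _ _]
    ext <;> push_cast <;> ring

end Fixed

end TorusMap

namespace TorusMap

/-! ### Quotients of a tiling by its symmetries -/

open Gluing

/-- The tiling that `T` describes has the vertices `V` and the graph `E`, in the plane with the
coordinates that belong to `u` and `v`; all translations by integral vectors are symmetries, and all
translations that preserve `V` are of this kind. -/
structure TilingModel.Describes {n : ℕ} [NeZero n] (T : TilingModel n) (u v : ℂ) (V E : Set ℂ) :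
    Prop where
  linearIndependent : LinearIndependent ℝ ![u, v]
  exists_isIntegralAffine : ∃ S : Finset (ℤ × ℤ × ℤ × ℤ), ∀ g ∈ T.group, ∃ M ∈ S, ∃ k l,
    IsIntegralAffine g M k l
  exists_translation : ∀ i j : ℤ, ∃ τ ∈ T.group, ∀ x y : ℝ, τ (x, y) = (x + i, y + j)
  exists_mem : ∀ z, ∃ g ∈ T.group, T.place (g z) ∈ Polygon n
  mem_vertices : ∀ x y : ℝ, (∃ g ∈ T.group, T.place (g (x, y)) = side n 0 0) ↔ x * u + y * v ∈ V
  mem_skeleton : ∀ x y : ℝ, (∃ g ∈ T.group, ∃ t, T.place (g (x, y)) = side n 0 t) ↔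
    x * u + y * v ∈ E
  exists_of_stable : ∀ w, (∀ z, z + w ∈ V ↔ z ∈ V) → ∃ i j : ℤ, w = i * u + j * v

theorem translation_pow {τ : Equiv.Perm (ℝ × ℝ)} {i j : ℤ}
    (hτ : ∀ x y : ℝ, τ (x, y) = (x + i, y + j)) (k : ℕ) (x y : ℝ) :
    (τ ^ k) (x, y) = (x + k * i, y + k * j) := by
  induction k generalizing x y with
  | zero => simp
  | succ k ih =>
    rw [pow_succ, Equiv.Perm.mul_apply, hτ, ih]
    ext <;> push_cast <;> ring

variable {n : ℕ} [NeZero n] {T : TilingModel n} {u v : ℂ} {V E : Set ℂ}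

namespace IsDevelopment

variable {G : Gluing n} {q : G.Flag → ℝ × ℝ → G.Space}

/-- There are finitely many flags, so the permutation that belongs to `τ` has finite order, and the
corresponding power of `τ` does not change `q s`. -/
theorem exists_period (hq : IsDevelopment T q) (s : G.Flag) {τ : Equiv.Perm (ℝ × ℝ)}
    (hτ : τ ∈ T.group) : ∃ N : ℕ, N ≠ 0 ∧ τ ^ N ∈ T.deckGroup (q s) := by
  obtain ⟨p, hp⟩ := hq.exists_perm hτ
  have := finite_flag (G := G)
  have hpow (k : ℕ) (z : ℝ × ℝ) : q ((p ^ k) s) z = q s ((τ ^ k) z) := by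
    induction k generalizing z with
    | zero => rfl
    | succ k ih => rw [pow_succ', Equiv.Perm.mul_apply, hp, ih, pow_succ, Equiv.Perm.mul_apply]
  refine ⟨orderOf p, (orderOf_pos p).ne', pow_mem hτ _, fun z ↦ ?_⟩
  rw [← hpow, pow_orderOf_eq_one, Equiv.Perm.one_apply]

/-- If only translations are compatible with a development, then it presents the surface as the
quotient of the plane by a lattice. -/
theorem exists_lattice [PreconnectedSpace G.Space] (hT : T.Describes u v V E)
    (hq : IsDevelopment T q) (s : G.Flag)
    (hdeck : ∀ g ∈ T.deckGroup (q s), ∃ k l, IsIntegralAffine g (1, 0, 0, 1) k l) :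
    ∃ (f : ℂ → G.Space) (a b : ℂ), Topology.IsQuotientMap f ∧ LinearIndependent ℝ ![a, b] ∧
      (∀ z w, f z = f w ↔ w - z ∈ AddSubgroup.closure {a, b}) ∧
      (∀ z, z ∈ AddSubgroup.closure {a, b} ↔
        ∃ i j : ℤ, z = i * u + j * v ∧ ∀ x y : ℝ, q s (x + i, y + j) = q s (x, y)) ∧
      (∀ z, (∃ f' k, Quot.mk _ ⟨f', side n k 0⟩ = f z) ↔ z ∈ V) ∧
      ∀ z, (∃ f' k t, Quot.mk _ ⟨f', side n k t⟩ = f z) ↔ z ∈ E := by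
  obtain ⟨e, he⟩ := exists_coordinates hT.linearIndependent
  have he' (z : ℂ) : z = (e z).1 * u + (e z).2 * v := by
    simpa using (e.symm_apply_apply z).symm.trans (he (e z).1 (e z).2)
  let Λ : AddSubgroup ℂ :=
    { carrier := {z | ∃ i j : ℤ, z = i * u + j * v ∧ ∀ x y : ℝ, q s (x + i, y + j) = q s (x, y)}
      zero_mem' := ⟨0, 0, by simp⟩
      add_mem' := by
        rintro _ _ ⟨i, j, rfl, h⟩ ⟨i', j', rfl, h'⟩
        refine ⟨i + i', j + j', by push_cast; ring, fun x y ↦ ?_⟩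
        rw [← h x y, ← h' (x + i) (y + j)]
        push_cast
        simp only [add_assoc]
      neg_mem' := by
        rintro _ ⟨i, j, rfl, h⟩
        refine ⟨-i, -j, by push_cast; ring, fun x y ↦ ?_⟩
        rw [← h (x + (-i : ℤ))]
        push_cast
        simp }
  have hle : Λ ≤ AddSubgroup.closure {u, v} := by
    rintro _ ⟨i, j, rfl, -⟩
    rw [AddSubgroup.mem_closure_pair]
    exact ⟨i, j, by simp⟩
  -- Some multiple of every integral vector is a period, so the group of periods is of full rank.
  have hperiod (i j : ℤ) : ∃ N : ℕ, N ≠ 0 ∧ (N * i * u + N * j * v : ℂ) ∈ Λ := by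
    obtain ⟨τ, hτ, hτ'⟩ := hT.exists_translation i j
    obtain ⟨N, hN, -, hN'⟩ := hq.exists_period s hτ
    refine ⟨N, hN, N * i, N * j, by push_cast; ring, fun x y ↦ ?_⟩
    have hpow := translation_pow hτ'
    rw [← hN' (x, y), hpow]
    push_cast
    rfl
  obtain ⟨N, hN, hN'⟩ := hperiod 1 0
  obtain ⟨N', hN0, hN0'⟩ := hperiod 0 1
  obtain ⟨a, b, hab, hΛ⟩ := exists_basis_of_le_lattice hT.linearIndependent hle
    (M := N) (N := N') (by exact_mod_cast hN) (by exact_mod_cast hN0)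
    (by simpa using hN') (by simpa using hN0')
  refine ⟨q s ∘ e, a, b, (hq.isQuotientMap s).comp e.toHomeomorph.isQuotientMap, hab, ?_, ?_, ?_, ?_⟩
  · intro z w
    rw [← hΛ]
    change q s (e z) = q s (e w) ↔ _
    constructor
    · intro h
      obtain ⟨g, hg, hgw⟩ := hq.eq_iff_exists_deck.1 h.symm
      obtain ⟨k, l, hkl⟩ := hdeck g hg
      refine ⟨k, l, ?_, fun x y ↦ ?_⟩
      · have := hkl (e z).1 (e z).2
        rw [Prod.mk.eta, hgw] at this
        rw [he' w, he' z, this]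
        push_cast; ring
      · have := hg.2 (x, y)
        rw [hkl] at this
        simpa using this
    · rintro ⟨i, j, hij, h⟩
      have hw : w = z + (i * u + j * v) := by rw [← hij]; ring
      have h2 : e (i * u + j * v) = ((i : ℝ), (j : ℝ)) := by
        rw [← ContinuousLinearEquiv.eq_symm_apply, he]
        simp
      rw [hw, map_add, h2]
      exact (h (e z).1 (e z).2).symm
  · intro z
    rw [← hΛ]
    rfl
  · intro z
    have h1 := hq.exists_side_iff s (e z) {0} (by simp)
    simp only [Set.mem_singleton_iff, exists_eq_left] at h1
    refine h1.trans ?_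
    conv_rhs => rw [he' z]
    exact hT.mem_vertices _ _
  · intro z
    have h1 := hq.exists_side_iff s (e z) Set.univ (by simp)
    simp only [Set.mem_univ, true_and] at h1
    refine h1.trans ?_
    conv_rhs => rw [he' z]
    exact hT.mem_skeleton _ _

/-- On the torus, the symmetries that are compatible with a development are translations if they
have no fixed points. -/
theorem isIntegralAffine_one_of_free (hT : T.Describes u v V E) (hq : IsDevelopment T q)
    (h : G.Space ≃ₜ Torus) (s : G.Flag)
    (hfree : ∀ g ∈ T.deckGroup (q s), ∀ w, g w = w → g = 1) {g : Equiv.Perm (ℝ × ℝ)}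
    (hg : g ∈ T.deckGroup (q s)) : ∃ k l, IsIntegralAffine g (1, 0, 0, 1) k l := by
  have : PreconnectedSpace G.Space := ⟨h.symm.range_coe ▸ isPreconnected_range h.symm.continuous⟩
  obtain ⟨S, hS⟩ := hT.exists_isIntegralAffine
  let D := T.deckGroup (q s)
  have hcont : ContinuousConstSMul D (ℝ × ℝ) := ⟨fun g ↦ T.continuous_of_mem g.2.1⟩
  have hcancel : IsCancelSMul D (ℝ × ℝ) := isCancelSMul_iff_eq_one_of_smul_eq.2
    fun g w hw ↦ Subtype.ext (hfree g g.2 w hw)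
  -- There are finitely many linear parts, with entries bounded by `B`. If an element takes a point
  -- of a bounded set to a point of a bounded set, its integral translation part is bounded as well,
  -- which leaves finitely many elements.
  have hdisc : ProperlyDiscontinuousSMul D (ℝ × ℝ) := by
    refine ⟨fun {K L} hK hL ↦ ?_⟩
    obtain ⟨C, hC⟩ := (hK.union hL).isBounded.exists_norm_le
    obtain ⟨C', hC'⟩ := exists_nat_ge C
    choose M hM k l hkl using fun g : D ↦ hS g g.2.1
    obtain ⟨B, hB⟩ : ∃ B : ℕ, ∀ M ∈ S, |M.1| ≤ B ∧ |M.2.1| ≤ B ∧ |M.2.2.1| ≤ B ∧ |M.2.2.2| ≤ B := by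
      refine ⟨S.sup fun M ↦ M.1.natAbs + M.2.1.natAbs + M.2.2.1.natAbs + M.2.2.2.natAbs,
        fun M hM ↦ ?_⟩
      have := Finset.le_sup (f := fun M : ℤ × ℤ × ℤ × ℤ ↦
        M.1.natAbs + M.2.1.natAbs + M.2.2.1.natAbs + M.2.2.2.natAbs) hM
      simp only [Int.abs_eq_natAbs]
      omega
    let R : ℤ := C' + 2 * B * C'
    refine Set.Finite.of_injOn (f := fun g ↦ (M g, k g, l g))
      (t := (S : Set (ℤ × ℤ × ℤ × ℤ)) ×ˢ (Set.Icc (-R) R ×ˢ Set.Icc (-R) R)) ?_ ?_ ?_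
    · rintro g ⟨_, ⟨⟨x, y⟩, hz, rfl⟩, hgz⟩
      have h1 := hC _ (Or.inl hz)
      have h2 := hC _ (Or.inr hgz)
      change ‖(g : Equiv.Perm (ℝ × ℝ)) (x, y)‖ ≤ C at h2
      rw [hkl, Prod.norm_mk, sup_le_iff] at h2
      rw [Prod.norm_mk, sup_le_iff] at h1
      obtain ⟨b1, b2, b3, b4⟩ := hB _ (hM g)
      have key (p r t : ℤ) (hp : |p| ≤ B) (hr : |r| ≤ B) (h : ‖(p * x + r * y + t : ℝ)‖ ≤ C) :
          t ∈ Set.Icc (-R) R := by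
        rw [Set.mem_Icc, ← abs_le]
        have hp' : |(p : ℝ)| ≤ B := by exact_mod_cast hp
        have hr' : |(r : ℝ)| ≤ B := by exact_mod_cast hr
        have hC0 : 0 ≤ (C' : ℝ) := Nat.cast_nonneg _
        have e1 : |p * x| ≤ B * C' := by
          rw [abs_mul]
          exact mul_le_mul hp' (h1.1.trans hC') (abs_nonneg _) (Nat.cast_nonneg _)
        have e2 : |r * y| ≤ B * C' := by
          rw [abs_mul]
          exact mul_le_mul hr' (h1.2.trans hC') (abs_nonneg _) (Nat.cast_nonneg _)
        have e3 : |(t : ℝ)| ≤ C' + 2 * B * C' := by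
          rw [Real.norm_eq_abs] at h
          rw [abs_le] at h e1 e2 ⊢
          constructor <;> linarith
        exact_mod_cast e3
      exact ⟨hM g, key _ _ _ b1 b2 h2.1, key _ _ _ b3 b4 h2.2⟩
    · intro g _ g' _ hgg'
      simp only [Prod.mk.injEq] at hgg'
      obtain ⟨e1, e2, e3⟩ := hgg'
      apply Subtype.ext
      ext1 ⟨x, y⟩
      rw [hkl, hkl, e1, e2, e3]
    · exact S.finite_toSet.prod ((Set.finite_Icc _ _).prod (Set.finite_Icc _ _))
  have hcov : IsQuotientCoveringMap (q s) D :=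
    (hq.isQuotientMap s).isQuotientCoveringMap_of_properlyDiscontinuousSMul
      fun {z w} ↦ by
        rw [hq.eq_iff_exists_deck]
        constructor
        · rintro ⟨g, hg, h⟩
          exact ⟨⟨g, hg⟩, h⟩
        · rintro ⟨⟨g, hg⟩, h⟩
          exact ⟨g, hg, h⟩
  have : SimplyConnectedSpace (ℝ × ℝ) := SimplyConnectedSpace.ofContractible _
  -- Here the surface has to be a torus: the free action presents it as a quotient of the simply
  -- connected plane, so the deck group is commutative.
  have hcomm := mul_comm_of_isQuotientCoveringMap_torus (hcov.homeomorph_comp h)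
  obtain ⟨M, hM, k, l, hgM⟩ := hS g hg.1
  -- Some translation by `N • (i, j)` with `N ≠ 0` is in the deck group. Commuting with it means
  -- that the linear part of `g` fixes `(i, j)`.
  have hfixed (i j : ℤ) : (M.1 * i + M.2.1 * j : ℤ) = i ∧ (M.2.2.1 * i + M.2.2.2 * j : ℤ) = j := by
    obtain ⟨τ, hτ, hτ'⟩ := hT.exists_translation i j
    obtain ⟨N, hN, hN'⟩ := hq.exists_period s hτ
    have hpow := translation_pow hτ'
    have h1 := congrArg (fun g : D ↦ (g : Equiv.Perm (ℝ × ℝ)) (0, 0)) (hcomm ⟨g, hg⟩ ⟨_, hN'⟩)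
    simp only [Subgroup.coe_mul, Equiv.Perm.mul_apply] at h1
    rw [hpow, hgM, hgM, hpow] at h1
    have hN1 : (N : ℝ) ≠ 0 := by exact_mod_cast hN
    simp only [Prod.mk.injEq] at h1
    obtain ⟨e1, e2⟩ := h1
    constructor
    · have : (M.1 * i + M.2.1 * j : ℝ) = i := mul_left_cancel₀ hN1 (by linear_combination e1)
      exact_mod_cast this
    · have : (M.2.2.1 * i + M.2.2.2 * j : ℝ) = j := mul_left_cancel₀ hN1 (by linear_combination e2)
      exact_mod_cast this
  have h10 := hfixed 1 0
  have h01 := hfixed 0 1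
  simp only [mul_one, mul_zero, add_zero, zero_add] at h10 h01
  refine ⟨k, l, ?_⟩
  obtain ⟨p, r, t, w⟩ := M
  obtain ⟨rfl, rfl⟩ := h10
  obtain ⟨rfl, rfl⟩ := h01
  exact hgM

end IsDevelopment

end TorusMap

namespace TorusMap

/-! ### Vertices and edges of the regular tilings -/

/-- Side `0` runs from `(a, b)` to `(a', b')`. Its images have vertices as ends and length one by
`hnorm`; conversely, by `htrans`, every ordered pair of vertices at distance one can be moved to the
ends of side `0`. So the images of the side make up the unit graph. -/
theorem TilingModel.mem_unitGraph_iff {n : ℕ} [NeZero n] {T : TilingModel n} {u v : ℂ} {V : Set ℂ}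
    (huv : LinearIndependent ℝ ![u, v])
    (haff : ∀ g ∈ T.group, ∃ M k l, IsIntegralAffine g M k l) {a b a' b' : ℝ}
    (hside : ∀ t : I, T.place ((1 - t) * a + t * a', (1 - t) * b + t * b') = side n 0 t)
    (hV : ∀ x y : ℝ, (∃ g ∈ T.group, g (x, y) = (a, b)) ↔ x * u + y * v ∈ V)
    (hV' : ∃ g ∈ T.group, g (a', b') = (a, b))
    (hnorm : ∀ g ∈ T.group, ∀ M k l, IsIntegralAffine g M k l →
      ‖((M.1 * (a - a') + M.2.1 * (b - b') : ℝ) * u +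
        (M.2.2.1 * (a - a') + M.2.2.2 * (b - b') : ℝ) * v : ℂ)‖ = 1)
    (htrans : ∀ x y x' y' : ℝ, (x * u + y * v : ℂ) ∈ V → (x' * u + y' * v : ℂ) ∈ V →
      ‖((x' - x : ℝ) * u + (y' - y : ℝ) * v : ℂ)‖ = 1 →
        ∃ g ∈ T.group, g (x, y) = (a, b) ∧ g (x', y') = (a', b')) (x y : ℝ) :
    (∃ g ∈ T.group, ∃ t, T.place (g (x, y)) = side n 0 t) ↔ x * u + y * v ∈ unitGraph V := by
  obtain ⟨e, he⟩ := exists_coordinates huv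
  simp only [Complex.real_smul] at he
  constructor
  · rintro ⟨g, hg, t, h⟩
    rw [← hside, T.place.injective.eq_iff] at h
    have hg' := inv_mem hg
    obtain ⟨M, k, l, hM⟩ := haff _ hg'
    have hz : (x, y) = g⁻¹ ((1 - t) * a + t * a', (1 - t) * b + t * b') := by
      rw [← h]; simp
    rw [hM, Prod.mk.injEq] at hz
    have h0 := (hV (M.1 * a + M.2.1 * b + k) (M.2.2.1 * a + M.2.2.2 * b + l)).1
      ⟨g, hg, by rw [← hM]; simp⟩
    obtain ⟨j, hj, hj'⟩ := hV'
    have h1 := (hV (M.1 * a' + M.2.1 * b' + k) (M.2.2.1 * a' + M.2.2.2 * b' + l)).1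
      ⟨j * g, mul_mem hj hg, by rw [← hM]; simpa using hj'⟩
    refine ⟨_, h0, _, h1, ?_, 1 - t, t, sub_nonneg.2 t.2.2, t.2.1, by ring, ?_⟩
    · rw [dist_eq_norm, ← hnorm _ hg' M k l hM]
      congr 1
      push_cast; ring
    · rw [hz.1, hz.2]
      simp only [Complex.real_smul]
      push_cast; ring
  · rintro ⟨P, hP, Q, hQ, hPQ, s, t, hs, ht, hst, h⟩
    obtain ⟨p, hp⟩ : ∃ p : ℝ × ℝ, e.symm p = P := e.symm.surjective P
    obtain ⟨r, hr⟩ : ∃ r : ℝ × ℝ, e.symm r = Q := e.symm.surjective Q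
    have hxy : e.symm (x, y) = e.symm (s • p + t • r) := by
      rw [map_add, map_smul, map_smul, hp, hr, h, he]
    replace hxy := e.symm.injective hxy
    obtain ⟨p1, p2⟩ := p
    obtain ⟨r1, r2⟩ := r
    rw [he] at hp hr
    obtain ⟨g, hg, hg1, hg2⟩ := htrans p1 p2 r1 r2 (hp ▸ hP) (hr ▸ hQ) (by
      rw [← hPQ, dist_comm, dist_eq_norm, ← hp, ← hr]
      congr 1
      push_cast; ring)
    obtain ⟨M, k, l, hM⟩ := haff _ hg
    refine ⟨g, hg, ⟨t, ht, by linarith⟩, ?_⟩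
    rw [← hside]
    congr 1
    rw [hM, Prod.mk.injEq] at hg1 hg2
    obtain rfl : s = 1 - t := by linarith
    simp only [Prod.smul_mk, Prod.mk_add_mk, smul_eq_mul, Prod.mk.injEq] at hxy
    rw [hM, hxy.1, hxy.2, ← hg1.1, ← hg1.2, ← hg2.1, ← hg2.2]
    ext <;> simp only <;> ring

theorem norm_add_mul_zeta (x y : ℝ) : ‖(x + y * zeta : ℂ)‖ = 1 ↔ x ^ 2 + x * y + y ^ 2 = 1 := by
  have h3 : √3 * √3 = 3 := Real.mul_self_sqrt (by norm_num)
  have : ‖(x + y * zeta : ℂ)‖ ^ 2 = x ^ 2 + x * y + y ^ 2 := by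
    rw [Complex.sq_norm, Complex.normSq_apply]
    simp [zeta_re, zeta_im]
    linear_combination (y ^ 2 / 4) * h3
  rw [← this, pow_eq_one_iff_of_nonneg (norm_nonneg _) two_ne_zero]

theorem norm_add_mul_I (x y : ℝ) : ‖(x + y * Complex.I : ℂ)‖ = 1 ↔ x ^ 2 + y ^ 2 = 1 := by
  have : ‖(x + y * Complex.I : ℂ)‖ ^ 2 = x ^ 2 + y ^ 2 := by
    rw [Complex.sq_norm, Complex.normSq_add_mul_I]
  rw [← this, pow_eq_one_iff_of_nonneg (norm_nonneg _) two_ne_zero]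

theorem linearIndependent_one_zeta : LinearIndependent ℝ ![1, zeta] :=
  linearIndependent_pair_of_det (by simp [zeta_im])

theorem linearIndependent_one_I : LinearIndependent ℝ ![1, Complex.I] :=
  linearIndependent_pair_of_det (by simp)

theorem eq_of_add_mul_eq {u v : ℂ} (h : LinearIndependent ℝ ![u, v]) {x y x' y' : ℝ}
    (e : (x * u + y * v : ℂ) = x' * u + y' * v) : x = x' ∧ y = y' := by
  have h1 : ((x - x' : ℝ) • u + (y - y' : ℝ) • v : ℂ) = 0 := by
    simp only [Complex.real_smul]
    push_cast
    linear_combination e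
  obtain ⟨h2, h3⟩ := LinearIndependent.pair_iff.1 h _ _ h1
  exact ⟨sub_eq_zero.1 h2, sub_eq_zero.1 h3⟩

theorem mem_triangularVertices {x y : ℝ} : (x * 1 + y * zeta : ℂ) ∈ triangularVertices ↔
    ∃ i j : ℤ, x = i ∧ y = j := by
  refine exists_congr fun i ↦ exists_congr fun j ↦ ⟨fun h ↦ ?_, ?_⟩
  · exact eq_of_add_mul_eq linearIndependent_one_zeta (by push_cast; rw [h]; ring)
  · rintro ⟨rfl, rfl⟩
    push_cast; ring

theorem mem_squareVertices {x y : ℝ} : (x * 1 + y * Complex.I : ℂ) ∈ squareVertices ↔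
    ∃ i j : ℤ, x = i ∧ y = j := by
  refine exists_congr fun i ↦ exists_congr fun j ↦ ⟨fun h ↦ ?_, ?_⟩
  · exact eq_of_add_mul_eq linearIndependent_one_I (by push_cast; rw [h]; ring)
  · rintro ⟨rfl, rfl⟩
    push_cast; ring

theorem exists_mem_origin {W : Subgroup (Equiv.Perm (ℝ × ℝ))}
    (haff : ∀ g ∈ W, ∃ M k l, IsIntegralAffine g M k l)
    (htr : ∀ i j : ℤ, ∃ τ ∈ W, ∀ x y : ℝ, τ (x, y) = (x + i, y + j)) (x y : ℝ) :
    (∃ g ∈ W, g (x, y) = (0, 0)) ↔ ∃ i j : ℤ, x = i ∧ y = j := by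
  constructor
  · rintro ⟨g, hg, h⟩
    obtain ⟨M, k, l, hM⟩ := haff _ (inv_mem hg)
    have h1 : g⁻¹ (0, 0) = (x, y) := by rw [← h]; simp
    rw [hM, Prod.mk.injEq] at h1
    exact ⟨k, l, by simpa using h1.1.symm, by simpa using h1.2.symm⟩
  · rintro ⟨i, j, rfl, rfl⟩
    obtain ⟨τ, hτ, h⟩ := htr (-i) (-j)
    exact ⟨τ, hτ, by rw [h]; simp⟩

theorem squareModel_describes :
    squareModel.Describes 1 Complex.I squareVertices (unitGraph squareVertices) := by
  have haff (g) (hg : g ∈ squareModel.group) : ∃ M k l, IsIntegralAffine g M k l := by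
    rw [squareModel_group] at hg
    obtain ⟨M, -, k, l, h⟩ := exists_isIntegralAffine_square hg
    exact ⟨M, k, l, h⟩
  have htr (i j : ℤ) : ∃ τ ∈ squareModel.group, ∀ x y : ℝ, τ (x, y) = (x + i, y + j) := by
    rw [squareModel_group]
    exact exists_translation_square i j
  have hV (x y : ℝ) := (exists_mem_origin haff htr x y).trans mem_squareVertices.symm
  have hplace : squareModel.place (0, 0) = side 4 0 0 := squareModel_place_side (by simp)
  refine ⟨linearIndependent_one_I, ⟨List.toFinset
      [(1, 0, 0, 1), (-1, 0, 0, -1), (0, -1, 1, 0), (0, 1, -1, 0),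
      (1, 0, 0, -1), (-1, 0, 0, 1), (0, 1, 1, 0), (0, -1, -1, 0)],
      fun g hg ↦ ?_⟩, htr, ?_, ?_, ?_, ?_⟩
  · rw [squareModel_group] at hg
    simpa only [List.mem_toFinset] using exists_isIntegralAffine_square hg
  · rintro ⟨x, y⟩
    obtain ⟨i, j, h⟩ := exists_sub_mem_square (x, y)
    obtain ⟨τ, hτ, h'⟩ := htr (-i) (-j)
    refine ⟨τ, hτ, squareModel_mem_polygon.2 ?_⟩
    rw [h']
    simpa [← sub_eq_add_neg] using h
  · intro x y
    rw [← hV, ← hplace]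
    simp only [squareModel.place.injective.eq_iff]
  · refine TilingModel.mem_unitGraph_iff (a := 0) (b := 0) (a' := 1) (b' := 0)
      linearIndependent_one_I haff ?_ hV ?_ ?_ ?_
    · intro t
      rw [← squareModel_place_side t.2]
      simp
    · rw [squareModel_group]
      exact ⟨_, squareReflection_mem 2, by simp [squareReflection_two]⟩
    · intro g hg M k l hM
      rw [squareModel_group] at hg
      obtain ⟨M', hM', k', l', h'⟩ := exists_isIntegralAffine_square hg
      have h1 := hM 1 0
      have h0 := hM 0 0
      rw [h', Prod.mk.injEq] at h1 h0
      rw [mul_one, norm_add_mul_I]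
      have e1 : (M.1 : ℝ) = M'.1 := by linarith
      have e2 : (M.2.2.1 : ℝ) = M'.2.2.1 := by linarith
      rw [e1, e2]
      simp only [List.mem_cons, List.not_mem_nil, or_false] at hM'
      rcases hM' with rfl | rfl | rfl | rfl | rfl | rfl | rfl | rfl <;> norm_num
    · intro x y x' y' h h' hn
      obtain ⟨i, j, rfl, rfl⟩ := mem_squareVertices.1 h
      obtain ⟨i', j', rfl, rfl⟩ := mem_squareVertices.1 h'
      rw [mul_one, norm_add_mul_I] at hn
      obtain ⟨τ, hτ, h⟩ := htr (-i) (-j)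
      have hn' : (i' - i) ^ 2 + (j' - j) ^ 2 = 1 := by exact_mod_cast hn
      obtain ⟨k, hk⟩ : ∃ k, k = i' - i := ⟨_, rfl⟩
      obtain ⟨l, hl⟩ : ∃ l, l = j' - j := ⟨_, rfl⟩
      rw [← hk, ← hl] at hn'
      -- After translation the edge starts at the origin, and its other end is one of the four
      -- integral vectors of norm one. A symmetry that fixes the origin takes it to `(1, 0)`.
      have hD : ∃ D ∈ squareModel.group, D (0, 0) = (0, 0) ∧ D ((k : ℝ), (l : ℝ)) = (1, 0) := by
        rw [squareModel_group]
        have m := squareReflection_mem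
        have k1 : -1 ≤ k := by nlinarith
        have k2 : k ≤ 1 := by nlinarith
        have l1 : -1 ≤ l := by nlinarith
        have l2 : l ≤ 1 := by nlinarith
        have cases : k = 1 ∧ l = 0 ∨ k = -1 ∧ l = 0 ∨ k = 0 ∧ l = 1 ∨ k = 0 ∧ l = -1 := by
          interval_cases k <;> interval_cases l <;> simp at hn' ⊢
        rcases cases with ⟨rfl, rfl⟩ | ⟨rfl, rfl⟩ | ⟨rfl, rfl⟩ | ⟨rfl, rfl⟩
        · exact ⟨1, one_mem _, by simp⟩
        · exact ⟨squareReflection 1 * squareReflection 0 * squareReflection 1,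
            mul_mem (mul_mem (m 1) (m 0)) (m 1),
            by simp [squareReflection_zero, squareReflection_one]⟩
        · exact ⟨squareReflection 1, m 1, by simp [squareReflection_one]⟩
        · exact ⟨squareReflection 1 * squareReflection 0, mul_mem (m 1) (m 0),
            by simp [squareReflection_zero, squareReflection_one]⟩
      obtain ⟨D, hD, h0, h1⟩ := hD
      refine ⟨D * τ, mul_mem hD hτ, ?_, ?_⟩
      · rw [Equiv.Perm.mul_apply, h, ← h0]
        simp
      · rw [Equiv.Perm.mul_apply, h, ← h1, hk, hl]
        push_cast
        rfl
  · intro w hw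
    obtain ⟨i, j, h⟩ := (hw 0).2 ⟨0, 0, by simp⟩
    exact ⟨i, j, by rw [← zero_add w, h]; ring⟩

theorem exists_point_reflection : ∃ g ∈ triangularGroup, ∀ x y : ℝ, g (x, y) = (-x, -y) := by
  have m := triangularReflection_mem
  refine ⟨(triangularReflection 0 * triangularReflection 1) ^ 3, pow_mem (mul_mem (m 0) (m 1)) 3,
    fun x y ↦ ?_⟩
  simp only [pow_succ, pow_zero, one_mul, Equiv.Perm.mul_apply, triangularReflection_zero,
    triangularReflection_one]
  ext <;> simp

theorem triangleModel_describes :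
    triangleModel.Describes 1 zeta triangularVertices (unitGraph triangularVertices) := by
  have haff (g) (hg : g ∈ triangleModel.group) : ∃ M k l, IsIntegralAffine g M k l := by
    rw [triangleModel_group] at hg
    obtain ⟨M, -, k, l, h⟩ := exists_isIntegralAffine_triangular hg
    exact ⟨M, k, l, h⟩
  have htr (i j : ℤ) : ∃ τ ∈ triangleModel.group, ∀ x y : ℝ, τ (x, y) = (x + i, y + j) := by
    rw [triangleModel_group]
    exact exists_translation_triangular i j
  have hV (x y : ℝ) := (exists_mem_origin haff htr x y).trans mem_triangularVertices.symm
  have hplace : triangleModel.place (0, 0) = side 3 0 0 := triangleModel_place_side (by simp)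
  refine ⟨linearIndependent_one_zeta, ⟨List.toFinset
      [(1, 0, 0, 1), (-1, 0, 0, -1), (0, -1, 1, 1), (-1, -1, 1, 0), (0, 1, -1, -1), (1, 1, -1, 0),
      (1, 1, 0, -1), (-1, -1, 0, 1), (0, 1, 1, 0), (0, -1, -1, 0), (1, 0, -1, -1), (-1, 0, 1, 1)],
      fun g hg ↦ ?_⟩, htr, ?_, ?_, ?_, ?_⟩
  · rw [triangleModel_group] at hg
    simpa only [List.mem_toFinset] using exists_isIntegralAffine_triangular hg
  · rintro ⟨x, y⟩
    obtain ⟨i, j, h⟩ := exists_sub_mem_square (x, y)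
    obtain ⟨τ, hτ, h'⟩ := htr (-i) (-j)
    have h1 : τ (x, y) = (x - i, y - j) := by
      rw [h']
      ext <;> simp [sub_eq_add_neg]
    obtain ⟨hx, hy⟩ := h
    simp only [Prod.fst_sub, Prod.snd_sub, Set.mem_Icc] at hx hy
    rcases le_total (x - i + (y - j)) 1 with hxy | hxy
    · refine ⟨τ, hτ, triangleModel_mem_polygon.2 ?_⟩
      rw [h1]
      exact mem_unitTriangle.2 ⟨hx.1, hy.1, hxy⟩
    -- In the upper half of the unit square, the half turn `z ↦ (1, 1) - z` leads into the base
    -- triangle.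
    · obtain ⟨g, hg, hg'⟩ := exists_point_reflection
      rw [← triangleModel_group] at hg
      obtain ⟨τ', hτ', h''⟩ := htr 1 1
      refine ⟨τ' * g * τ, mul_mem (mul_mem hτ' hg) hτ, triangleModel_mem_polygon.2 ?_⟩
      rw [Equiv.Perm.mul_apply, Equiv.Perm.mul_apply, h1, hg', h'']
      push_cast
      exact mem_unitTriangle.2 ⟨by linarith, by linarith, by linarith⟩
  · intro x y
    rw [← hV, ← hplace]
    simp only [triangleModel.place.injective.eq_iff]
  · refine TilingModel.mem_unitGraph_iff (a := 0) (b := 0) (a' := 1) (b' := 0)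
      linearIndependent_one_zeta haff ?_ hV ?_ ?_ ?_
    · intro t
      rw [← triangleModel_place_side t.2]
      simp
    · rw [triangleModel_group]
      exact ⟨_, triangularReflection_mem 2, by simp [triangularReflection_two]⟩
    · intro g hg M k l hM
      rw [triangleModel_group] at hg
      obtain ⟨M', hM', k', l', h'⟩ := exists_isIntegralAffine_triangular hg
      have h1 := hM 1 0
      have h0 := hM 0 0
      rw [h', Prod.mk.injEq] at h1 h0
      rw [mul_one, norm_add_mul_zeta]
      have e1 : (M.1 : ℝ) = M'.1 := by linarith
      have e2 : (M.2.2.1 : ℝ) = M'.2.2.1 := by linarith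
      rw [e1, e2]
      simp only [List.mem_cons, List.not_mem_nil, or_false] at hM'
      rcases hM' with rfl | rfl | rfl | rfl | rfl | rfl | rfl | rfl | rfl | rfl | rfl | rfl <;>
        norm_num
    · intro x y x' y' h h' hn
      obtain ⟨i, j, rfl, rfl⟩ := mem_triangularVertices.1 h
      obtain ⟨i', j', rfl, rfl⟩ := mem_triangularVertices.1 h'
      rw [mul_one, norm_add_mul_zeta] at hn
      obtain ⟨τ, hτ, h⟩ := htr (-i) (-j)
      have hn' : (i' - i) ^ 2 + (i' - i) * (j' - j) + (j' - j) ^ 2 = 1 := by exact_mod_cast hn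
      obtain ⟨k, hk⟩ : ∃ k, k = i' - i := ⟨_, rfl⟩
      obtain ⟨l, hl⟩ : ∃ l, l = j' - j := ⟨_, rfl⟩
      rw [← hk, ← hl] at hn'
      have hD : ∃ D ∈ triangleModel.group, D (0, 0) = (0, 0) ∧ D ((k : ℝ), (l : ℝ)) = (1, 0) := by
        rw [triangleModel_group]
        have m := triangularReflection_mem
        obtain ⟨g, hg, hg'⟩ := exists_point_reflection
        -- The bounds come from `4 (k² + k l + l²) = 3 k² + (k + 2 l)²` and the same identity with
        -- `k` and `l` exchanged.
        have k1 : -1 ≤ k := by nlinarith [sq_nonneg (k + 2 * l)]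
        have k2 : k ≤ 1 := by nlinarith [sq_nonneg (k + 2 * l)]
        have l1 : -1 ≤ l := by nlinarith [sq_nonneg (2 * k + l)]
        have l2 : l ≤ 1 := by nlinarith [sq_nonneg (2 * k + l)]
        have cases : k = 1 ∧ l = 0 ∨ k = -1 ∧ l = 0 ∨ k = 0 ∧ l = 1 ∨ k = 0 ∧ l = -1 ∨
            k = 1 ∧ l = -1 ∨ k = -1 ∧ l = 1 := by
          interval_cases k <;> interval_cases l <;> simp at hn' ⊢
        rcases cases with ⟨rfl, rfl⟩ | ⟨rfl, rfl⟩ | ⟨rfl, rfl⟩ | ⟨rfl, rfl⟩ | ⟨rfl, rfl⟩ | ⟨rfl, rfl⟩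
        · exact ⟨1, one_mem _, by simp⟩
        · exact ⟨g, hg, by simp [hg']⟩
        · exact ⟨triangularReflection 1, m 1, by simp [triangularReflection_one]⟩
        · exact ⟨g * triangularReflection 1, mul_mem hg (m 1),
            by simp [triangularReflection_one, hg']⟩
        · exact ⟨triangularReflection 1 * triangularReflection 0, mul_mem (m 1) (m 0),
            by simp [triangularReflection_zero, triangularReflection_one]⟩
        · exact ⟨g * triangularReflection 1 * triangularReflection 0,
            mul_mem (mul_mem hg (m 1)) (m 0),
            by simp [triangularReflection_zero, triangularReflection_one, hg']⟩
      obtain ⟨D, hD, h0, h1⟩ := hD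
      refine ⟨D * τ, mul_mem hD hτ, ?_, ?_⟩
      · rw [Equiv.Perm.mul_apply, h, ← h0]
        simp
      · rw [Equiv.Perm.mul_apply, h, ← h1, hk, hl]
        push_cast
        rfl
  · intro w hw
    obtain ⟨i, j, h⟩ := (hw 0).2 ⟨0, 0, by simp⟩
    exact ⟨i, j, by rw [← zero_add w, h]; ring⟩

/-- If `a + b ζ` has coordinates `(x, y)` in the lattice of centers, then `a - b = 3 y` and `b = x -
y`. The two nonzero residues of `a - b` modulo `3` yield the two classes of vertices. -/
theorem mem_hexagonalVertices {x y : ℝ} : (x * (1 + zeta) + y * (2 - zeta) : ℂ) ∈ hexagonalVertices ↔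
    ∃ i j : ℤ, x = i + 1 / 3 ∧ y = j + 1 / 3 ∨ x = i - 1 / 3 ∧ y = j - 1 / 3 := by
  constructor
  · rintro ⟨a, b, hab, h⟩
    have h1 : ((x + 2 * y : ℝ) * 1 + (x - y : ℝ) * zeta : ℂ) = (a : ℝ) * 1 + (b : ℝ) * zeta := by
      push_cast
      linear_combination h
    obtain ⟨h2, h3⟩ := eq_of_add_mul_eq linearIndependent_one_zeta h1
    have hmod : (a - b) % 3 = 1 ∨ (a - b) % 3 = 2 := by
      have : (a - b) % 3 ≠ 0 := fun h0 ↦ hab (Int.ModEq.symm ((Int.modEq_iff_dvd).2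
        (Int.dvd_of_emod_eq_zero h0)))
      omega
    rcases hmod with h0 | h0
    · obtain ⟨j, hj⟩ : ∃ j, a = b + 3 * j + 1 := ⟨(a - b) / 3, by omega⟩
      have hj' : (a : ℝ) = b + 3 * j + 1 := by exact_mod_cast hj
      exact ⟨b + j, j, Or.inl ⟨by push_cast; linarith, by linarith⟩⟩
    · obtain ⟨j, hj⟩ : ∃ j, a = b + 3 * j - 1 := ⟨(a - b) / 3 + 1, by omega⟩
      have hj' : (a : ℝ) = b + 3 * j - 1 := by exact_mod_cast hj
      exact ⟨b + j, j, Or.inr ⟨by push_cast; linarith, by linarith⟩⟩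
  · rintro ⟨i, j, ⟨rfl, rfl⟩ | ⟨rfl, rfl⟩⟩
    · refine ⟨i + 2 * j + 1, i - j, ?_, by push_cast; ring⟩
      rw [Int.modEq_iff_dvd]
      omega
    · refine ⟨i + 2 * j - 1, i - j, ?_, by push_cast; ring⟩
      rw [Int.modEq_iff_dvd]
      omega

theorem exists_mem_hexagonal (x y : ℝ) :
    (∃ g ∈ triangularGroup, g (x, y) = (1 / 3, 1 / 3)) ↔
      ∃ i j : ℤ, x = i + 1 / 3 ∧ y = j + 1 / 3 ∨ x = i - 1 / 3 ∧ y = j - 1 / 3 := by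
  constructor
  · rintro ⟨g, hg, h⟩
    obtain ⟨M, hM, k, l, hgM⟩ := exists_isIntegralAffine_triangular (inv_mem hg)
    have h1 : g⁻¹ (1 / 3, 1 / 3) = (x, y) := by rw [← h]; simp
    rw [hgM, Prod.mk.injEq] at h1
    obtain ⟨rfl, rfl⟩ := h1
    simp only [List.mem_cons, List.not_mem_nil, or_false] at hM
    rcases hM with rfl | rfl | rfl | rfl | rfl | rfl | rfl | rfl | rfl | rfl | rfl | rfl <;> push_cast
    · exact ⟨k, l, Or.inl ⟨by ring, by ring⟩⟩
    · exact ⟨k, l, Or.inr ⟨by ring, by ring⟩⟩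
    · exact ⟨k, l + 1, Or.inr ⟨by ring, by push_cast; ring⟩⟩
    · exact ⟨k - 1, l, Or.inl ⟨by push_cast; ring, by ring⟩⟩
    · exact ⟨k, l - 1, Or.inl ⟨by ring, by push_cast; ring⟩⟩
    · exact ⟨k + 1, l, Or.inr ⟨by push_cast; ring, by ring⟩⟩
    · exact ⟨k + 1, l, Or.inr ⟨by push_cast; ring, by ring⟩⟩
    · exact ⟨k - 1, l, Or.inl ⟨by push_cast; ring, by ring⟩⟩
    · exact ⟨k, l, Or.inl ⟨by ring, by ring⟩⟩
    · exact ⟨k, l, Or.inr ⟨by ring, by ring⟩⟩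
    · exact ⟨k, l - 1, Or.inl ⟨by ring, by push_cast; ring⟩⟩
    · exact ⟨k, l + 1, Or.inr ⟨by ring, by push_cast; ring⟩⟩
  · rintro ⟨i, j, ⟨rfl, rfl⟩ | ⟨rfl, rfl⟩⟩ <;>
      obtain ⟨τ, hτ, h⟩ := exists_translation_triangular (-i) (-j)
    · exact ⟨τ, hτ, by rw [h]; ext <;> simp⟩
    · obtain ⟨g, hg, hg'⟩ := exists_point_reflection
      refine ⟨g * τ, mul_mem hg hτ, ?_⟩
      rw [Equiv.Perm.mul_apply, h, hg']
      ext <;> push_cast <;> ring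

theorem norm_hexagonal (x y : ℝ) :
    ‖(x * (1 + zeta) + y * (2 - zeta) : ℂ)‖ = 1 ↔ 3 * (x ^ 2 + x * y + y ^ 2) = 1 := by
  have : (x * (1 + zeta) + y * (2 - zeta) : ℂ) = (x + 2 * y : ℝ) + (x - y : ℝ) * zeta := by
    push_cast; ring
  rw [this, norm_add_mul_zeta]
  constructor <;> intro h <;> linarith

theorem hexagonModel_describes : hexagonModel.Describes (1 + zeta) (2 - zeta) hexagonalVertices
    (unitGraph hexagonalVertices) := by
  have haff (g) (hg : g ∈ hexagonModel.group) : ∃ M k l, IsIntegralAffine g M k l := by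
    obtain ⟨M, -, k, l, h⟩ := exists_isIntegralAffine_triangular hg
    exact ⟨M, k, l, h⟩
  have htr := exists_translation_triangular
  have hV (x y : ℝ) := (exists_mem_hexagonal x y).trans mem_hexagonalVertices.symm
  have hplace : hexagonModel.place (1 / 3, 1 / 3) = side 6 0 0 := by
    have := hexagonModel_place_side (x := 0) (by simp)
    simpa using this
  refine ⟨linearIndependent_hexagon, ⟨List.toFinset
      [(1, 0, 0, 1), (-1, 0, 0, -1), (0, -1, 1, 1), (-1, -1, 1, 0), (0, 1, -1, -1), (1, 1, -1, 0),
      (1, 1, 0, -1), (-1, -1, 0, 1), (0, 1, 1, 0), (0, -1, -1, 0), (1, 0, -1, -1), (-1, 0, 1, 1)],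
      fun g hg ↦ ?_⟩, htr, ?_, ?_, ?_, ?_⟩
  · simpa only [List.mem_toFinset] using exists_isIntegralAffine_triangular hg
  · rintro ⟨x, y⟩
    obtain ⟨i, j, h⟩ := exists_sub_mem_unitHexagon (x, y)
    obtain ⟨τ, hτ, h'⟩ := htr (-i) (-j)
    refine ⟨τ, hτ, hexagonModel_mem_polygon.2 ?_⟩
    rw [h']
    simpa [← sub_eq_add_neg] using h
  · intro x y
    rw [← hV, ← hplace]
    simp only [hexagonModel.place.injective.eq_iff]
    rfl
  · refine TilingModel.mem_unitGraph_iff (a := 1 / 3) (b := 1 / 3) (a' := 2 / 3) (b' := -1 / 3)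
      linearIndependent_hexagon haff ?_ hV ?_ ?_ ?_
    · intro t
      rw [← hexagonModel_place_side t.2]
      congr 1
      ext <;> simp only <;> ring
    · refine ⟨_, triangularReflection_mem 0, ?_⟩
      rw [triangularReflection_zero]
      ext <;> norm_num
    · intro g hg M k l hM
      obtain ⟨M', hM', k', l', h'⟩ := exists_isIntegralAffine_triangular hg
      have h1 := hM 1 0
      have h0 := hM 0 0
      have h2 := hM 0 1
      rw [h', Prod.mk.injEq] at h1 h0 h2
      rw [norm_hexagonal]
      have e1 : (M.1 : ℝ) = M'.1 := by linarith
      have e2 : (M.2.2.1 : ℝ) = M'.2.2.1 := by linarith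
      have e3 : (M.2.1 : ℝ) = M'.2.1 := by linarith
      have e4 : (M.2.2.2 : ℝ) = M'.2.2.2 := by linarith
      rw [e1, e2, e3, e4]
      simp only [List.mem_cons, List.not_mem_nil, or_false] at hM'
      rcases hM' with rfl | rfl | rfl | rfl | rfl | rfl | rfl | rfl | rfl | rfl | rfl | rfl <;>
        norm_num
    · intro x y x' y' hz hz' hn
      have key (i j : ℤ) (x' y' : ℝ) (hz' : (x' * (1 + zeta) + y' * (2 - zeta) : ℂ) ∈
          hexagonalVertices)
          (hn : ‖((x' - (i + 1 / 3) : ℝ) * (1 + zeta) + (y' - (j + 1 / 3) : ℝ) * (2 - zeta) : ℂ)‖ = 1) :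
          ∃ g ∈ triangularGroup, g ((i : ℝ) + 1 / 3, (j : ℝ) + 1 / 3) = (1 / 3, 1 / 3) ∧
            g (x', y') = (2 / 3, -1 / 3) := by
        rw [norm_hexagonal] at hn
        obtain ⟨τ, hτ, h⟩ := htr (-i) (-j)
        obtain ⟨i', j', ⟨rfl, rfl⟩ | ⟨rfl, rfl⟩⟩ := mem_hexagonalVertices.1 hz'
        -- Vertices of the same class differ by an element of the lattice of centers, whose squared
        -- length is divisible by three and hence not one.
        · exfalso
          have h1 : 3 * ((i' - i) ^ 2 + (i' - i) * (j' - j) + (j' - j) ^ 2) = 1 := by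
            have : 3 * (((i' : ℝ) - i) ^ 2 + (i' - i) * (j' - j) + (j' - j) ^ 2) = 1 := by
              rw [← hn]; ring
            exact_mod_cast this
          omega
        · obtain ⟨k, hk⟩ : ∃ k, k = i' - i := ⟨_, rfl⟩
          obtain ⟨l, hl⟩ : ∃ l, l = j' - j := ⟨_, rfl⟩
          have hk' : (k : ℝ) = i' - i := by rw [hk]; push_cast; rfl
          have hl' : (l : ℝ) = j' - j := by rw [hl]; push_cast; rfl
          have h1 : (3 * k - 2) ^ 2 + (3 * k - 2) * (3 * l - 2) + (3 * l - 2) ^ 2 = 3 := by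
            have : (3 * (k : ℝ) - 2) ^ 2 + (3 * k - 2) * (3 * l - 2) + (3 * l - 2) ^ 2 = 3 := by
              rw [hk', hl']
              linear_combination 3 * hn
            exact_mod_cast this
          have m := triangularReflection_mem
          have hD : ∃ D ∈ triangularGroup, D (1 / 3, 1 / 3) = (1 / 3, 1 / 3) ∧
              D ((k : ℝ) - 1 / 3, (l : ℝ) - 1 / 3) = (2 / 3, -1 / 3) := by
            have k1 : 0 ≤ k := by nlinarith [sq_nonneg ((3 * k - 2) + 2 * (3 * l - 2))]
            have k2 : k ≤ 1 := by nlinarith [sq_nonneg ((3 * k - 2) + 2 * (3 * l - 2))]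
            have l1 : 0 ≤ l := by nlinarith [sq_nonneg (2 * (3 * k - 2) + (3 * l - 2))]
            have l2 : l ≤ 1 := by nlinarith [sq_nonneg (2 * (3 * k - 2) + (3 * l - 2))]
            have cases : k = 1 ∧ l = 0 ∨ k = 0 ∧ l = 1 ∨ k = 1 ∧ l = 1 := by
              interval_cases k <;> interval_cases l <;> simp at h1 ⊢
            rcases cases with ⟨rfl, rfl⟩ | ⟨rfl, rfl⟩ | ⟨rfl, rfl⟩
            · exact ⟨1, one_mem _, rfl, by ext <;> norm_num⟩
            · refine ⟨triangularReflection 1, m 1, ?_, ?_⟩ <;> rw [triangularReflection_one]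
              ext <;> norm_num
            · refine ⟨triangularReflection 1 * triangularReflection 2, mul_mem (m 1) (m 2), ?_, ?_⟩ <;>
                rw [Equiv.Perm.mul_apply, triangularReflection_two, triangularReflection_one] <;>
                ext <;> norm_num
          obtain ⟨D, hD, h2, h3⟩ := hD
          refine ⟨D * τ, mul_mem hD hτ, ?_, ?_⟩
          · rw [Equiv.Perm.mul_apply, h, ← h2]
            simp
          · rw [Equiv.Perm.mul_apply, h, ← h3, hk', hl']
            congr 2 <;> push_cast <;> ring
      obtain ⟨i, j, ⟨rfl, rfl⟩ | ⟨rfl, rfl⟩⟩ := mem_hexagonalVertices.1 hz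
      · exact key i j x' y' hz' hn
      -- The point reflection exchanges the two classes of vertices and reduces this case to the
      -- previous one.
      · obtain ⟨g, hg, hg'⟩ := exists_point_reflection
        obtain ⟨D, hD, h1, h2⟩ := key (-i) (-j) (-x') (-y') (by
            rw [mem_hexagonalVertices] at hz' ⊢
            obtain ⟨i', j', ⟨rfl, rfl⟩ | ⟨rfl, rfl⟩⟩ := hz'
            · exact ⟨-i', -j', Or.inr ⟨by push_cast; ring, by push_cast; ring⟩⟩
            · exact ⟨-i', -j', Or.inl ⟨by push_cast; ring, by push_cast; ring⟩⟩) (by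
            refine Eq.trans ?_ hn
            rw [← norm_neg]
            congr 1
            push_cast; ring)
        refine ⟨D * g, mul_mem hD hg, ?_, ?_⟩
        · rw [Equiv.Perm.mul_apply, hg', ← h1]
          congr 2 <;> push_cast <;> ring
        · rw [Equiv.Perm.mul_apply, hg', h2]
  · intro w hw
    have hw' (a b : ℤ) (hab : ¬ a ≡ b [ZMOD 3]) :
        ∃ c d : ℤ, ¬ c ≡ d [ZMOD 3] ∧ (a + b * zeta : ℂ) + w = c + d * zeta :=
      (hw _).2 ⟨a, b, hab, rfl⟩
    -- One vertex does not determine the class of `w`, but the images of both `1` and `-1` must be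
    -- vertices. This rules out two residues of `c - d` modulo `3` and leaves `c - d ≡ 1`, so that
    -- `w` is in the lattice of centers.
    obtain ⟨c, d, hcd, h⟩ := hw' 1 0 (by decide)
    obtain ⟨c', d', hcd', h'⟩ := hw' (-1) 0 (by decide)
    push_cast at h h'
    have h2 : ((c' + 2 : ℝ) * 1 + (d' : ℝ) * zeta : ℂ) = (c : ℝ) * 1 + (d : ℝ) * zeta := by
      push_cast
      linear_combination h - h'
    obtain ⟨h3, h4⟩ := eq_of_add_mul_eq linearIndependent_one_zeta h2
    have h3' : c' + 2 = c := by exact_mod_cast h3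
    have h4' : d' = d := by exact_mod_cast h4
    rw [Int.modEq_iff_dvd] at hcd hcd'
    obtain ⟨j, hj⟩ : ∃ j, c = d + 3 * j + 1 := ⟨(c - d - 1) / 3, by omega⟩
    refine ⟨d + j, j, ?_⟩
    subst hj
    push_cast at h ⊢
    linear_combination h

end TorusMap

namespace TorusMap

open scoped ComplexConjugate
open Gluing

/-! ### Symmetries with fixed points -/

namespace IsDevelopment

variable {n : ℕ} [NeZero n] {T : TilingModel n} {G : Gluing n} {q : G.Flag → ℝ × ℝ → G.Space}

variable (q) in
/-- The permutation `p` of the flags does the same as the transformation `g` of the plane. -/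
def Realizes (p : Equiv.Perm G.Flag) (g : Equiv.Perm (ℝ × ℝ)) : Prop :=
  ∀ s z, q (p s) z = q s (g z)

theorem Realizes.mul {p p' : Equiv.Perm G.Flag} {g g' : Equiv.Perm (ℝ × ℝ)} (h : Realizes q p g)
    (h' : Realizes q p' g') : Realizes q (p' * p) (g * g') := fun s z ↦ by
  rw [Equiv.Perm.mul_apply, h', h, Equiv.Perm.mul_apply]

theorem Realizes.pow {p : Equiv.Perm G.Flag} {g : Equiv.Perm (ℝ × ℝ)} (h : Realizes q p g) (k : ℕ) :
    Realizes q (p ^ k) (g ^ k) := by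
  induction k with
  | zero => exact fun _ _ ↦ rfl
  | succ k ih =>
    rw [pow_succ', pow_succ]
    exact ih.mul h

variable (q) in
/-- The transformation `g` of the plane is compatible with no map of the development. -/
def NowhereCompatible (g : Equiv.Perm (ℝ × ℝ)) : Prop := ∀ s, ¬ ∀ z, q s (g z) = q s z

/-- The maps of a development determine their flags, so `g` is compatible with `q s` only if `p`
fixes `s`. Freeness becomes a matter of fixed flags. -/
theorem Realizes.nowhereCompatible (hn : 3 ≤ n) (hq : IsDevelopment T q) {p : Equiv.Perm G.Flag}
    {g : Equiv.Perm (ℝ × ℝ)} (h : Realizes q p g) (hp : ∀ s, p s ≠ s) : NowhereCompatible q g := by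
  intro s hs
  exact hp s (hq.injective hn (funext fun z ↦ (h s z).trans (hs z)))

theorem NowhereCompatible.conj (hq : IsDevelopment T q) {h : Equiv.Perm (ℝ × ℝ)} (hh : h ∈ T.group)
    {g g' : Equiv.Perm (ℝ × ℝ)} (hgg' : ∀ z, g (h z) = h (g' z)) (hg' : NowhereCompatible q g') :
    NowhereCompatible q g := by
  intro s hs
  obtain ⟨p, hp⟩ := hq.exists_perm hh
  refine hg' (p s) fun z ↦ ?_
  rw [hp, hp, ← hgg', hs]

theorem NowhereCompatible.of_sq {g : Equiv.Perm (ℝ × ℝ)} (h : NowhereCompatible q (g * g)) :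
    NowhereCompatible q g := fun s hs ↦ h s fun z ↦ by
  rw [Equiv.Perm.mul_apply, hs, hs]

theorem NowhereCompatible.of_cube {g : Equiv.Perm (ℝ × ℝ)}
    (h : NowhereCompatible q (g * (g * g))) : NowhereCompatible q g := fun s hs ↦ h s fun z ↦ by
  rw [Equiv.Perm.mul_apply, Equiv.Perm.mul_apply, hs, hs, hs]

end IsDevelopment

open IsDevelopment

theorem pow_mul_comm_ne {F : Type*} {a b : Equiv.Perm F} {k : ℕ} (ha : a * a = 1) (hb : b * b = 1)
    (h : ∀ s, ((a * b) ^ k) s ≠ s) (s : F) : ((b * a) ^ k) s ≠ s := by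
  have : b * a = (a * b)⁻¹ := by
    rw [mul_inv_rev, inv_eq_of_mul_eq_one_left ha, inv_eq_of_mul_eq_one_left hb]
  intro hs
  rw [this, inv_pow, Equiv.Perm.inv_eq_iff_eq] at hs
  exact h s hs.symm

/-- The representatives of symmetries with fixed points are realized by the involutions, by `flipEnd
* cross`, by proper powers of `turn * cross` and by `flipEnd * turn`. None of them fixes a flag; for
the powers of `turn * cross` this is the exactness of the degrees. -/
theorem nowhereCompatible_triangle {G : Gluing 3} {q : G.Flag → ℝ × ℝ → G.Space}
    (hq : IsDevelopment triangleModel q)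
    (hne : ∀ i, 0 < i → i < 6 → ∀ s, ((G.turn * G.cross) ^ i) s ≠ s) {g : Equiv.Perm (ℝ × ℝ)}
    (hg : g ∈ triangleModel.group) {w : ℝ × ℝ} (hw : g w = w) (hg1 : g ≠ 1) :
    NowhereCompatible q g := by
  rw [triangleModel_group] at hg
  have h0 : Realizes q G.cross (triangularReflection 0) := hq.reflect 2
  have h1 : Realizes q G.turn (triangularReflection 1) := hq.reflect 1
  have h2 : Realizes q G.flipEnd (triangularReflection 2) := hq.reflect 0
  refine triangular_of_fixed (N := NowhereCompatible q)
    (fun h hh g g' hgg' ↦ NowhereCompatible.conj hq (triangleModel_group ▸ hh) hgg')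
    (fun g ↦ .of_sq) (fun g ↦ .of_cube) ?_
    ((h0.mul h2).nowhereCompatible le_rfl hq G.flipEnd_mul_cross_ne)
    (((h0.mul h1).pow 2).nowhereCompatible le_rfl hq (hne 2 (by norm_num) (by norm_num)))
    (((h0.mul h1).pow 3).nowhereCompatible le_rfl hq (hne 3 (by norm_num) (by norm_num)))
    ((h1.mul h2).nowhereCompatible le_rfl hq fun s ↦ by
      simpa using G.flipEnd_mul_turn_pow_ne one_pos (by norm_num) s) hg hw hg1
  intro i
  fin_cases i
  · exact h0.nowhereCompatible le_rfl hq G.cross_ne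
  · exact h1.nowhereCompatible le_rfl hq G.turn_ne
  · exact h2.nowhereCompatible le_rfl hq G.flipEnd_ne

theorem nowhereCompatible_square {G : Gluing 4} {q : G.Flag → ℝ × ℝ → G.Space}
    (hq : IsDevelopment squareModel q)
    (hne : ∀ i, 0 < i → i < 4 → ∀ s, ((G.turn * G.cross) ^ i) s ≠ s) {g : Equiv.Perm (ℝ × ℝ)}
    (hg : g ∈ squareModel.group) {w : ℝ × ℝ} (hw : g w = w) (hg1 : g ≠ 1) :
    NowhereCompatible q g := by
  have hn : 3 ≤ 4 := by norm_num
  rw [squareModel_group] at hg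
  have h0 : Realizes q G.cross (squareReflection 0) := hq.reflect 2
  have h1 : Realizes q G.turn (squareReflection 1) := hq.reflect 1
  have h2 : Realizes q G.flipEnd (squareReflection 2) := hq.reflect 0
  refine square_of_fixed (N := NowhereCompatible q)
    (fun h hh g g' hgg' ↦ NowhereCompatible.conj hq (squareModel_group ▸ hh) hgg')
    (fun g ↦ .of_sq) ?_
    ((h0.mul h2).nowhereCompatible hn hq G.flipEnd_mul_cross_ne)
    (((h0.mul h1).pow 2).nowhereCompatible hn hq (hne 2 (by norm_num) (by norm_num)))
    (((h1.mul h2).pow 2).nowhereCompatible hn hq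
      (G.flipEnd_mul_turn_pow_ne (by norm_num) (by norm_num))) hg hw hg1
  intro i
  fin_cases i
  · exact h0.nowhereCompatible hn hq G.cross_ne
  · exact h1.nowhereCompatible hn hq G.turn_ne
  · exact h2.nowhereCompatible hn hq G.flipEnd_ne

theorem nowhereCompatible_hexagon {G : Gluing 6} {q : G.Flag → ℝ × ℝ → G.Space}
    (hq : IsDevelopment hexagonModel q)
    (hne : ∀ i, 0 < i → i < 3 → ∀ s, ((G.turn * G.cross) ^ i) s ≠ s) {g : Equiv.Perm (ℝ × ℝ)}
    (hg : g ∈ hexagonModel.group) {w : ℝ × ℝ} (hw : g w = w) (hg1 : g ≠ 1) :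
    NowhereCompatible q g := by
  have hn : 3 ≤ 6 := by norm_num
  have h0 : Realizes q G.flipEnd (triangularReflection 0) := hq.reflect 0
  have h1 : Realizes q G.turn (triangularReflection 1) := hq.reflect 1
  have h2 : Realizes q G.cross (triangularReflection 2) := hq.reflect 2
  have hcomm (i : ℕ) (hi : 0 < i) (hi' : i < 6) :=
    pow_mul_comm_ne G.flipEnd_mul_self G.turn_mul_self (G.flipEnd_mul_turn_pow_ne hi hi')
  refine triangular_of_fixed (N := NowhereCompatible q)
    (fun h hh g g' hgg' ↦ NowhereCompatible.conj hq hh hgg')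
    (fun g ↦ .of_sq) (fun g ↦ .of_cube) ?_
    ((h0.mul h2).nowhereCompatible hn hq (G.flipEnd_mul_cross ▸ G.flipEnd_mul_cross_ne))
    (((h0.mul h1).pow 2).nowhereCompatible hn hq (hcomm 2 (by norm_num) (by norm_num)))
    (((h0.mul h1).pow 3).nowhereCompatible hn hq (hcomm 3 (by norm_num) (by norm_num)))
    ((h1.mul h2).nowhereCompatible hn hq (by
      simpa using pow_mul_comm_ne G.turn_mul_self G.cross_mul_self
        (hne 1 (by norm_num) (by norm_num)))) hg hw hg1
  intro i
  fin_cases i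
  · exact h0.nowhereCompatible hn hq G.flipEnd_ne
  · exact h1.nowhereCompatible hn hq G.turn_ne
  · exact h2.nowhereCompatible hn hq G.cross_ne

/-! ### Maps without exceptional vertices -/

theorem PolygonalMap.isQuotientOfTiling_of_isDevelopment {n : ℕ} [NeZero n] {T : TilingModel n}
    {u v : ℂ} {V E : Set ℂ} (hT : T.Describes u v V E) (m : PolygonalMap n Torus)
    {q : m.Flag → ℝ × ℝ → m.Space} (hq : IsDevelopment T q)
    (hfree : ∀ g ∈ T.group, ∀ w, g w = w → g ≠ 1 → NowhereCompatible q g) :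
    m.IsQuotientOfTiling V E := by
  have : PreconnectedSpace m.Space :=
    ⟨m.homeo.symm.range_coe ▸ isPreconnected_range m.homeo.symm.continuous⟩
  obtain ⟨f, -⟩ : ∃ f : m.Space, True := ⟨m.homeo.symm 0, trivial⟩
  obtain ⟨⟨f, -⟩, -⟩ := Quot.exists_rep f
  let s : m.Flag := ((f, 0), false)
  obtain ⟨f, a, b, hf, hab, hfab, -, hV, hE⟩ := hq.exists_lattice hT s fun g hg ↦
    hq.isIntegralAffine_one_of_free hT m.homeo s
      (fun g hg w hw ↦ by_contra fun hg1 ↦ hfree g hg.1 w hw hg1 s hg.2) hg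
  refine isQuotientOfTiling_of_isQuotientMap (f := m.homeo ∘ f)
    (m.homeo.isQuotientMap.comp hf) hab (fun z w ↦ ?_) (fun z ↦ ?_) fun z ↦ ?_
  · rw [← hfab]
    exact m.homeo.injective.eq_iff
  · rw [← hV]
    simp only [vertices, point, Set.mem_ofPred_eq, Function.comp_apply, m.homeo.injective.eq_iff]
  · rw [← hE]
    simp only [skeleton, point, Set.mem_ofPred_eq, Function.comp_apply, m.homeo.injective.eq_iff]

theorem PolygonalMap.NoExceptionalVertices.isQuotientOfTiling_triangle {m : PolygonalMap 3 Torus}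
    (h : m.NoExceptionalVertices) :
    m.IsQuotientOfTiling triangularVertices (unitGraph triangularVertices) := by
  obtain ⟨q, hq⟩ := exists_isDevelopment_triangle (h.turn_mul_cross_pow (by norm_num))
    triangleModel_describes.exists_mem
  exact m.isQuotientOfTiling_of_isDevelopment triangleModel_describes hq fun g hg w hw hg1 ↦
    nowhereCompatible_triangle hq (fun i hi hi' ↦ h.turn_mul_cross_pow_ne (by norm_num) hi hi')
      hg hw hg1

theorem PolygonalMap.NoExceptionalVertices.isQuotientOfTiling_square {m : PolygonalMap 4 Torus}
    (h : m.NoExceptionalVertices) :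
    m.IsQuotientOfTiling squareVertices (unitGraph squareVertices) := by
  obtain ⟨q, hq⟩ := exists_isDevelopment_square (h.turn_mul_cross_pow (by norm_num))
    squareModel_describes.exists_mem
  exact m.isQuotientOfTiling_of_isDevelopment squareModel_describes hq fun g hg w hw hg1 ↦
    nowhereCompatible_square hq (fun i hi hi' ↦ h.turn_mul_cross_pow_ne (by norm_num) hi hi')
      hg hw hg1

theorem PolygonalMap.NoExceptionalVertices.isQuotientOfTiling_hexagon {m : PolygonalMap 6 Torus}
    (h : m.NoExceptionalVertices) :
    m.IsQuotientOfTiling hexagonalVertices (unitGraph hexagonalVertices) := by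
  obtain ⟨q, hq⟩ := exists_isDevelopment_hexagon (h.turn_mul_cross_pow (by norm_num))
    hexagonModel_describes.exists_mem
  exact m.isQuotientOfTiling_of_isDevelopment hexagonModel_describes hq fun g hg w hw hg1 ↦
    nowhereCompatible_hexagon hq (fun i hi hi' ↦ h.turn_mul_cross_pow_ne (by norm_num) hi hi')
      hg hw hg1

end TorusMap

namespace TorusMap

open scoped ComplexConjugate
open Gluing

/-! ### The minimal maps -/

namespace IsDevelopment

variable {n : ℕ} [NeZero n] {T : TilingModel n} {G : Gluing n} {q : G.Flag → ℝ × ℝ → G.Space}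

/-- If the flags are positions of the standard polygon in the plane, and the three involutions of
the flags correspond to reflections, then the symmetries that are compatible with a development are
the translations. -/
theorem mem_deckGroup_iff (hn : 3 ≤ n) (hq : IsDevelopment T q) {φ : G.Flag → ℂ →ₗ[ℝ] ℂ}
    (hφ : Function.Injective φ) (hφs : ∀ s, Function.Injective (φ s))
    (hφr : ∀ i s z, φ (G.flagPerm i s) z =
      φ s (polygonReflection n i z - polygonReflection n i 0)) (s : G.Flag)
    {g : Equiv.Perm (ℝ × ℝ)} (hg : g ∈ T.group) :
    g ∈ T.deckGroup (q s) ↔ ∀ z w, T.place (g z) - T.place (g w) = T.place z - T.place w := by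
  -- Subtracting the value at `0` leaves the linear part of a reflection.
  have hlin (i : Fin 3) (z w : ℂ) : polygonReflection n i z - polygonReflection n i w =
      polygonReflection n i (z - w) - polygonReflection n i 0 := by
    fin_cases i <;> simp [polygonReflection, mul_sub]
  -- Along a word for `g`, the permutation `p` of the flags and the linear part `A` of `g` are built
  -- together, and `φ` relates one to the other. As `φ` and its values are injective, `p` fixes `s`
  -- exactly if `A` is the identity.
  have key : ∃ (p : Equiv.Perm G.Flag) (A : ℂ → ℂ), (∀ s z, q (p s) z = q s (g z)) ∧
      (∀ s z, φ (p s) z = φ s (A z)) ∧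
      ∀ z w, T.place (g z) - T.place (g w) = A (T.place z - T.place w) := by
    unfold TilingModel.group at hg
    induction hg using Subgroup.closure_induction_left with
    | one => exact ⟨1, id, fun _ _ ↦ rfl, fun _ _ ↦ rfl, fun _ _ ↦ rfl⟩
    | mul_left x hx y hy ih =>
      obtain ⟨i, rfl⟩ := hx
      obtain ⟨p, A, h1, h2, h3⟩ := ih
      refine ⟨p * G.flagPerm i, fun z ↦ polygonReflection n i (A z) - polygonReflection n i 0,
        fun s z ↦ ?_, fun s z ↦ ?_, fun z w ↦ ?_⟩
      · rw [Equiv.Perm.mul_apply, h1, hq.reflect, Equiv.Perm.mul_apply]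
      · rw [Equiv.Perm.mul_apply, h2, hφr]
      · rw [Equiv.Perm.mul_apply, Equiv.Perm.mul_apply, T.place_reflection, T.place_reflection,
          hlin, h3]
    | inv_mul_cancel x hx y hy ih =>
      obtain ⟨i, rfl⟩ := hx
      have : (T.reflection i)⁻¹ = T.reflection i := by
        ext1 z
        rw [Equiv.Perm.inv_eq_iff_eq, T.reflection_reflection]
      rw [this]
      obtain ⟨p, A, h1, h2, h3⟩ := ih
      refine ⟨p * G.flagPerm i, fun z ↦ polygonReflection n i (A z) - polygonReflection n i 0,
        fun s z ↦ ?_, fun s z ↦ ?_, fun z w ↦ ?_⟩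
      · rw [Equiv.Perm.mul_apply, h1, hq.reflect, Equiv.Perm.mul_apply]
      · rw [Equiv.Perm.mul_apply, h2, hφr]
      · rw [Equiv.Perm.mul_apply, Equiv.Perm.mul_apply, T.place_reflection, T.place_reflection,
          hlin, h3]
  obtain ⟨p, A, h1, h2, h3⟩ := key
  constructor
  · intro h z w
    have hp : p s = s := hq.injective hn (funext fun z ↦ (h1 s z).trans (h.2 z))
    rw [h3]
    apply hφs s
    rw [← h2, hp]
  · intro h
    have hA (z : ℂ) : A z = z := by
      have := h3 (T.place.symm z) (T.place.symm 0)
      rw [h] at this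
      simpa using this.symm
    have hp : p s = s := hφ (LinearMap.ext fun z ↦ by rw [h2, hA])
    exact ⟨hg, fun z ↦ by rw [← h1, hp]⟩

/-- A gluing with a development whose compatible symmetries are all translations presents the
torus. -/
theorem exists_polygonalMap [PreconnectedSpace G.Space] {u v : ℂ} {V E : Set ℂ}
    (hT : T.Describes u v V E) (hq : IsDevelopment T q) (s : G.Flag)
    (hdeck : ∀ g ∈ T.group, g ∈ T.deckGroup (q s) ↔ ∃ k l, IsIntegralAffine g (1, 0, 0, 1) k l) :
    ∃ m₀ : PolygonalMap n Torus, m₀.toGluing = G ∧ ∃ h₀ : (ℂ ⧸ AddSubgroup.closure {u, v}) ≃ₜ Torus,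
      (∀ z : ℂ, h₀ (QuotientAddGroup.mk z) ∈ m₀.vertices ↔ z ∈ V) ∧
      ∀ z : ℂ, h₀ (QuotientAddGroup.mk z) ∈ m₀.skeleton ↔ z ∈ E := by
  obtain ⟨f, a, b, hf, hab, hfab, hmem, hV, hE⟩ := hq.exists_lattice hT s
    fun g hg ↦ (hdeck g hg.1).1 hg
  -- All integral translations are compatible with the development, so the lattice of the quotient
  -- is the full one.
  have hΛ : AddSubgroup.closure {a, b} = AddSubgroup.closure {u, v} := by
    ext z
    rw [hmem, AddSubgroup.mem_closure_pair]
    refine exists_congr fun i ↦ exists_congr fun j ↦ ⟨fun h ↦ by simp [h.1], fun h ↦ ?_⟩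
    refine ⟨by simp [← h], fun x y ↦ ?_⟩
    obtain ⟨τ, hτ, hτ'⟩ := hT.exists_translation i j
    rw [← hτ']
    exact ((hdeck τ hτ).2 ⟨i, j, fun x y ↦ by rw [hτ']; simp⟩).2 _
  rw [hΛ] at hfab
  obtain ⟨h₁, hh₁⟩ := exists_homeomorph_of_isQuotientMap hf _ hfab
  obtain ⟨h₂⟩ := exists_homeomorph_torus hT.linearIndependent
  -- Any identification `h₂` of the quotient of the plane with the torus will do; the map is made to
  -- correspond to the tiling under it.
  refine ⟨{ toGluing := G, homeo := h₁.symm.trans h₂ }, rfl, h₂, fun z ↦ ?_, fun z ↦ ?_⟩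
  · rw [← hV]
    simp only [PolygonalMap.vertices, PolygonalMap.point, Set.mem_ofPred_eq, Homeomorph.trans_apply,
      h₂.injective.eq_iff, Homeomorph.symm_apply_eq, hh₁]
  · rw [← hE]
    simp only [PolygonalMap.skeleton, PolygonalMap.point, Set.mem_ofPred_eq, Homeomorph.trans_apply,
      h₂.injective.eq_iff, Homeomorph.symm_apply_eq, hh₁]

end IsDevelopment

/-- The quotients of a tiling are the finite covers of its quotient by all translations. -/
theorem PolygonalMap.isQuotientOfTiling_iff_isFiniteCoverOf {n : ℕ} [NeZero n] {T : TilingModel n}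
    {u v : ℂ} {V E : Set ℂ} (hT : T.Describes u v V E) {m₀ : PolygonalMap n Torus}
    (h₀ : (ℂ ⧸ AddSubgroup.closure {u, v}) ≃ₜ Torus)
    (hV₀ : ∀ z : ℂ, h₀ (QuotientAddGroup.mk z) ∈ m₀.vertices ↔ z ∈ V)
    (hE₀ : ∀ z : ℂ, h₀ (QuotientAddGroup.mk z) ∈ m₀.skeleton ↔ z ∈ E) (m : PolygonalMap n Torus) :
    m.IsQuotientOfTiling V E ↔ m.IsFiniteCoverOf m₀ := by
  constructor
  · rintro ⟨a, b, hab, h, hV, hE⟩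
    refine isFiniteCoverOf_of_le hab hT.linearIndependent (fun w hw ↦ ?_) h h₀ hV hE hV₀ hE₀
    -- Translation by `w` does not change points of the quotient, so it preserves the preimage `V`
    -- of the vertices.
    obtain ⟨i, j, rfl⟩ := hT.exists_of_stable w fun z ↦ by
      rw [← hV, ← hV]
      have : (QuotientAddGroup.mk (z + w) : ℂ ⧸ AddSubgroup.closure {a, b}) =
          QuotientAddGroup.mk z := by
        rw [QuotientAddGroup.mk_add_of_mem z hw]
      rw [this]
    exact AddSubgroup.mem_closure_pair.2 ⟨i, j, by simp⟩
  · intro h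
    exact h.isQuotientOfTiling ⟨u, v, hT.linearIndependent, h₀, hV₀, hE₀⟩

theorem preconnectedSpace_of_common_point {n : ℕ} {G : Gluing n} (x : G.Space)
    (hx : ∀ f, ∃ y, Quot.mk _ ⟨f, y⟩ = x) : PreconnectedSpace G.Space := by
  have h : IsPreconnected (⋃ f : G.Face, Set.range fun y : Polygon n ↦ (Quot.mk _ ⟨f, y⟩ : G.Space)) := by
    refine isPreconnected_iUnion ⟨x, Set.mem_iInter.2 hx⟩ fun f ↦ ?_
    have : PreconnectedSpace (Polygon n) :=
      isPreconnected_iff_preconnectedSpace.1 (convex_convexHull ℝ _).isPreconnected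
    exact isPreconnected_range (continuous_quot_mk.comp continuous_sigmaMk)
  refine ⟨?_⟩
  convert h
  refine (Set.eq_univ_of_forall fun z ↦ ?_).symm
  obtain ⟨⟨f, y⟩, rfl⟩ := Quot.exists_rep z
  exact Set.mem_iUnion.2 ⟨f, y, rfl⟩

/-- A translation in affine coordinates is a translation. -/
theorem isIntegralAffine_one_iff_place {n : ℕ} {T : TilingModel n} {c u v : ℂ}
    (huv : LinearIndependent ℝ ![u, v]) (hT : ∀ x y : ℝ, T.place (x, y) = c + (x * u + y * v))
    {g : Equiv.Perm (ℝ × ℝ)} (hg : ∃ M k l, IsIntegralAffine g M k l) :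
    (∀ z w, T.place (g z) - T.place (g w) = T.place z - T.place w) ↔
      ∃ k l, IsIntegralAffine g (1, 0, 0, 1) k l := by
  obtain ⟨M, k, l, hM⟩ := hg
  constructor
  · intro h
    have h1 := h (1, 0) (0, 0)
    have h2 := h (0, 1) (0, 0)
    rw [hM, hM, hT, hT, hT, hT] at h1 h2
    obtain ⟨e1, e2⟩ := eq_of_add_mul_eq huv (x := M.1) (y := M.2.2.1) (x' := (1 : ℝ)) (y' := (0 : ℝ))
      (by push_cast at h1 ⊢; linear_combination h1)
    obtain ⟨e3, e4⟩ := eq_of_add_mul_eq huv (x := M.2.1) (y := M.2.2.2) (x' := (0 : ℝ)) (y' := (1 : ℝ))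
      (by push_cast at h2 ⊢; linear_combination h2)
    exact ⟨k, l, fun x y ↦ by rw [hM, e1, e2, e3, e4]; simp⟩
  · rintro ⟨k, l, hkl⟩ ⟨x, y⟩ ⟨x', y'⟩
    rw [hkl, hkl, hT, hT, hT, hT]
    push_cast
    ring

theorem polygonSymmetry_flagPerm {n : ℕ} [NeZero n] {G : Gluing n} {i : Fin 3} (hi : i ≠ 2)
    (s : G.Flag) (z : ℂ) : polygonSymmetry (G.flagPerm i s).1.2 (G.flagPerm i s).2 z =
      polygonSymmetry s.1.2 s.2 (polygonReflection n i z - polygonReflection n i 0) := by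
  fin_cases i
  · have : polygonReflection n 0 0 = 0 := by simp [polygonReflection]
    simp only [Fin.zero_eta, this, sub_zero]
    exact polygonSymmetry_not _ _ _
  · have : polygonReflection n 1 0 = 0 := by simp [polygonReflection]
    simp only [Fin.mk_one, this, sub_zero]
    exact polygonSymmetry_turn _ _
  · exact absurd rfl hi

/-- The axes of the reflections `0` and `2` are perpendicular, so their linear parts differ by the
half turn `-1`. -/
theorem polygonReflection_two_sub {n : ℕ} [NeZero n] (z : ℂ) :
    polygonReflection n 2 z - polygonReflection n 2 0 = -polygonReflection n 0 z := by
  simp [polygonReflection]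

theorem polygonSymmetry_add_of_neg {n : ℕ} [NeZero n] {d : ZMod n} (hd : corner n d = -1)
    (k : ZMod n) (b : Bool) (z : ℂ) : polygonSymmetry (k + d) b z = -polygonSymmetry k b z := by
  cases b <;> simp [corner_add, hd]

theorem exists_minimal_triangle : ∃ m₀ : PolygonalMap 3 Torus, m₀.toGluing = triangleGluing ∧
    ∃ h₀ : (ℂ ⧸ AddSubgroup.closure {1, zeta}) ≃ₜ Torus,
      (∀ z : ℂ, h₀ (QuotientAddGroup.mk z) ∈ m₀.vertices ↔ z ∈ triangularVertices) ∧
      ∀ z : ℂ, h₀ (QuotientAddGroup.mk z) ∈ m₀.skeleton ↔ z ∈ unitGraph triangularVertices := by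
  have hT := triangleModel_describes
  obtain ⟨q, hq⟩ := exists_isDevelopment_triangle (G := triangleGluing) (by
    ext1 ⟨⟨f, k⟩, b⟩
    fin_cases k <;> cases b <;> cases f <;> rfl) hT.exists_mem
  have : PreconnectedSpace triangleGluing.Space :=
    preconnectedSpace_of_common_point (Quot.mk _ ⟨false, side 3 0 0⟩) (by
      rintro (_ | _)
      · exact ⟨_, rfl⟩
      · exact ⟨_, (Quot.sound (Glued.of_side (G := triangleGluing) (false, 0) 0)).symm⟩)
  have hcube (k : ZMod 3) : corner 3 k ^ 3 = 1 := by
    have : k + k + k = 0 := by revert k; decide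
    rw [pow_three', ← corner_add, ← corner_add, this, corner_zero]
  -- The second triangle is the first one turned by 180 degrees, whence the sign. With it, flags
  -- correspond to positions of a tile up to translation.
  let φ : triangleGluing.Flag → ℂ →ₗ[ℝ] ℂ := fun s ↦
    (cond (s.1.1 : Bool) (-1) 1 : ℝ) • polygonSymmetry s.1.2 s.2
  refine hq.exists_polygonalMap hT ((false, 0), false) fun g hg ↦ ?_
  rw [hq.mem_deckGroup_iff (φ := φ) le_rfl ?_ ?_ ?_ _ hg,
    isIntegralAffine_one_iff_place linearIndependent_triangle triangleModel_place]
  · obtain ⟨S, hS⟩ := hT.exists_isIntegralAffine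
    obtain ⟨M, -, h⟩ := hS g hg
    exact ⟨M, h⟩
  · have hne (k k' : ZMod 3) (b b' : Bool) (h : -polygonSymmetry k b = polygonSymmetry k' b') :
        False := by
      have h0 := LinearMap.congr_fun h (corner 3 0)
      rw [LinearMap.neg_apply, polygonSymmetry_corner, polygonSymmetry_corner] at h0
      have h1 := congrArg (· ^ 3) h0
      simp only [Odd.neg_pow (by decide : Odd 3), hcube] at h1
      norm_num at h1
    rintro ⟨⟨_ | _, k⟩, b⟩ ⟨⟨_ | _, k'⟩, b'⟩ h <;> simp [φ] at h
    · obtain ⟨rfl, rfl⟩ := polygonSymmetry_inj le_rfl fun l ↦ LinearMap.congr_fun h (corner 3 l)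
      rfl
    · exact (hne _ _ _ _ h.symm).elim
    · exact (hne _ _ _ _ h).elim
    · obtain ⟨rfl, rfl⟩ := polygonSymmetry_inj le_rfl fun l ↦ LinearMap.congr_fun h (corner 3 l)
      rfl
  · rintro ⟨⟨_ | _, k⟩, b⟩ z w h <;> simp [φ] at h <;> exact polygonSymmetry_injective _ _ h
  · intro i s z
    by_cases hi : i = 2
    · subst hi
      obtain ⟨⟨f, k⟩, b⟩ := s
      have h1 := polygonSymmetry_not k b z
      have h2 : triangleGluing.flagPerm 2 ((f, k), b) = ((!f, k), !b) := by cases b <;> rfl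
      rw [h2, polygonReflection_two_sub, map_neg]
      cases f <;> simp [φ, h1]
    · have h1 := polygonSymmetry_flagPerm hi s z
      have h2 : (triangleGluing.flagPerm i s).1.1 = s.1.1 := by
        fin_cases i
        · rfl
        · rfl
        · exact absurd rfl hi
      simp only [φ, LinearMap.smul_apply, h1, h2]

theorem exists_minimal_square : ∃ m₀ : PolygonalMap 4 Torus, m₀.toGluing = squareGluing ∧
    ∃ h₀ : (ℂ ⧸ AddSubgroup.closure {1, Complex.I}) ≃ₜ Torus,
      (∀ z : ℂ, h₀ (QuotientAddGroup.mk z) ∈ m₀.vertices ↔ z ∈ squareVertices) ∧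
      ∀ z : ℂ, h₀ (QuotientAddGroup.mk z) ∈ m₀.skeleton ↔ z ∈ unitGraph squareVertices := by
  have hT := squareModel_describes
  obtain ⟨q, hq⟩ := exists_isDevelopment_square (G := squareGluing) (by
    ext1 ⟨⟨f, k⟩, b⟩
    fin_cases k <;> cases b <;> cases f <;> rfl) hT.exists_mem
  have : PreconnectedSpace squareGluing.Space :=
    preconnectedSpace_of_common_point (Quot.mk _ ⟨(), side 4 0 0⟩) fun _ ↦ ⟨_, rfl⟩
  refine hq.exists_polygonalMap hT (((), 0), false) fun g hg ↦ ?_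
  rw [hq.mem_deckGroup_iff (φ := fun s ↦ polygonSymmetry s.1.2 s.2) (by norm_num) ?_
      (fun s ↦ polygonSymmetry_injective _ _) ?_ _ hg,
    isIntegralAffine_one_iff_place linearIndependent_square squareModel_place]
  · obtain ⟨S, hS⟩ := hT.exists_isIntegralAffine
    obtain ⟨M, -, h⟩ := hS g hg
    exact ⟨M, h⟩
  · rintro ⟨⟨_, k⟩, b⟩ ⟨⟨_, k'⟩, b'⟩ h
    obtain ⟨rfl, rfl⟩ := polygonSymmetry_inj (by norm_num) fun l ↦ LinearMap.congr_fun h (corner _ l)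
    rfl
  · intro i s z
    by_cases hi : i = 2
    · subst hi
      obtain ⟨⟨f, k⟩, b⟩ := s
      -- Passing to the opposite side multiplies the position by `corner 4 2 = -1`, which is the
      -- half turn that distinguishes the linear parts of reflections `2` and `0`. For the hexagon
      -- this role is played by `corner 6 3`.
      have h2 : squareGluing.flagPerm 2 ((f, k), b) = ((f, k + 2), !b) := by cases b <;> rfl
      rw [h2, polygonReflection_two_sub, map_neg, ← polygonSymmetry_not,
        polygonSymmetry_add_of_neg corner_four_two]
    · exact polygonSymmetry_flagPerm hi s z

theorem exists_minimal_hexagon : ∃ m₀ : PolygonalMap 6 Torus, m₀.toGluing = hexagonGluing ∧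
    ∃ h₀ : (ℂ ⧸ AddSubgroup.closure {1 + zeta, 2 - zeta}) ≃ₜ Torus,
      (∀ z : ℂ, h₀ (QuotientAddGroup.mk z) ∈ m₀.vertices ↔ z ∈ hexagonalVertices) ∧
      ∀ z : ℂ, h₀ (QuotientAddGroup.mk z) ∈ m₀.skeleton ↔ z ∈ unitGraph hexagonalVertices := by
  have hT := hexagonModel_describes
  obtain ⟨q, hq⟩ := exists_isDevelopment_hexagon (G := hexagonGluing) (by
    ext1 ⟨⟨f, k⟩, b⟩
    fin_cases k <;> cases b <;> cases f <;> rfl) hT.exists_mem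
  have : PreconnectedSpace hexagonGluing.Space :=
    preconnectedSpace_of_common_point (Quot.mk _ ⟨(), side 6 0 0⟩) fun _ ↦ ⟨_, rfl⟩
  refine hq.exists_polygonalMap hT (((), 0), false) fun g hg ↦ ?_
  rw [hq.mem_deckGroup_iff (φ := fun s ↦ polygonSymmetry s.1.2 s.2) (by norm_num) ?_
      (fun s ↦ polygonSymmetry_injective _ _) ?_ _ hg,
    isIntegralAffine_one_iff_place (c := 0) linearIndependent_hexagon
      fun x y ↦ by rw [hexagonModel_place, zero_add]]
  · obtain ⟨S, hS⟩ := hT.exists_isIntegralAffine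
    obtain ⟨M, -, h⟩ := hS g hg
    exact ⟨M, h⟩
  · rintro ⟨⟨_, k⟩, b⟩ ⟨⟨_, k'⟩, b'⟩ h
    obtain ⟨rfl, rfl⟩ := polygonSymmetry_inj (by norm_num) fun l ↦ LinearMap.congr_fun h (corner _ l)
    rfl
  · intro i s z
    by_cases hi : i = 2
    · subst hi
      obtain ⟨⟨f, k⟩, b⟩ := s
      have h2 : hexagonGluing.flagPerm 2 ((f, k), b) = ((f, k + 3), !b) := by cases b <;> rfl
      rw [h2, polygonReflection_two_sub, map_neg, ← polygonSymmetry_not,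
        polygonSymmetry_add_of_neg corner_six_three]
    · exact polygonSymmetry_flagPerm hi s z

theorem ncard_eq_one_of_lattice {X : Type*} {u v : ℂ} (h : (ℂ ⧸ AddSubgroup.closure {u, v}) ≃ X)
    {S : Set X} (hS : ∀ z : ℂ, h (QuotientAddGroup.mk z) ∈ S ↔ ∃ i j : ℤ, z = i * u + j * v) :
    S.ncard = 1 := by
  rw [Set.ncard_eq_one]
  refine ⟨h (QuotientAddGroup.mk 0), Set.ext fun x ↦ ?_⟩
  obtain ⟨y, rfl⟩ := h.surjective x
  obtain ⟨z, rfl⟩ := QuotientAddGroup.mk_surjective y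
  rw [hS, Set.mem_singleton_iff, h.injective.eq_iff, eq_comm, QuotientAddGroup.eq,
    AddSubgroup.mem_closure_pair]
  simp [eq_comm]

theorem ncard_eq_two_of_hexagonal {X : Type*}
    (h : (ℂ ⧸ AddSubgroup.closure {1 + zeta, 2 - zeta}) ≃ X)
    {S : Set X} (hS : ∀ z : ℂ, h (QuotientAddGroup.mk z) ∈ S ↔ z ∈ hexagonalVertices) :
    S.ncard = 2 := by
  rw [Set.ncard_eq_two]
  refine ⟨h (QuotientAddGroup.mk 1), h (QuotientAddGroup.mk (-1)), fun e ↦ ?_, Set.ext fun x ↦ ?_⟩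
  · rw [h.injective.eq_iff, QuotientAddGroup.eq, AddSubgroup.mem_closure_pair] at e
    obtain ⟨i, j, hij⟩ := e
    have h1 : (((i + 2 * j : ℤ) : ℝ) * 1 + ((i - j : ℤ) : ℝ) * zeta : ℂ) =
        (-2 : ℝ) * 1 + (0 : ℝ) * zeta := by
      simp only [zsmul_eq_mul] at hij
      push_cast
      linear_combination hij
    obtain ⟨e1, e2⟩ := eq_of_add_mul_eq linearIndependent_one_zeta h1
    have e1' : i + 2 * j = -2 := by exact_mod_cast e1
    have e2' : i - j = 0 := by exact_mod_cast e2
    omega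
  · obtain ⟨y, rfl⟩ := h.surjective x
    obtain ⟨z, rfl⟩ := QuotientAddGroup.mk_surjective y
    rw [hS, Set.mem_insert_iff, Set.mem_singleton_iff, h.injective.eq_iff, h.injective.eq_iff,
      QuotientAddGroup.eq, QuotientAddGroup.eq, AddSubgroup.mem_closure_pair,
      AddSubgroup.mem_closure_pair]
    obtain ⟨e, he⟩ := exists_coordinates linearIndependent_hexagon
    obtain ⟨⟨x, y⟩, rfl⟩ := e.symm.surjective z
    simp only [he, Complex.real_smul, mem_hexagonalVertices, zsmul_eq_mul, exists_or]
    -- The vertices `1` and `-1` have coordinates `(1 / 3, 1 / 3)` and `(-1 / 3, -1 / 3)`; with `c =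
    -- 1 / 3` and `c = -1 / 3`, membership in their cosets is matched with the two classes of
    -- vertices.
    have key (c : ℝ) : (∃ i j : ℤ, x = i + c ∧ y = j + c) ↔ ∃ i j : ℤ,
        (i * (1 + zeta) + j * (2 - zeta) : ℂ) = -(x * (1 + zeta) + y * (2 - zeta)) + 3 * c := by
      constructor
      · rintro ⟨i, j, rfl, rfl⟩
        exact ⟨-i, -j, by push_cast; ring⟩
      · rintro ⟨i, j, hij⟩
        obtain ⟨h1, h2⟩ := eq_of_add_mul_eq linearIndependent_hexagon (x := x) (y := y)
          (x' := ((-i : ℤ) : ℝ) + c) (y' := ((-j : ℤ) : ℝ) + c)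
          (by push_cast; linear_combination hij)
        exact ⟨-i, -j, h1, h2⟩
    have h1 := key (1 / 3)
    have h2 := key (-1 / 3)
    have e1 : (3 * ((1 / 3 : ℝ) : ℂ)) = 1 := by push_cast; norm_num
    have e2 : (3 * ((-1 / 3 : ℝ) : ℂ)) = -1 := by push_cast; norm_num
    have e3 (t : ℝ) : t + -1 / 3 = t - 1 / 3 := by ring
    simp only [e1, e2, e3] at h1 h2
    rw [h1, h2]

end TorusMap

end

/-! ### The theorem for triangulations, quadrangulations and hexangulations -/

theorem mainTheorem11 :
    (∃ m₀ : TorusMap.PolygonalMap 3 TorusMap.Torus,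
      m₀.toGluing = TorusMap.triangleGluing ∧ m₀.vertices.ncard = 1 ∧
      ∀ m : TorusMap.PolygonalMap 3 TorusMap.Torus,
        (m.NoExceptionalVertices → m.IsQuotientOfTiling TorusMap.triangularVertices
          (TorusMap.unitGraph TorusMap.triangularVertices)) ∧
        (m.IsQuotientOfTiling TorusMap.triangularVertices
          (TorusMap.unitGraph TorusMap.triangularVertices) ↔ m.IsFiniteCoverOf m₀)) ∧
    (∃ m₀ : TorusMap.PolygonalMap 4 TorusMap.Torus,
      m₀.toGluing = TorusMap.squareGluing ∧ m₀.vertices.ncard = 1 ∧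
      ∀ m : TorusMap.PolygonalMap 4 TorusMap.Torus,
        (m.NoExceptionalVertices → m.IsQuotientOfTiling TorusMap.squareVertices
          (TorusMap.unitGraph TorusMap.squareVertices)) ∧
        (m.IsQuotientOfTiling TorusMap.squareVertices
          (TorusMap.unitGraph TorusMap.squareVertices) ↔ m.IsFiniteCoverOf m₀)) ∧
    (∃ m₀ : TorusMap.PolygonalMap 6 TorusMap.Torus,
      m₀.toGluing = TorusMap.hexagonGluing ∧ m₀.vertices.ncard = 2 ∧
      ∀ m : TorusMap.PolygonalMap 6 TorusMap.Torus,
        (m.NoExceptionalVertices → m.IsQuotientOfTiling TorusMap.hexagonalVertices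
          (TorusMap.unitGraph TorusMap.hexagonalVertices)) ∧
        (m.IsQuotientOfTiling TorusMap.hexagonalVertices
          (TorusMap.unitGraph TorusMap.hexagonalVertices) ↔ m.IsFiniteCoverOf m₀)) := by
  refine ⟨?_, ?_, ?_⟩
  · obtain ⟨m₀, hm₀, h₀, hV, hE⟩ := TorusMap.exists_minimal_triangle
    refine ⟨m₀, hm₀, TorusMap.ncard_eq_one_of_lattice h₀.toEquiv fun z ↦ (hV z).trans ?_, fun m ↦
      ⟨fun h ↦ h.isQuotientOfTiling_triangle, TorusMap.PolygonalMap.isQuotientOfTiling_iff_isFiniteCoverOf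
        TorusMap.triangleModel_describes h₀ hV hE m⟩⟩
    simp [TorusMap.triangularVertices]
  · obtain ⟨m₀, hm₀, h₀, hV, hE⟩ := TorusMap.exists_minimal_square
    refine ⟨m₀, hm₀, TorusMap.ncard_eq_one_of_lattice h₀.toEquiv fun z ↦ (hV z).trans ?_, fun m ↦
      ⟨fun h ↦ h.isQuotientOfTiling_square, TorusMap.PolygonalMap.isQuotientOfTiling_iff_isFiniteCoverOf
        TorusMap.squareModel_describes h₀ hV hE m⟩⟩
    simp [TorusMap.squareVertices]
  · obtain ⟨m₀, hm₀, h₀, hV, hE⟩ := TorusMap.exists_minimal_hexagon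
    exact ⟨m₀, hm₀, TorusMap.ncard_eq_two_of_hexagonal h₀.toEquiv hV, fun m ↦
      ⟨fun h ↦ h.isQuotientOfTiling_hexagon, TorusMap.PolygonalMap.isQuotientOfTiling_iff_isFiniteCoverOf
        TorusMap.hexagonModel_describes h₀ hV hE m⟩⟩
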